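/- Let $(M,g)$ be a generalized Robertson-Walker (GRW) space-time of dimension $n\ge 3$ with Chen vector $X$; that is, $M$ is a smooth $n$-manifold, $g$ a smooth metric of signature $(-,+,\dots,+)$, and $X$ a smooth vector field with $X^2:=X^jX_j<0$ everywhere and $$\nabla_j X_k=\rho\, g_{jk}$$ for a smooth scalar field $\rho$. Let $R_{jk}$ be the Ricci tensor, $R_{jklm}$ the Riemann tensor (sign fixed by $R_{kl}=-g^{jm}R_{jklm}$), $R$ the curvature scalar, and $$C_{jklm}=R_{jklm}+\tfrac{1}{n-2}\left(g_{jm}R_{kl}-g_{km}R_{jl}+R_{jm}g_{kl}-R_{km}g_{jl}\right)-R\,\tfrac{g_{jm}g_{kl}-g_{jl}g_{km}}{(n-1)(n-2)}$$ the Weyl tensor. Consider the two conditions (a) the Weyl tensor is harmonic: $\nabla^m C_{jklm}=0$ on $M$; (b) the space-time is a perfect fluid (quasi-Einstein) space-time with respect to $X$: there are smooth scalar fields $\alpha,\beta$ on $M$ with $R_{jk}=\alpha\, g_{jk}+\beta\,\dfrac{X_jX_k}{X^2}$. Then (b) implies (a). Moreover, suppose that either $n=3$, or that every point of $M$ lies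 on an integral curve of $X$ along which $\rho$ does not vanish identically (for a warped product $-dt^2+q(t)^2g^*$ with $X=q\,\partial_t$, $\rho=q'$, this says that the warping function $q$ is not constant). Then (a) and (b) are equivalent. -/

import Mathlib

open scoped Manifold ContDiff Topology

noncomputable section

namespace GRW

/-! ## Tensor calculus in coordinates

`G` is the matrix field `g_{ij}` of a metric on (an open subset of) `ℝⁿ`. All sums over repeated
indices are written out; the position of an index (up or down) is stated in each docstring. -/

/-- The coordinate space `ℝⁿ`. -/
abbrev Coord (n : ℕ) : Type := EuclideanSpace ℝ (Fin n)

section Coordinates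

variable {n : ℕ}

/-- The partial derivative `∂_i f` at `x`. -/
def pd (i : Fin n) (f : Coord n → ℝ) (x : Coord n) : ℝ :=
  fderiv ℝ f x (EuclideanSpace.single i 1)

/-- The inverse metric `g^{ij}`. -/
def invMetric (G : Coord n → Matrix (Fin n) (Fin n) ℝ) (i j : Fin n) (x : Coord n) : ℝ :=
  (G x)⁻¹ i j

/-- The Christoffel symbols `Γ^m_{ij}` of the Levi-Civita connection. -/
def christoffel (G : Coord n → Matrix (Fin n) (Fin n) ℝ) (m i j : Fin n) (x : Coord n) : ℝ :=
  (1 / 2) * ∑ l, invMetric G m l x *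
    (pd i (fun y => G y l j) x + pd j (fun y => G y i l) x - pd l (fun y => G y i j) x)

/-- The covariant derivative `∇_j w_k` of a covector field `w`. -/
def covDeriv₁ (G : Coord n → Matrix (Fin n) (Fin n) ℝ) (w : Fin n → Coord n → ℝ)
    (j k : Fin n) (x : Coord n) : ℝ :=
  pd j (w k) x - ∑ m, christoffel G m j k x * w m x

/-- The covariant derivative `∇_s T_{jklm}` of a tensor field `T` of type `(0,4)`. -/
def covDeriv₄ (G : Coord n → Matrix (Fin n) (Fin n) ℝ)
    (T : Fin n → Fin n → Fin n → Fin n → Coord n → ℝ) (s j k l m : Fin n) (x : Coord n) : ℝ :=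
  pd s (T j k l m) x
    - ∑ a, christoffel G a s j x * T a k l m x - ∑ a, christoffel G a s k x * T j a l m x
    - ∑ a, christoffel G a s l x * T j k a m x - ∑ a, christoffel G a s m x * T j k l a x

/-- The Riemann tensor `R_{ijk}{}^m`, with the sign fixed by
`∇_i ∇_j w_k - ∇_j ∇_i w_k = R_{ijk}{}^m w_m`. -/
def riemannUp (G : Coord n → Matrix (Fin n) (Fin n) ℝ) (i j k m : Fin n) (x : Coord n) : ℝ :=
  pd j (christoffel G m i k) x - pd i (christoffel G m j k) x
    + ∑ l, (christoffel G m j l x * christoffel G l i k x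
      - christoffel G m i l x * christoffel G l j k x)

/-- The Riemann tensor `R_{jklm} = R_{jkl}{}^a g_{am}`. -/
def riemann (G : Coord n → Matrix (Fin n) (Fin n) ℝ) (j k l m : Fin n) (x : Coord n) : ℝ :=
  ∑ a, riemannUp G j k l a x * G x a m

/-- The Ricci tensor `R_{kl} = - R_{jkl}{}^j` (positive on round spheres). -/
def ricci (G : Coord n → Matrix (Fin n) (Fin n) ℝ) (k l : Fin n) (x : Coord n) : ℝ :=
  -∑ j, riemannUp G j k l j x

/-- The curvature scalar `R = g^{kl} R_{kl}`. -/
def scalar (G : Coord n → Matrix (Fin n) (Fin n) ℝ) (x : Coord n) : ℝ :=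
  ∑ k, ∑ l, invMetric G k l x * ricci G k l x

/-- The Weyl tensor `C_{jklm}`. -/
def weyl (G : Coord n → Matrix (Fin n) (Fin n) ℝ) (j k l m : Fin n) (x : Coord n) : ℝ :=
  riemann G j k l m x
    + 1 / ((n : ℝ) - 2) * (G x j m * ricci G k l x - G x k m * ricci G j l x
      + ricci G j m x * G x k l - ricci G k m x * G x j l)
    - scalar G x * (G x j m * G x k l - G x j l * G x k m) / (((n : ℝ) - 1) * ((n : ℝ) - 2))

/-- The divergence `∇^m C_{jklm} = g^{ms} ∇_s C_{jklm}` of the Weyl tensor. -/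
def divWeyl (G : Coord n → Matrix (Fin n) (Fin n) ℝ) (j k l : Fin n) (x : Coord n) : ℝ :=
  ∑ m, ∑ s, invMetric G m s x * covDeriv₄ G (weyl G) s j k l m x

end Coordinates

/-! ## Lorentzian manifolds -/

section Manifold

variable {n : ℕ} {M : Type*} [TopologicalSpace M] [ChartedSpace (Coord n) M]

/-- The coordinate vector field `∂_i` of the chart `e`, at the point with coordinates `x`. -/
def coordVec (e : OpenPartialHomeomorph M (Coord n)) (i : Fin n) (x : Coord n) :
    TangentSpace (𝓡 n) (e.symm x) :=
  mfderiv (𝓡 n) (𝓡 n) e.symm x (EuclideanSpace.single i (1 : ℝ) : Coord n)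

/-- The components `B_{ij} = B(∂_i, ∂_j)`, in the chart `e`, of a field `B` of bilinear forms on
the tangent spaces. -/
def components (B : ∀ p : M, LinearMap.BilinForm ℝ (TangentSpace (𝓡 n) p))
    (e : OpenPartialHomeomorph M (Coord n)) (x : Coord n) : Matrix (Fin n) (Fin n) ℝ :=
  Matrix.of fun i j => B (e.symm x) (coordVec e i x) (coordVec e j x)

variable (n M) in
/-- A smooth Lorentzian metric, of signature `(-,+,…,+)`: a symmetric bilinear form on every tangent
space, negative on some vector and positive definite on the orthogonal complement of that vector,
with smooth components in every smooth chart. -/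
structure LorentzMetric where
  /-- The bilinear form on each tangent space. -/
  form : ∀ p : M, LinearMap.BilinForm ℝ (TangentSpace (𝓡 n) p)
  symm : ∀ p u v, form p u v = form p v u
  lorentzian : ∀ p, ∃ u, form p u u < 0 ∧ ∀ v, form p u v = 0 → v ≠ 0 → 0 < form p v v
  smooth : ∀ e ∈ IsManifold.maximalAtlas (𝓡 n) ∞ M, ∀ i j,
    ContDiffOn ℝ ∞ (fun x => components form e x i j) e.target

namespace LorentzMetric

variable (g : LorentzMetric n M)

/-- The matrix field `g_{ij}` of the metric in the chart `e`. -/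
abbrev matrix (e : OpenPartialHomeomorph M (Coord n)) : Coord n → Matrix (Fin n) (Fin n) ℝ :=
  components g.form e

/-- The covariant components `X_k = g(X, ∂_k)` of a vector field in the chart `e`. -/
def lower (X : ∀ p : M, TangentSpace (𝓡 n) p) (e : OpenPartialHomeomorph M (Coord n))
    (k : Fin n) (x : Coord n) : ℝ :=
  g.form (e.symm x) (X (e.symm x)) (coordVec e k x)

/-- `X² = X^j X_j`. -/
def sq (X : ∀ p : M, TangentSpace (𝓡 n) p) (p : M) : ℝ := g.form p (X p) (X p)

/-- `X` is a Chen vector (timelike concircular vector field) with scalar field `ρ`: it is smooth,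
`X^j X_j < 0`, and `∇_j X_k = ρ g_{jk}`. A Lorentzian manifold of dimension at least three that
carries such a field is a generalized Robertson-Walker space-time. -/
structure IsChenVector [IsManifold (𝓡 n) ∞ M]
    (X : ∀ p : M, TangentSpace (𝓡 n) p) (ρ : M → ℝ) : Prop where
  smooth : ContMDiff (𝓡 n) (𝓡 n).tangent ∞ (fun p => (⟨p, X p⟩ : TangentBundle (𝓡 n) M))
  smooth_scalar : ContMDiff (𝓡 n) 𝓘(ℝ, ℝ) ∞ ρ
  timelike : ∀ p, g.sq X p < 0
  concircular : ∀ e ∈ IsManifold.maximalAtlas (𝓡 n) ∞ M, ∀ x ∈ e.target, ∀ j k,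
    covDeriv₁ (g.matrix e) (g.lower X e) j k x = ρ (e.symm x) * g.matrix e x j k

/-- The Weyl tensor is harmonic: `∇^m C_{jklm} = 0`. -/
def HarmonicWeyl : Prop :=
  ∀ e ∈ IsManifold.maximalAtlas (𝓡 n) ∞ M, ∀ x ∈ e.target, ∀ j k l,
    divWeyl (g.matrix e) j k l x = 0

/-- The Ricci tensor has the perfect-fluid form `R_{jk} = α g_{jk} + β X_j X_k / X²`
with scalar fields `α`, `β` on the manifold. -/
def IsPerfectFluid (X : ∀ p : M, TangentSpace (𝓡 n) p) : Prop :=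
  ∃ α β : M → ℝ, ContMDiff (𝓡 n) 𝓘(ℝ, ℝ) ∞ α ∧ ContMDiff (𝓡 n) 𝓘(ℝ, ℝ) ∞ β ∧
    ∀ e ∈ IsManifold.maximalAtlas (𝓡 n) ∞ M, ∀ x ∈ e.target, ∀ j k,
      ricci (g.matrix e) j k x = α (e.symm x) * g.matrix e x j k
        + β (e.symm x) * (g.lower X e j x * g.lower X e k x / g.sq X (e.symm x))

end LorentzMetric

/-- Every point lies on an integral curve of `X` along which `ρ` does not vanish identically. For
the metric `-dt² + q(t)² g*` with `X = q ∂_t` and `ρ = q'`, this says that `q` is not constant. -/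
def NonStatic (X : ∀ p : M, TangentSpace (𝓡 n) p) (ρ : M → ℝ) : Prop :=
  ∀ p : M, ∃ (γ : ℝ → M) (a b : ℝ), IsMIntegralCurveOn γ X (Set.Ioo a b) ∧
    (∃ t ∈ Set.Ioo a b, γ t = p) ∧ ∃ t ∈ Set.Ioo a b, ρ (γ t) ≠ 0

end Manifold

end GRW

end

/-! The method is to contract every curvature identity with `X`. Commuting derivatives in `∇_j X_k =
ρ g_{jk}` gives `R_{ijk}{}^m X_m = ∂_i ρ g_{jk} - ∂_j ρ g_{ik}` (`sum_curvature_mul`). Skew-symmetry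
of the Riemann tensor then forces `∂_i ρ = σ X_i` (`pd_potential`), so `X` is an eigenvector of the
Ricci tensor with eigenvalue `λ = -(n-1)σ`. One more derivative expresses `X^l ∇_s R_{ijkl}` and
`X^l ∇_s R_{kl}` through the Hessian of `ρ` and `ρ` times curvature (`pairing_covRiemann`,
`pairing_covRicci`). Independently, the contracted Bianchi identity makes the divergence of the Weyl
tensor `(n-3)/(n-2)` times the Cotton tensor (`divWeyl_eq`).

(b) implies (a): write the Ricci tensor as `α g + b X X`. Its contraction with `X`, its trace and
its divergence give three relations between `dα`, `db` and `dR`; for `n ≥ 4` they make all three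
multiples of `X`, and the Cotton tensor cancels. For `n = 3` the factor `n - 3` vanishes.

(a) implies (b), `n ≥ 4`: the vanishing Cotton tensor, contracted with `X` and compared with the
Bianchi identity, shows that `ρ R_{kl}` is a combination of `g_{kl}` and `X_k X_l`
(`mul_ricci_eq_fluid`). This is void where `ρ = 0`, but `∇_X` of the Ricci tensor has the same form
there too (`pairing_covRicci_eq_fluid`). Let `f` be the squared length of the trace-free part of the
Ricci tensor on the complement of `X`. Then `ρ f = 0` and `X f = 0`, so `f` is constant along
integral curves, and a point of the curve with `ρ ≠ 0` makes it zero. As `X` is timelike, the metric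
is definite on the complement, so `f = 0` kills that part (`isFluidAt_of_anisotropy_eq_zero`).

For `n = 3` the Weyl tensor vanishes algebraically, and its contraction with `X` already yields (b)
(`isFluidAt_of_dim_three`).

The computations are done in a chart. The transformation law of the Ricci tensor makes the scalar
invariants, hence `f` and the fluid coefficients, smooth functions on `M`. -/

noncomputable section

namespace GRW

/-! ### Calculus of partial derivatives on coordinate space. -/

section PartialDerivatives

variable {n : ℕ} {U : Set (Coord n)} {f g : Coord n → ℝ} {x : Coord n}

theorem differentiableAt_of_contDiffOn (hU : IsOpen U) (hf : ContDiffOn ℝ ∞ f U) (hx : x ∈ U) :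
    DifferentiableAt ℝ f x :=
  (hf.contDiffAt (hU.mem_nhds hx)).differentiableAt (by simp)

theorem pd_congr (hU : IsOpen U) (h : ∀ y ∈ U, f y = g y) (hx : x ∈ U) (i : Fin n) :
    pd i f x = pd i g x := by
  have : f =ᶠ[𝓝 x] g := Filter.eventually_of_mem (hU.mem_nhds hx) h
  simp only [pd, this.fderiv_eq]

theorem pd_const (c : ℝ) (i : Fin n) : pd i (fun _ => c) x = 0 := by simp [pd]

theorem pd_add (hf : DifferentiableAt ℝ f x) (hg : DifferentiableAt ℝ g x) (i : Fin n) :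
    pd i (fun y => f y + g y) x = pd i f x + pd i g x := by
  simp only [pd, fderiv_fun_add hf hg, add_apply]

theorem pd_sub (hf : DifferentiableAt ℝ f x) (hg : DifferentiableAt ℝ g x) (i : Fin n) :
    pd i (fun y => f y - g y) x = pd i f x - pd i g x := by
  simp only [pd, fderiv_fun_sub hf hg, sub_apply]

theorem pd_neg (i : Fin n) : pd i (fun y => - f y) x = - pd i f x := by
  simp only [pd, fderiv_fun_neg, neg_apply]

theorem pd_mul (hf : DifferentiableAt ℝ f x) (hg : DifferentiableAt ℝ g x) (i : Fin n) :
    pd i (fun y => f y * g y) x = pd i f x * g x + f x * pd i g x := by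
  simp only [pd, fderiv_fun_mul hf hg, add_apply, smul_apply,
    smul_eq_mul]
  ring

theorem pd_const_mul (c : ℝ) (hf : DifferentiableAt ℝ f x) (i : Fin n) :
    pd i (fun y => c * f y) x = c * pd i f x := by
  rw [pd_mul (by fun_prop) hf, pd_const]; ring

theorem pd_sum {ι : Type*} (s : Finset ι) {F : ι → Coord n → ℝ}
    (hF : ∀ a ∈ s, DifferentiableAt ℝ (F a) x) (i : Fin n) :
    pd i (fun y => ∑ a ∈ s, F a y) x = ∑ a ∈ s, pd i (F a) x := by
  simp only [pd, fderiv_fun_sum hF, sum_apply]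

theorem contDiffOn_pd (hU : IsOpen U) (hf : ContDiffOn ℝ ∞ f U) (i : Fin n) :
    ContDiffOn ℝ ∞ (pd i f) U := by
  have h := hf.fderiv_of_isOpen hU (m := ∞) (by simp)
  exact h.clm_apply contDiffOn_const

theorem pd_comm (hU : IsOpen U) (hf : ContDiffOn ℝ ∞ f U) (hx : x ∈ U) (i j : Fin n) :
    pd i (pd j f) x = pd j (pd i f) x := by
  have hs : IsSymmSndFDerivAt ℝ f x :=
    (hf.contDiffAt (hU.mem_nhds hx)).isSymmSndFDerivAt
      (by rw [minSmoothness_of_isRCLikeNormedField]; exact WithTop.coe_le_coe.2 le_top)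
  have hd : DifferentiableAt ℝ (fderiv ℝ f) x :=
    ((hf.fderiv_of_isOpen hU (m := ∞) (by simp)).contDiffAt
      (hU.mem_nhds hx)).differentiableAt (by simp)
  have key : ∀ u v : Coord n, fderiv ℝ (fun y => fderiv ℝ f y u) x v
      = fderiv ℝ (fderiv ℝ f) x v u := fun u v => by
    rw [fderiv_clm_apply hd (by fun_prop)]; simp
  unfold pd
  rw [key, key]
  exact hs _ _

end PartialDerivatives

/-! ### Calculus of matrix-valued functions. -/

section MatrixFields

variable {n : ℕ} {U : Set (Coord n)} {A B : Coord n → Matrix (Fin n) (Fin n) ℝ} {x : Coord n}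

/-- A matrix field with smooth entries on `U`. -/
def SmoothOn (A : Coord n → Matrix (Fin n) (Fin n) ℝ) (U : Set (Coord n)) : Prop :=
  ∀ a b, ContDiffOn ℝ ∞ (fun y => A y a b) U

/-- The entrywise partial derivative of a matrix field. -/
def pdM (i : Fin n) (A : Coord n → Matrix (Fin n) (Fin n) ℝ) (x : Coord n) :
    Matrix (Fin n) (Fin n) ℝ :=
  Matrix.of fun a b => pd i (fun y => A y a b) x

theorem SmoothOn.differentiableAt (hA : SmoothOn A U) (hU : IsOpen U) (hx : x ∈ U) (a b : Fin n) :
    DifferentiableAt ℝ (fun y => A y a b) x :=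
  differentiableAt_of_contDiffOn hU (hA a b) hx

theorem SmoothOn.add (hA : SmoothOn A U) (hB : SmoothOn B U) : SmoothOn (fun y => A y + B y) U :=
  fun a b => (hA a b).add (hB a b)

theorem SmoothOn.sub (hA : SmoothOn A U) (hB : SmoothOn B U) : SmoothOn (fun y => A y - B y) U :=
  fun a b => (hA a b).sub (hB a b)

theorem SmoothOn.transpose (hA : SmoothOn A U) : SmoothOn (fun y => (A y).transpose) U :=
  fun a b => hA b a

theorem SmoothOn.mul (hA : SmoothOn A U) (hB : SmoothOn B U) : SmoothOn (fun y => A y * B y) U :=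
  fun a b => by
    simp only [Matrix.mul_apply]
    exact ContDiffOn.sum fun c _ => (hA a c).mul (hB c b)

theorem SmoothOn.pdM (hA : SmoothOn A U) (hU : IsOpen U) (i : Fin n) : SmoothOn (pdM i A) U :=
  fun a b => contDiffOn_pd hU (hA a b) i

theorem SmoothOn.det (hA : SmoothOn A U) : ContDiffOn ℝ ∞ (fun y => (A y).det) U := by
  simp only [Matrix.det_apply']
  exact ContDiffOn.sum fun c _ => contDiffOn_const.mul (contDiffOn_prod fun d _ => hA _ _)

theorem SmoothOn.adjugate (hA : SmoothOn A U) : SmoothOn (fun y => (A y).adjugate) U := by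
  intro a b
  simp only [Matrix.adjugate_apply]
  refine SmoothOn.det fun c d => ?_
  by_cases h : c = b
  · subst h; simp only [Matrix.updateRow_self]; exact contDiffOn_const
  · simp only [Matrix.updateRow_ne h]; exact hA c d

/-- Cramer's rule: the adjugate and the determinant are polynomials in the entries. -/
theorem SmoothOn.inv (hA : SmoothOn A U) (hdet : ∀ x ∈ U, (A x).det ≠ 0) :
    SmoothOn (fun y => (A y)⁻¹) U := by
  intro a b
  simp only [Matrix.inv_def, Ring.inverse_eq_inv', Matrix.smul_apply, smul_eq_mul]
  exact (hA.det.inv hdet).mul (hA.adjugate a b)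

theorem pdM_congr (hU : IsOpen U) (h : ∀ y ∈ U, A y = B y) (hx : x ∈ U) (i : Fin n) :
    pdM i A x = pdM i B x := by
  ext a b
  exact pd_congr hU (fun y hy => by rw [h y hy]) hx i

theorem pdM_const (C : Matrix (Fin n) (Fin n) ℝ) (i : Fin n) : pdM i (fun _ => C) x = 0 := by
  ext a b
  exact pd_const _ _

theorem pdM_transpose (i : Fin n) :
    pdM i (fun y => (A y).transpose) x = (pdM i A x).transpose := rfl

theorem pdM_add (hU : IsOpen U) (hA : SmoothOn A U) (hB : SmoothOn B U) (hx : x ∈ U) (i : Fin n) :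
    pdM i (fun y => A y + B y) x = pdM i A x + pdM i B x := by
  ext a b
  exact pd_add (hA.differentiableAt hU hx a b) (hB.differentiableAt hU hx a b) i

theorem pdM_sub (hU : IsOpen U) (hA : SmoothOn A U) (hB : SmoothOn B U) (hx : x ∈ U) (i : Fin n) :
    pdM i (fun y => A y - B y) x = pdM i A x - pdM i B x := by
  ext a b
  exact pd_sub (hA.differentiableAt hU hx a b) (hB.differentiableAt hU hx a b) i

theorem pdM_mul (hU : IsOpen U) (hA : SmoothOn A U) (hB : SmoothOn B U) (hx : x ∈ U) (i : Fin n) :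
    pdM i (fun y => A y * B y) x = pdM i A x * B x + A x * pdM i B x := by
  ext a b
  simp only [pdM, Matrix.of_apply, Matrix.mul_apply, Matrix.add_apply]
  have hA' := fun c => hA.differentiableAt hU hx a c
  have hB' := fun c => hB.differentiableAt hU hx c b
  rw [← Finset.sum_add_distrib,
    pd_sum _ (F := fun c y => A y a c * B y c b) (fun c _ => (hA' c).mul (hB' c))]
  exact Finset.sum_congr rfl fun c _ => pd_mul (hA' c) (hB' c) i

theorem pdM_comm (hU : IsOpen U) (hA : SmoothOn A U) (hx : x ∈ U) (i j : Fin n) :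
    pdM i (pdM j A) x = pdM j (pdM i A) x := by
  ext a b
  exact pd_comm hU (hA a b) hx i j

theorem pd_trace (hU : IsOpen U) (hA : SmoothOn A U) (hx : x ∈ U) (i : Fin n) :
    pd i (fun y => (A y).trace) x = (pdM i A x).trace := by
  simp only [Matrix.trace, Matrix.diag_apply]
  exact pd_sum _ (fun a _ => hA.differentiableAt hU hx a a) i

end MatrixFields

/-- A smooth nondegenerate metric on an open set of the coordinate space. -/
structure IsMetricOn {n : ℕ} (G : Coord n → Matrix (Fin n) (Fin n) ℝ) (U : Set (Coord n)) :
    Prop where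
  isOpen : IsOpen U
  smooth : SmoothOn G U
  transpose_eq : ∀ x, (G x).transpose = G x
  det_ne_zero : ∀ x ∈ U, (G x).det ≠ 0

/-! ### The Levi-Civita connection and its curvature in matrix form, with the Bianchi identities. -/

section Connection

variable {n : ℕ} (G : Coord n → Matrix (Fin n) (Fin n) ℝ)

/-- The connection matrices: the entry `(m, k)` of `connection G i x` is `Γ^m_{ik}`. -/
def connection (i : Fin n) (x : Coord n) : Matrix (Fin n) (Fin n) ℝ :=
  Matrix.of fun m k => christoffel G m i k x

/-- The curvature matrices: the entry `(m, k)` of `curvature G i j x` is `R_{ijk}{}^m`. -/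
def curvature (i j : Fin n) (x : Coord n) : Matrix (Fin n) (Fin n) ℝ :=
  Matrix.of fun m k => riemannUp G i j k m x

/-- The covariant derivative `∇_s T_{kl}` of a tensor field of type `(0,2)`. -/
def covDeriv₂ (T : Fin n → Fin n → Coord n → ℝ) (s k l : Fin n) (x : Coord n) : ℝ :=
  pd s (T k l) x - ∑ a, christoffel G a s k x * T a l x - ∑ a, christoffel G a s l x * T k a x

/-- The covariant derivative of the curvature matrices. -/
def covCurvature (s j k : Fin n) (x : Coord n) : Matrix (Fin n) (Fin n) ℝ :=
  pdM s (curvature G j k) x + connection G s x * curvature G j k x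
    - curvature G j k x * connection G s x
    - ∑ a, christoffel G a s j x • curvature G a k x
    - ∑ a, christoffel G a s k x • curvature G j a x

variable {G} {U : Set (Coord n)} {x : Coord n}

theorem curvature_eq (i j : Fin n) (x : Coord n) :
    curvature G i j x = pdM j (connection G i) x - pdM i (connection G j) x
      + (connection G j x * connection G i x - connection G i x * connection G j x) := by
  ext m k
  simp [curvature, riemannUp, pdM, connection, Matrix.mul_apply, Finset.sum_sub_distrib]

theorem curvature_swap (i j : Fin n) (x : Coord n) : curvature G j i x = - curvature G i j x := by
  rw [curvature_eq, curvature_eq]; abel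

theorem connection_eq (i : Fin n) (x : Coord n) :
    connection G i x = (1 / 2 : ℝ) • ((G x)⁻¹ * Matrix.of fun l j =>
      pd i (fun y => G y l j) x + pd j (fun y => G y i l) x - pd l (fun y => G y i j) x) := by
  ext m k
  simp [connection, christoffel, invMetric, Matrix.mul_apply]

/-- The Levi-Civita connection is the only symmetric connection that preserves the metric. -/
theorem eq_connection_of_symm_of_compat (hdet : IsUnit (G x).det)
    (hG : (G x).transpose = G x) (A : Fin n → Matrix (Fin n) (Fin n) ℝ)
    (hsymm : ∀ i j m, A i m j = A j m i)
    (hcompat : ∀ s, pdM s G x = (A s).transpose * G x + G x * A s) (i : Fin n) :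
    connection G i x = A i := by
  have hK : ∀ s a b, (G x * A s) a b = (G x * A b) a s := fun s a b => by
    simp only [Matrix.mul_apply, hsymm s b]
  have hd : ∀ s a b, pd s (fun y => G y a b) x = (G x * A s) b a + (G x * A s) a b := by
    intro s a b
    have h := congrFun (congrFun (hcompat s) a) b
    have ht : (A s).transpose * G x = (G x * A s).transpose := by
      rw [Matrix.transpose_mul, hG]
    rw [ht] at h
    exact h
  rw [connection_eq, ← Matrix.mul_smul]
  -- The Koszul computation: of the six terms `(G A)` four cancel in pairs by symmetry, and the
  -- other two are equal.
  have : ((1 / 2 : ℝ) • Matrix.of fun l j => pd i (fun y => G y l j) x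
      + pd j (fun y => G y i l) x - pd l (fun y => G y i j) x) = G x * A i := by
    ext l j
    simp only [Matrix.smul_apply, Matrix.of_apply, hd, smul_eq_mul]
    rw [hK j l i, hK l j i, hK j i l]
    ring
  rw [this, ← Matrix.mul_assoc, Matrix.nonsing_inv_mul _ hdet, Matrix.one_mul]

theorem riemann_eq (j k l m : Fin n) (x : Coord n) :
    riemann G j k l m x = ((curvature G j k x).transpose * G x) l m := rfl

theorem ricci_eq (k l : Fin n) (x : Coord n) :
    ricci G k l x = - ∑ j, curvature G j k x j l := rfl

namespace IsMetricOn



theorem isUnit_det (h : IsMetricOn G U) (hx : x ∈ U) : IsUnit (G x).det := isUnit_iff_ne_zero.2 (h.det_ne_zero x hx)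

theorem apply_comm (h : IsMetricOn G U) (x : Coord n) (i j : Fin n) : G x i j = G x j i :=
  (congrFun (congrFun (h.transpose_eq x) i) j).symm

theorem inv_transpose (h : IsMetricOn G U) (x : Coord n) : ((G x)⁻¹).transpose = (G x)⁻¹ := by
  rw [Matrix.transpose_nonsing_inv, h.transpose_eq]

theorem invMetric_comm (h : IsMetricOn G U) (x : Coord n) (i j : Fin n) : (G x)⁻¹ i j = (G x)⁻¹ j i :=
  (congrFun (congrFun (h.inv_transpose x) i) j).symm

theorem smooth_inv (h : IsMetricOn G U) : SmoothOn (fun y => (G y)⁻¹) U := h.smooth.inv h.det_ne_zero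

theorem christoffel_comm (h : IsMetricOn G U) (m i j : Fin n) (x : Coord n) :
    christoffel G m i j x = christoffel G m j i x := by
  unfold christoffel
  congr 1
  refine Finset.sum_congr rfl fun l _ => ?_
  congr 1
  have h1 : ∀ a b : Fin n, (fun y => G y a b) = fun y => G y b a := fun a b => by
    funext y; exact h.apply_comm y a b
  rw [h1 l i, h1 j l, h1 j i]; ring

theorem smooth_connection (h : IsMetricOn G U) (i : Fin n) : SmoothOn (connection G i) U := by
  have hS : SmoothOn (fun x => (Matrix.of fun l j => pd i (fun y => G y l j) x
      + pd j (fun y => G y i l) x - pd l (fun y => G y i j) x :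
      Matrix (Fin n) (Fin n) ℝ)) U := fun l j =>
    ((contDiffOn_pd h.isOpen (h.smooth l j) i).add
      (contDiffOn_pd h.isOpen (h.smooth i l) j)).sub (contDiffOn_pd h.isOpen (h.smooth i j) l)
  intro a b
  have := (contDiffOn_const (c := (1 / 2 : ℝ))).mul ((h.smooth_inv.mul hS) a b)
  refine this.congr fun y _ => ?_
  rw [connection_eq]; rfl

theorem smooth_curvature (h : IsMetricOn G U) (i j : Fin n) : SmoothOn (curvature G i j) U := by
  have hA := h.smooth_connection
  intro a b
  refine (((((hA i).pdM h.isOpen j).sub ((hA j).pdM h.isOpen i)).add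
    (((hA j).mul (hA i)).sub ((hA i).mul (hA j)))) a b).congr fun y _ => ?_
  rw [curvature_eq]

/-- Lowering the index of the Christoffel symbols leaves half the Koszul bracket; adding its
transpose cancels everything except the derivative of the metric. -/
theorem pdM_metric (h : IsMetricOn G U) (hx : x ∈ U) (s : Fin n) :
    pdM s G x = (connection G s x).transpose * G x + G x * connection G s x := by
  have h1 : G x * connection G s x = (1 / 2 : ℝ) • Matrix.of fun l j =>
      pd s (fun y => G y l j) x + pd j (fun y => G y s l) x - pd l (fun y => G y s j) x := by
    rw [connection_eq, Matrix.mul_smul, ← Matrix.mul_assoc,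
      Matrix.mul_nonsing_inv _ (h.isUnit_det hx), Matrix.one_mul]
  have h2 : (connection G s x).transpose * G x = (G x * connection G s x).transpose := by
    rw [Matrix.transpose_mul, h.transpose_eq]
  rw [h2, h1]
  ext i j
  have h3 : ∀ a b : Fin n, (fun y => G y a b) = fun y => G y b a := fun a b => by
    funext y; exact h.apply_comm y a b
  simp only [pdM, Matrix.of_apply, Matrix.add_apply, Matrix.transpose_apply, Matrix.smul_apply,
    smul_eq_mul]
  rw [h3 j i]
  ring

theorem pdM_inv (h : IsMetricOn G U) (hx : x ∈ U) (s : Fin n) :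
    pdM s (fun y => (G y)⁻¹) x
      = - (connection G s x * (G x)⁻¹) - (G x)⁻¹ * (connection G s x).transpose := by
  have h1 : pdM s (fun y => (G y)⁻¹ * G y) x = 0 := by
    rw [pdM_congr (B := fun _ => 1) h.isOpen
      (fun y hy => Matrix.nonsing_inv_mul _ (h.isUnit_det hy)) hx, pdM_const]
  rw [pdM_mul h.isOpen h.smooth_inv h.smooth hx, h.pdM_metric hx] at h1
  have h2 := congrArg (· * (G x)⁻¹) h1
  simp only [add_mul, mul_add, zero_mul] at h2
  rw [Matrix.mul_assoc (pdM s _ x), Matrix.mul_nonsing_inv _ (h.isUnit_det hx), Matrix.mul_one,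
    ← Matrix.mul_assoc, ← Matrix.mul_assoc, Matrix.nonsing_inv_mul _ (h.isUnit_det hx),
    Matrix.one_mul, Matrix.mul_assoc _ (G x), Matrix.mul_nonsing_inv _ (h.isUnit_det hx),
    Matrix.mul_one] at h2
  rw [eq_neg_of_add_eq_zero_left h2]; abel

/-- Metric compatibility, applied twice, computes the second partials of `G`; their commutation
leaves exactly the two curvature terms. -/
theorem curvature_skew (h : IsMetricOn G U) (hx : x ∈ U) (i j : Fin n) :
    (curvature G i j x).transpose * G x + G x * curvature G i j x = 0 := by
  have key : ∀ i j : Fin n, pdM i (pdM j G) x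
      = (pdM i (connection G j) x).transpose * G x
        + (connection G j x).transpose *
          ((connection G i x).transpose * G x + G x * connection G i x)
        + (((connection G i x).transpose * G x + G x * connection G i x) * connection G j x
        + G x * pdM i (connection G j) x) := by
    intro i j
    have hA := h.smooth_connection j
    rw [pdM_congr h.isOpen (fun y hy => h.pdM_metric hy j) hx,
      pdM_add h.isOpen (hA.transpose.mul h.smooth) (h.smooth.mul hA) hx,
      pdM_mul h.isOpen hA.transpose h.smooth hx, pdM_mul h.isOpen h.smooth hA hx,
      pdM_transpose, h.pdM_metric hx]
  have h0 := sub_eq_zero.2 (pdM_comm h.isOpen h.smooth hx j i)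
  rw [key, key] at h0
  rw [curvature_eq, ← h0]
  simp only [Matrix.transpose_add, Matrix.transpose_sub, Matrix.transpose_mul]
  noncomm_ring

/-- Only the symmetry of the Christoffel symbols matters: with it all terms of the cyclic sum cancel
in pairs. -/
theorem riemannUp_cyclic (h : IsMetricOn G U) (i j k m : Fin n) (x : Coord n) :
    riemannUp G i j k m x + riemannUp G j k i m x + riemannUp G k i j m x = 0 := by
  have hf : ∀ m i j, christoffel G m i j = christoffel G m j i :=
    fun m i j => funext fun x => h.christoffel_comm m i j x
  simp only [riemannUp, Finset.sum_sub_distrib]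
  rw [hf m k i, hf m k j, hf m j i]
  simp only [hf _ k i, hf _ k j, hf _ j i]
  ring

/-- The second Bianchi identity for a curvature form `dA + A ∧ A`: second derivatives of `A` cancel
because partials commute, the rest is noncommutative algebra. -/
theorem curvature_bianchi (h : IsMetricOn G U) (hx : x ∈ U) (s i j : Fin n) :
    (pdM s (curvature G i j) x + connection G s x * curvature G i j x
        - curvature G i j x * connection G s x)
      + (pdM i (curvature G j s) x + connection G i x * curvature G j s x
        - curvature G j s x * connection G i x)
      + (pdM j (curvature G s i) x + connection G j x * curvature G s i x
        - curvature G s i x * connection G j x) = 0 := by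
  have hA := h.smooth_connection
  have key : ∀ s i j, pdM s (curvature G i j) x
      = pdM s (pdM j (connection G i)) x - pdM s (pdM i (connection G j)) x
        + ((pdM s (connection G j) x * connection G i x
            + connection G j x * pdM s (connection G i) x)
          - (pdM s (connection G i) x * connection G j x
            + connection G i x * pdM s (connection G j) x)) := by
    intro s i j
    rw [pdM_congr h.isOpen (fun y _ => curvature_eq i j y) hx,
      pdM_add h.isOpen (((hA i).pdM h.isOpen j).sub ((hA j).pdM h.isOpen i))
        (((hA j).mul (hA i)).sub ((hA i).mul (hA j))) hx,
      pdM_sub h.isOpen ((hA i).pdM h.isOpen j) ((hA j).pdM h.isOpen i) hx,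
      pdM_sub h.isOpen ((hA j).mul (hA i)) ((hA i).mul (hA j)) hx,
      pdM_mul h.isOpen (hA j) (hA i) hx, pdM_mul h.isOpen (hA i) (hA j) hx]
  rw [key, key, key, pdM_comm h.isOpen (hA i) hx s j, pdM_comm h.isOpen (hA j) hx s i,
    pdM_comm h.isOpen (hA s) hx i j]
  simp only [curvature_eq]
  noncomm_ring

/-- The Christoffel corrections on the two form indices cancel in the cyclic sum, because the
connection is torsion-free; what remains is `curvature_bianchi`. -/
theorem covCurvature_bianchi (h : IsMetricOn G U) (hx : x ∈ U) (s j k : Fin n) :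
    covCurvature G s j k x + covCurvature G j k s x + covCurvature G k s j x = 0 := by
  have h1 := h.curvature_bianchi hx s j k
  have h2 : ∀ a b c : Fin n, ∑ d, christoffel G d a b x • curvature G d c x
      = - ∑ d, christoffel G d b a x • curvature G c d x := fun a b c => by
    rw [← Finset.sum_neg_distrib]
    refine Finset.sum_congr rfl fun d _ => ?_
    rw [curvature_swap c d, h.christoffel_comm, smul_neg]
  unfold covCurvature
  rw [h2 s j k, h2 j k s, h2 k s j, ← h1]
  abel

theorem smooth_riemann (h : IsMetricOn G U) (j k l m : Fin n) : ContDiffOn ℝ ∞ (riemann G j k l m) U :=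
  ((h.smooth_curvature j k).transpose.mul h.smooth) l m

theorem smooth_ricci (h : IsMetricOn G U) (k l : Fin n) : ContDiffOn ℝ ∞ (ricci G k l) U :=
  (ContDiffOn.sum fun j _ => h.smooth_curvature j k j l).neg

theorem covDeriv_riemann (h : IsMetricOn G U) (hx : x ∈ U) (s j k l m : Fin n) :
    covDeriv₄ G (riemann G) s j k l m x = ((covCurvature G s j k x).transpose * G x) l m := by
  have h1 : pd s (riemann G j k l m) x
      = ((pdM s (curvature G j k) x).transpose * G x + (curvature G j k x).transpose *
        ((connection G s x).transpose * G x + G x * connection G s x)) l m := by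
    rw [← h.pdM_metric hx, ← pdM_transpose,
      ← pdM_mul h.isOpen (h.smooth_curvature j k).transpose h.smooth hx]
    rfl
  have h2 : ∑ a, christoffel G a s l x * riemann G j k a m x
      = ((connection G s x).transpose * ((curvature G j k x).transpose * G x)) l m := by
    rw [Matrix.mul_apply]; rfl
  have h3 : ∑ a, christoffel G a s m x * riemann G j k l a x
      = (((curvature G j k x).transpose * G x) * connection G s x) l m := by
    rw [Matrix.mul_apply]; exact Finset.sum_congr rfl fun a _ => mul_comm _ _
  have h4 : ∀ (c : Fin n → ℝ) (K : Fin n → Matrix (Fin n) (Fin n) ℝ),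
      ((∑ a, c a • K a).transpose * G x) l m = ∑ a, c a * ((K a).transpose * G x) l m := by
    intro c K
    simp [Matrix.transpose_sum, Matrix.sum_mul, Matrix.sum_apply]
  unfold covDeriv₄
  rw [h1, h2, h3, covCurvature]
  simp only [Matrix.transpose_sub, Matrix.sub_mul, Matrix.sub_apply, h4, riemann_eq,
    Matrix.transpose_add, Matrix.add_mul, Matrix.transpose_mul, Matrix.mul_add, Matrix.add_apply,
    Matrix.mul_assoc]
  ring

/-- Covariant differentiation commutes with contraction: the corrections for the contracted upper
and lower index cancel. -/
theorem sum_covCurvature (h : IsMetricOn G U) (hx : x ∈ U) (s k l : Fin n) :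
    ∑ j, covCurvature G s j k x j l = - covDeriv₂ G (ricci G) s k l x := by
  have h1 : pd s (ricci G k l) x = - ∑ j, pd s (fun y => curvature G j k y j l) x := by
    rw [← pd_sum _ (fun j _ => (h.smooth_curvature j k).differentiableAt h.isOpen hx j l), ← pd_neg]
    rfl
  simp only [covCurvature, covDeriv₂, h1, ricci_eq, Matrix.sub_apply, Matrix.add_apply,
    Finset.sum_add_distrib, Finset.sum_sub_distrib, Matrix.mul_apply, Matrix.sum_apply,
    Matrix.smul_apply, smul_eq_mul, mul_neg, Finset.sum_neg_distrib, Finset.mul_sum]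
  have h2 : ∑ j, ∑ a, connection G s x j a * curvature G j k x a l
      = ∑ j, ∑ a, christoffel G a s j x * curvature G a k x j l := Finset.sum_comm
  have h3 : ∑ j, ∑ a, curvature G j k x j a * connection G s x a l
      = ∑ a, ∑ j, christoffel G a s l x * curvature G j k x j a := by
    rw [Finset.sum_comm]
    exact Finset.sum_congr rfl fun a _ => Finset.sum_congr rfl fun j _ => mul_comm _ _
  have h4 : ∑ j, ∑ a, christoffel G a s k x * curvature G j a x j l
      = ∑ a, ∑ j, christoffel G a s k x * curvature G j a x j l := Finset.sum_comm
  rw [h2, h3, h4]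
  simp only [pdM, Matrix.of_apply]
  ring

end IsMetricOn

end Connection

/-! ### Linear algebra of index contractions. -/

section Contraction

variable {n : ℕ}

/-- The contraction `H^{ab} f_{ab}`. -/
def contract (H : Matrix (Fin n) (Fin n) ℝ) (f : Fin n → Fin n → ℝ) : ℝ := ∑ a, ∑ b, H a b * f a b

/-- The contraction `v^a f_a`. -/
def pairing (v f : Fin n → ℝ) : ℝ := ∑ a, v a * f a

variable (H : Matrix (Fin n) (Fin n) ℝ) (v : Fin n → ℝ)

theorem contract_add (f g : Fin n → Fin n → ℝ) :
    contract H (fun a b => f a b + g a b) = contract H f + contract H g := by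
  simp only [contract, mul_add, Finset.sum_add_distrib]

theorem contract_sub (f g : Fin n → Fin n → ℝ) :
    contract H (fun a b => f a b - g a b) = contract H f - contract H g := by
  simp only [contract, mul_sub, Finset.sum_sub_distrib]

theorem contract_neg (f : Fin n → Fin n → ℝ) :
    contract H (fun a b => - f a b) = - contract H f := by
  simp only [contract, mul_neg, Finset.sum_neg_distrib]

theorem contract_const_mul (c : ℝ) (f : Fin n → Fin n → ℝ) :
    contract H (fun a b => c * f a b) = c * contract H f := by
  simp only [contract, Finset.mul_sum]
  exact Finset.sum_congr rfl fun a _ => Finset.sum_congr rfl fun b _ => by ring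

theorem contract_mul_const (c : ℝ) (f : Fin n → Fin n → ℝ) :
    contract H (fun a b => f a b * c) = contract H f * c := by
  rw [mul_comm, ← contract_const_mul]; simp only [mul_comm]

theorem contract_swap (hH : ∀ a b, H a b = H b a) (f : Fin n → Fin n → ℝ) :
    contract H (fun a b => f b a) = contract H f := by
  unfold contract
  rw [Finset.sum_comm]
  simp only [hH]

theorem pairing_add (f g : Fin n → ℝ) :
    pairing v (fun a => f a + g a) = pairing v f + pairing v g := by
  simp only [pairing, mul_add, Finset.sum_add_distrib]

theorem pairing_sub (f g : Fin n → ℝ) :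
    pairing v (fun a => f a - g a) = pairing v f - pairing v g := by
  simp only [pairing, mul_sub, Finset.sum_sub_distrib]

theorem pairing_neg (f : Fin n → ℝ) : pairing v (fun a => - f a) = - pairing v f := by
  simp only [pairing, mul_neg, Finset.sum_neg_distrib]

theorem pairing_const_mul (c : ℝ) (f : Fin n → ℝ) :
    pairing v (fun a => c * f a) = c * pairing v f := by
  simp only [pairing, Finset.mul_sum]
  exact Finset.sum_congr rfl fun b _ => by ring

theorem pairing_mul_const (c : ℝ) (f : Fin n → ℝ) :
    pairing v (fun a => f a * c) = pairing v f * c := by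
  rw [mul_comm, ← pairing_const_mul]; simp only [mul_comm]

theorem contract_sum {ι : Type*} (t : Finset ι) (f : ι → Fin n → Fin n → ℝ) :
    contract H (fun a b => ∑ c ∈ t, f c a b) = ∑ c ∈ t, contract H (f c) := by
  simp only [contract, Finset.mul_sum]
  rw [Finset.sum_comm]
  simp_rw [Finset.sum_comm (s := t)]
  rw [Finset.sum_comm]

theorem pairing_contract (f : Fin n → Fin n → Fin n → ℝ) :
    pairing v (fun c => contract H (fun a b => f c a b))
      = contract H (fun a b => pairing v (fun c => f c a b)) := by
  simp only [pairing, contract_sum, contract_const_mul]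

theorem contract_comm (K : Matrix (Fin n) (Fin n) ℝ) (f : Fin n → Fin n → Fin n → Fin n → ℝ) :
    contract H (fun a b => contract K (fun c d => f a b c d))
      = contract K (fun c d => contract H (fun a b => f a b c d)) := by
  have e : ∀ g : Fin n → Fin n → ℝ, contract K g = ∑ c, ∑ d, K c d * g c d := fun _ => rfl
  simp only [e, contract_sum, contract_const_mul]

end Contraction

/-! ### Symmetries of the curvature tensors and of their derivatives, and the contracted Bianchi
identities. -/

section CovariantCalculus

variable {n : ℕ} {G : Coord n → Matrix (Fin n) (Fin n) ℝ} {U : Set (Coord n)} {x : Coord n}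

theorem covDeriv₄_congr (hU : IsOpen U) {S T : Fin n → Fin n → Fin n → Fin n → Coord n → ℝ}
    (hST : ∀ j k l m, ∀ y ∈ U, S j k l m y = T j k l m y) (hx : x ∈ U) (s j k l m : Fin n) :
    covDeriv₄ G S s j k l m x = covDeriv₄ G T s j k l m x := by
  unfold covDeriv₄
  rw [pd_congr hU (hST j k l m) hx]
  simp only [hST _ _ _ _ x hx]

theorem covDeriv₄_neg (T : Fin n → Fin n → Fin n → Fin n → Coord n → ℝ) (s j k l m : Fin n) :
    covDeriv₄ G (fun j k l m y => - T j k l m y) s j k l m x = - covDeriv₄ G T s j k l m x := by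
  unfold covDeriv₄
  rw [pd_neg]
  simp only [mul_neg, Finset.sum_neg_distrib]
  ring

theorem covDeriv₄_add {S T : Fin n → Fin n → Fin n → Fin n → Coord n → ℝ}
    (hS : ∀ j k l m, DifferentiableAt ℝ (S j k l m) x)
    (hT : ∀ j k l m, DifferentiableAt ℝ (T j k l m) x) (s j k l m : Fin n) :
    covDeriv₄ G (fun j k l m y => S j k l m y + T j k l m y) s j k l m x
      = covDeriv₄ G S s j k l m x + covDeriv₄ G T s j k l m x := by
  unfold covDeriv₄
  rw [pd_add (hS j k l m) (hT j k l m)]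
  simp only [mul_add, Finset.sum_add_distrib]
  ring

theorem covDeriv₄_swap_left (T : Fin n → Fin n → Fin n → Fin n → Coord n → ℝ)
    (s j k l m : Fin n) :
    covDeriv₄ G (fun j k l m => T k j l m) s j k l m x = covDeriv₄ G T s k j l m x := by
  unfold covDeriv₄; ring

theorem covDeriv₄_swap_right (T : Fin n → Fin n → Fin n → Fin n → Coord n → ℝ)
    (s j k l m : Fin n) :
    covDeriv₄ G (fun j k l m => T j k m l) s j k l m x = covDeriv₄ G T s j k m l x := by
  unfold covDeriv₄; ring

theorem covDeriv₄_swap_pairs (T : Fin n → Fin n → Fin n → Fin n → Coord n → ℝ)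
    (s j k l m : Fin n) :
    covDeriv₄ G (fun j k l m => T l m j k) s j k l m x = covDeriv₄ G T s l m j k x := by
  unfold covDeriv₄; ring

theorem covDeriv₄_mul {A B : Fin n → Fin n → Coord n → ℝ}
    (hA : ∀ i j, DifferentiableAt ℝ (A i j) x) (hB : ∀ i j, DifferentiableAt ℝ (B i j) x)
    (s j k l m : Fin n) :
    covDeriv₄ G (fun j k l m y => A j m y * B k l y) s j k l m x
      = covDeriv₂ G A s j m x * B k l x + A j m x * covDeriv₂ G B s k l x := by
  unfold covDeriv₄ covDeriv₂
  rw [pd_mul (hA j m) (hB k l)]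
  simp only [sub_mul, mul_sub, Finset.mul_sum, Finset.sum_mul, mul_left_comm (A _ _ x),
    ← mul_assoc]
  simp only [mul_right_comm _ (A _ _ x), mul_comm (A _ _ x)]
  ring

/-- The matrix of components of the Ricci tensor. -/
def ricciMatrix (G : Coord n → Matrix (Fin n) (Fin n) ℝ) (x : Coord n) :
    Matrix (Fin n) (Fin n) ℝ :=
  Matrix.of fun k l => ricci G k l x

/-- The mixed components `R^k{}_l` of the Ricci tensor. -/
def mixedRicci (G : Coord n → Matrix (Fin n) (Fin n) ℝ) (x : Coord n) :
    Matrix (Fin n) (Fin n) ℝ :=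
  (G x)⁻¹ * ricciMatrix G x

/-- The matrix of components of `∇_s R_{kl}`. -/
def covRicci (G : Coord n → Matrix (Fin n) (Fin n) ℝ) (s : Fin n) (x : Coord n) :
    Matrix (Fin n) (Fin n) ℝ :=
  Matrix.of fun k l => covDeriv₂ G (ricci G) s k l x

namespace IsMetricOn

theorem covDeriv_metric (h : IsMetricOn G U) (hx : x ∈ U) (s k l : Fin n) :
    covDeriv₂ G (fun i j y => G y i j) s k l x = 0 := by
  have := congrFun (congrFun (h.pdM_metric hx s) k) l
  simp only [pdM, Matrix.of_apply, Matrix.add_apply, Matrix.mul_apply, connection,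
    Matrix.transpose_apply] at this
  unfold covDeriv₂
  rw [this]
  simp only [mul_comm]
  ring

theorem riemann_skew_right (h : IsMetricOn G U) (hx : x ∈ U) (j k l m : Fin n) :
    riemann G j k m l x = - riemann G j k l m x := by
  have h1 := congrFun (congrFun (h.curvature_skew hx j k) m) l
  have h2 : (G x * curvature G j k x) m l = riemann G j k l m x := by
    rw [riemann_eq, ← Matrix.transpose_apply (_ * G x), Matrix.transpose_mul, h.transpose_eq,
      Matrix.transpose_transpose]
  rw [Matrix.add_apply, h2, ← riemann_eq] at h1
  exact eq_neg_of_add_eq_zero_left h1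

theorem riemann_skew_left (j k l m : Fin n) :
    riemann G k j l m x = - riemann G j k l m x := by
  rw [riemann_eq, riemann_eq, curvature_swap j k]; simp

theorem riemann_cyclic (h : IsMetricOn G U) (j k l m : Fin n) :
    riemann G j k l m x + riemann G k l j m x + riemann G l j k m x = 0 := by
  simp only [riemann, ← Finset.sum_add_distrib, ← add_mul, h.riemannUp_cyclic, zero_mul,
    Finset.sum_const_zero]

/-- The classical octahedron argument: a linear combination of four cyclic identities, simplified by
skewness in each pair. -/
theorem riemann_swap_pairs (h : IsMetricOn G U) (hx : x ∈ U) (j k l m : Fin n) :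
    riemann G l m j k x = riemann G j k l m x := by
  have h1 := h.riemann_cyclic (x := x) j k l m
  have h2 := h.riemann_cyclic (x := x) k l m j
  have h3 := h.riemann_cyclic (x := x) l m j k
  have h4 := h.riemann_cyclic (x := x) m j k l
  have a := h.riemann_skew_right hx
  have b := @riemann_skew_left n G x
  linarith [a j k l m, a k l j m, a l j k m, a k l m j, a l m k j, a m k l j, a l m j k, a m j l k,
    a j l m k, a m j k l, a j k m l, a k m j l, b k m j l, b j l k m, b k m l j, b j l m k,
    b m j k l, b j k l m, b k l j m, b l m j k, b l m k j, b j m k l, b j m l k]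

/-- The cyclic identity is traced over its first and upper index. The term `R_{klj}{}^j` drops out
because the curvature matrix is conjugate to minus its transpose and so has trace zero. -/
theorem ricci_comm (h : IsMetricOn G U) (hx : x ∈ U) (k l : Fin n) :
    ricci G k l x = ricci G l k x := by
  have h1 : ∑ j, riemannUp G k l j j x = 0 := by
    have h2 : curvature G k l x = -((G x)⁻¹ * (curvature G k l x).transpose * G x) := by
      rw [Matrix.mul_assoc, eq_neg_of_add_eq_zero_left (h.curvature_skew hx k l), Matrix.mul_neg,
        neg_neg, ← Matrix.mul_assoc, Matrix.nonsing_inv_mul _ (h.isUnit_det hx), Matrix.one_mul]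
    have h3 := congrArg Matrix.trace h2
    rw [Matrix.trace_neg, Matrix.mul_assoc, Matrix.trace_mul_comm, Matrix.mul_assoc,
      Matrix.mul_nonsing_inv _ (h.isUnit_det hx), Matrix.mul_one, Matrix.trace_transpose] at h3
    have h4 : (curvature G k l x).trace = 0 := by linarith
    exact h4
  have h2 : ∑ j, (riemannUp G j k l j x + riemannUp G k l j j x + riemannUp G l j k j x) = 0 :=
    Finset.sum_eq_zero fun j _ => h.riemannUp_cyclic j k l j x
  have h3 : ∑ j, riemannUp G l j k j x = - ∑ j, riemannUp G j l k j x := by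
    rw [← Finset.sum_neg_distrib]
    exact Finset.sum_congr rfl fun j _ => congrFun (congrFun (curvature_swap j l x) j) k
  rw [Finset.sum_add_distrib, Finset.sum_add_distrib, h1, h3] at h2
  unfold ricci
  linarith

theorem covRiemann_skew_left (s j k l m : Fin n) :
    covDeriv₄ G (riemann G) s k j l m x = - covDeriv₄ G (riemann G) s j k l m x := by
  rw [← covDeriv₄_neg, ← covDeriv₄_swap_left]
  congr 1
  funext j k l m y
  exact riemann_skew_left j k l m

theorem covRiemann_skew_right (h : IsMetricOn G U) (hx : x ∈ U) (s j k l m : Fin n) :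
    covDeriv₄ G (riemann G) s j k m l x = - covDeriv₄ G (riemann G) s j k l m x := by
  rw [← covDeriv₄_neg, ← covDeriv₄_swap_right]
  exact covDeriv₄_congr h.isOpen (fun j k l m y hy => h.riemann_skew_right hy j k l m) hx ..

theorem covRiemann_swap_pairs (h : IsMetricOn G U) (hx : x ∈ U) (s j k l m : Fin n) :
    covDeriv₄ G (riemann G) s l m j k x = covDeriv₄ G (riemann G) s j k l m x := by
  rw [← covDeriv₄_swap_pairs]
  exact covDeriv₄_congr h.isOpen (fun j k l m y hy => h.riemann_swap_pairs hy j k l m) hx ..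

theorem covRiemann_bianchi (h : IsMetricOn G U) (hx : x ∈ U) (s j k l m : Fin n) :
    covDeriv₄ G (riemann G) s j k l m x + covDeriv₄ G (riemann G) j k s l m x
      + covDeriv₄ G (riemann G) k s j l m x = 0 := by
  rw [h.covDeriv_riemann hx, h.covDeriv_riemann hx, h.covDeriv_riemann hx, ← Matrix.add_apply,
    ← Matrix.add_apply, ← Matrix.add_mul, ← Matrix.add_mul, ← Matrix.transpose_add,
    ← Matrix.transpose_add, h.covCurvature_bianchi hx]
  simp

theorem contract_metric_mul (h : IsMetricOn G U) (hx : x ∈ U) (c : Fin n) (v : Fin n → ℝ) :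
    contract (G x)⁻¹ (fun a b => G x c a * v b) = v c := by
  have : contract (G x)⁻¹ (fun a b => G x c a * v b) = (G x).mulVec ((G x)⁻¹.mulVec v) c := by
    simp only [contract, Matrix.mulVec, dotProduct, Finset.mul_sum]
    exact Finset.sum_congr rfl fun a _ => Finset.sum_congr rfl fun b _ => by ring
  rw [this, Matrix.mulVec_mulVec, Matrix.mul_nonsing_inv _ (h.isUnit_det hx), Matrix.one_mulVec]

theorem contract_mul_metric (h : IsMetricOn G U) (hx : x ∈ U) (c : Fin n) (v : Fin n → ℝ) :
    contract (G x)⁻¹ (fun a b => v a * G x c b) = v c := by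
  rw [← h.contract_metric_mul hx c v, ← contract_swap _ (h.invMetric_comm x)]
  simp only [mul_comm]

theorem contract_metric (h : IsMetricOn G U) (hx : x ∈ U) :
    contract (G x)⁻¹ (fun a b => G x a b) = n := by
  have : contract (G x)⁻¹ (fun a b => G x a b) = ((G x)⁻¹ * (G x).transpose).trace := by
    simp only [contract, Matrix.trace, Matrix.diag_apply, Matrix.mul_apply,
      Matrix.transpose_apply]
  rw [this, h.transpose_eq, Matrix.nonsing_inv_mul _ (h.isUnit_det hx)]
  simp

theorem contract_const_mul_metric (h : IsMetricOn G U) (hx : x ∈ U) (c : ℝ) :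
    contract (G x)⁻¹ (fun a b => c * G x a b) = c * n :=
  (contract_const_mul _ c _).trans (by rw [h.contract_metric hx])

theorem contract_lower (h : IsMetricOn G U) (hx : x ∈ U) (K : Fin n → Fin n → ℝ) :
    contract (G x)⁻¹ (fun a b => ∑ c, K c a * G x c b) = ∑ c, K c c := by
  have : ∀ c, contract (G x)⁻¹ (fun a b => K c a * G x c b) = K c c := fun c =>
    h.contract_mul_metric hx c (K c)
  rw [contract_sum]
  exact Finset.sum_congr rfl fun c _ => this c

theorem contract_riemann (h : IsMetricOn G U) (hx : x ∈ U) (k l : Fin n) :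
    contract (G x)⁻¹ (fun j m => riemann G j k l m x) = - ricci G k l x := by
  rw [ricci_eq, neg_neg]
  exact h.contract_lower hx (fun c a => curvature G a k x c l)

theorem contract_covRiemann (h : IsMetricOn G U) (hx : x ∈ U) (s k l : Fin n) :
    contract (G x)⁻¹ (fun j m => covDeriv₄ G (riemann G) s j k l m x)
      = - covDeriv₂ G (ricci G) s k l x := by
  rw [← h.sum_covCurvature hx]
  simp only [h.covDeriv_riemann hx]
  exact h.contract_lower hx (fun c a => covCurvature G s a k x c l)

theorem covRicci_comm (h : IsMetricOn G U) (hx : x ∈ U) (s k l : Fin n) :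
    covDeriv₂ G (ricci G) s k l x = covDeriv₂ G (ricci G) s l k x := by
  unfold covDeriv₂
  rw [pd_congr h.isOpen (fun y hy => h.ricci_comm hy k l) hx]
  simp only [h.ricci_comm hx l, h.ricci_comm hx k]
  ring

theorem smooth_ricciMatrix (h : IsMetricOn G U) : SmoothOn (ricciMatrix G) U :=
  fun k l => h.smooth_ricci k l

theorem smooth_mixedRicci (h : IsMetricOn G U) : SmoothOn (mixedRicci G) U :=
  h.smooth_inv.mul h.smooth_ricciMatrix

theorem trace_inv_mul (h : IsMetricOn G U) (K : Matrix (Fin n) (Fin n) ℝ) :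
    ((G x)⁻¹ * K).trace = contract (G x)⁻¹ (fun a b => K a b) := by
  rw [← contract_swap _ (h.invMetric_comm x)]
  simp only [contract, Matrix.trace, Matrix.diag_apply, Matrix.mul_apply]

theorem scalar_eq_trace (h : IsMetricOn G U) (x : Coord n) :
    scalar G x = (mixedRicci G x).trace :=
  (h.trace_inv_mul _).symm

/-- For mixed components the Christoffel corrections form a commutator, which disappears under the
trace. The derivatives of the curvature scalar and of the squared length of the Ricci tensor are
obtained this way. -/
theorem pdM_mixedRicci (h : IsMetricOn G U) (hx : x ∈ U) (s : Fin n) :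
    pdM s (mixedRicci G) x = (G x)⁻¹ * covRicci G s x
      + (mixedRicci G x * connection G s x - connection G s x * mixedRicci G x) := by
  have h1 : pdM s (ricciMatrix G) x = covRicci G s x
      + (connection G s x).transpose * ricciMatrix G x + ricciMatrix G x * connection G s x := by
    ext k l
    have e : ∑ a, christoffel G a s l x * ricci G k a x
        = ∑ a, ricci G k a x * christoffel G a s l x :=
      Finset.sum_congr rfl fun a _ => mul_comm _ _
    simp only [covRicci, ricciMatrix, pdM, covDeriv₂, connection, Matrix.add_apply,
      Matrix.mul_apply, Matrix.of_apply, Matrix.transpose_apply, e]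
    ring
  have h2 : pdM s (mixedRicci G) x = pdM s (fun y => (G y)⁻¹) x * ricciMatrix G x
      + (G x)⁻¹ * pdM s (ricciMatrix G) x :=
    pdM_mul h.isOpen h.smooth_inv h.smooth_ricciMatrix hx s
  rw [h2, h1, h.pdM_inv hx, mixedRicci]
  noncomm_ring

theorem smooth_scalar (h : IsMetricOn G U) : ContDiffOn ℝ ∞ (scalar G) U := by
  have := fun a => h.smooth_mixedRicci a a
  refine (ContDiffOn.sum (s := Finset.univ) fun a _ => this a).congr fun y _ => ?_
  rw [h.scalar_eq_trace, Matrix.trace]; rfl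

theorem pd_scalar (h : IsMetricOn G U) (hx : x ∈ U) (s : Fin n) :
    pd s (scalar G) x = contract (G x)⁻¹ (fun a b => covDeriv₂ G (ricci G) s a b x) := by
  rw [pd_congr h.isOpen (fun y _ => h.scalar_eq_trace y) hx,
    pd_trace h.isOpen h.smooth_mixedRicci hx, h.pdM_mixedRicci hx, Matrix.trace_add,
    Matrix.trace_sub, Matrix.trace_mul_comm (mixedRicci G x), sub_self, add_zero, h.trace_inv_mul]
  rfl

theorem pd_trace_mixedRicci_mul_self (h : IsMetricOn G U) (hx : x ∈ U) (s : Fin n) :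
    pd s (fun y => (mixedRicci G y * mixedRicci G y).trace) x
      = 2 * (mixedRicci G x * ((G x)⁻¹ * covRicci G s x)).trace := by
  have hM := h.smooth_mixedRicci
  have h0 : (mixedRicci G x * (mixedRicci G x * connection G s x
      - connection G s x * mixedRicci G x)).trace = 0 := by
    rw [mul_sub, Matrix.trace_sub, ← Matrix.mul_assoc _ (connection G s x),
      Matrix.trace_mul_comm _ (mixedRicci G x), sub_self]
  rw [pd_trace h.isOpen (hM.mul hM) hx, pdM_mul h.isOpen hM hM hx, Matrix.trace_add,
    Matrix.trace_mul_comm (pdM s _ x), ← two_mul, h.pdM_mixedRicci hx, mul_add,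
    Matrix.trace_add, h0, add_zero]

/-- The contracted second Bianchi identity `∇^m R_{jklm} = ∇_k R_{jl} - ∇_j R_{kl}`. -/
theorem div_riemann (h : IsMetricOn G U) (hx : x ∈ U) (j k l : Fin n) :
    contract (G x)⁻¹ (fun m s => covDeriv₄ G (riemann G) s j k l m x)
      = covDeriv₂ G (ricci G) k j l x - covDeriv₂ G (ricci G) j k l x := by
  have h1 : ∀ m s, covDeriv₄ G (riemann G) s j k l m x
      = covDeriv₄ G (riemann G) j s k l m x - covDeriv₄ G (riemann G) k s j l m x := fun m s => by
    linarith [h.covRiemann_bianchi hx s j k l m, covRiemann_skew_left (G := G) (x := x) j s k l m]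
  simp only [h1]
  rw [contract_swap _ (h.invMetric_comm x)
    (fun s m => covDeriv₄ G (riemann G) j s k l m x - covDeriv₄ G (riemann G) k s j l m x),
    contract_sub, h.contract_covRiemann hx, h.contract_covRiemann hx]
  ring

/-- The twice contracted second Bianchi identity `∇^m R_{km} = ∇_k R / 2`. -/
theorem div_ricci (h : IsMetricOn G U) (hx : x ∈ U) (k : Fin n) :
    contract (G x)⁻¹ (fun m s => covDeriv₂ G (ricci G) s k m x) = pd k (scalar G) x / 2 := by
  have h1 : contract (G x)⁻¹ (fun j l => contract (G x)⁻¹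
      (fun m s => covDeriv₄ G (riemann G) s j k l m x))
      = contract (G x)⁻¹ (fun m s => covDeriv₂ G (ricci G) s k m x) := by
    rw [contract_comm]
    congr 1
    funext m s
    rw [← neg_neg (covDeriv₂ G _ s k m x), ← h.contract_covRiemann hx, ← contract_neg]
    congr 1
    funext j l
    exact h.covRiemann_skew_right hx s j k m l
  simp only [h.div_riemann hx] at h1
  rw [contract_sub, ← h.pd_scalar hx] at h1
  have h2 : contract (G x)⁻¹ (fun j l => covDeriv₂ G (ricci G) j k l x)
      = contract (G x)⁻¹ (fun m s => covDeriv₂ G (ricci G) s k m x) :=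
    contract_swap _ (h.invMetric_comm x) (fun m s => covDeriv₂ G (ricci G) s k m x)
  linarith

end IsMetricOn

end CovariantCalculus

/-! ### The divergence of the Weyl tensor as a multiple of the Cotton tensor. -/

section DivergenceOfWeyl

variable {n : ℕ} {G : Coord n → Matrix (Fin n) (Fin n) ℝ} {U : Set (Coord n)} {x : Coord n}

/-- The Schouten tensor. -/
def schouten (G : Coord n → Matrix (Fin n) (Fin n) ℝ) (k l : Fin n) (x : Coord n) : ℝ :=
  1 / ((n : ℝ) - 2) * ricci G k l x
    - 1 / (2 * ((n : ℝ) - 1) * ((n : ℝ) - 2)) * (scalar G x * G x k l)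

/-- The sum `g_{jm} P_{kl} + P_{jm} g_{kl}`, with `P` the Schouten tensor. -/
def metricSchouten (G : Coord n → Matrix (Fin n) (Fin n) ℝ) (j k l m : Fin n) (x : Coord n) : ℝ :=
  G x j m * schouten G k l x + schouten G j m x * G x k l

/-- Absorbing the scalar term into the Schouten tensor leaves products of `g` with a single tensor,
so that `∇g = 0` makes the covariant derivative immediate. -/
theorem weyl_eq (hn : 3 ≤ n) (j k l m : Fin n) (x : Coord n) :
    weyl G j k l m x = (riemann G j k l m x + metricSchouten G j k l m x)
      + - metricSchouten G k j l m x := by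
  have hn' : (3 : ℝ) ≤ n := by exact_mod_cast hn
  have h1 : (n : ℝ) - 1 ≠ 0 := by linarith
  have h2 : (n : ℝ) - 2 ≠ 0 := by linarith
  unfold weyl metricSchouten schouten
  field_simp
  ring

namespace IsMetricOn

theorem smooth_schouten (h : IsMetricOn G U) (k l : Fin n) : ContDiffOn ℝ ∞ (schouten G k l) U :=
  (contDiffOn_const.mul (h.smooth_ricci k l)).sub
    (contDiffOn_const.mul (h.smooth_scalar.mul (h.smooth k l)))

theorem covDeriv_schouten (h : IsMetricOn G U) (hx : x ∈ U) (s k l : Fin n) :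
    covDeriv₂ G (schouten G) s k l x = 1 / ((n : ℝ) - 2) * covDeriv₂ G (ricci G) s k l x
      - 1 / (2 * ((n : ℝ) - 1) * ((n : ℝ) - 2)) * (pd s (scalar G) x * G x k l) := by
  have hR := differentiableAt_of_contDiffOn h.isOpen (h.smooth_ricci k l) hx
  have hs := differentiableAt_of_contDiffOn h.isOpen h.smooth_scalar hx
  have hG := h.smooth.differentiableAt h.isOpen hx k l
  have h0 := h.covDeriv_metric hx s k l
  have h1 : pd s (schouten G k l) x = 1 / ((n : ℝ) - 2) * pd s (ricci G k l) x
      - 1 / (2 * ((n : ℝ) - 1) * ((n : ℝ) - 2)) *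
        (pd s (scalar G) x * G x k l + scalar G x * pd s (fun y => G y k l) x) := by
    rw [← pd_mul hs hG, ← pd_const_mul _ hR, ← pd_const_mul _ (hs.fun_mul hG), ← pd_sub (by fun_prop)
      (by fun_prop)]
    rfl
  unfold covDeriv₂ at h0 ⊢
  rw [h1, eq_add_of_sub_eq (eq_add_of_sub_eq h0)]
  simp only [schouten, mul_sub, Finset.sum_sub_distrib, mul_left_comm (christoffel _ _ _ _ _),
    ← Finset.mul_sum]
  ring

theorem covDeriv_metricSchouten (h : IsMetricOn G U) (hx : x ∈ U) (s j k l m : Fin n) :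
    covDeriv₄ G (metricSchouten G) s j k l m x
      = G x j m * covDeriv₂ G (schouten G) s k l x
        + covDeriv₂ G (schouten G) s j m x * G x k l := by
  have hG := fun i j => h.smooth.differentiableAt h.isOpen hx i j
  have hP := fun i j => differentiableAt_of_contDiffOn h.isOpen (h.smooth_schouten i j) hx
  have e : metricSchouten G = fun j k l m y => G y j m * schouten G k l y
      + schouten G j m y * G y k l := rfl
  rw [e, covDeriv₄_add (fun j k l m => (hG j m).fun_mul (hP k l))
      (fun j k l m => (hP j m).fun_mul (hG k l)),
    covDeriv₄_mul (A := fun i j y => G y i j) hG hP, covDeriv₄_mul (B := fun i j y => G y i j) hP hG,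
    h.covDeriv_metric hx, h.covDeriv_metric hx]
  ring

theorem covDeriv_weyl (h : IsMetricOn G U) (hn : 3 ≤ n) (hx : x ∈ U) (s j k l m : Fin n) :
    covDeriv₄ G (weyl G) s j k l m x = covDeriv₄ G (riemann G) s j k l m x
      + (G x j m * covDeriv₂ G (schouten G) s k l x + covDeriv₂ G (schouten G) s j m x * G x k l)
      - (G x k m * covDeriv₂ G (schouten G) s j l x
        + covDeriv₂ G (schouten G) s k m x * G x j l) := by
  have hR := fun j k l m => differentiableAt_of_contDiffOn h.isOpen (h.smooth_riemann j k l m) hx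
  have hP := fun i j => differentiableAt_of_contDiffOn h.isOpen (h.smooth_schouten i j) hx
  have hM : ∀ j k l m, DifferentiableAt ℝ (metricSchouten G j k l m) x := fun j k l m =>
    ((h.smooth.differentiableAt h.isOpen hx j m).mul (hP k l)).add
      ((hP j m).mul (h.smooth.differentiableAt h.isOpen hx k l))
  have e : weyl G = fun j k l m y => (riemann G j k l m y + metricSchouten G j k l m y)
      + - metricSchouten G k j l m y := by
    funext j k l m y; exact weyl_eq hn j k l m y
  rw [e, covDeriv₄_add (fun j k l m => (hR j k l m).fun_add (hM j k l m))
    (fun j k l m => (hM k j l m).fun_neg), covDeriv₄_add hR hM,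
    covDeriv₄_neg (fun j k l m => metricSchouten G k j l m),
    covDeriv₄_swap_left (metricSchouten G),
    h.covDeriv_metricSchouten hx, h.covDeriv_metricSchouten hx]
  ring

theorem div_schouten (h : IsMetricOn G U) (hn : 3 ≤ n) (hx : x ∈ U) (j : Fin n) :
    contract (G x)⁻¹ (fun m s => covDeriv₂ G (schouten G) s j m x)
      = pd j (scalar G) x / (2 * ((n : ℝ) - 1)) := by
  have hn' : (3 : ℝ) ≤ n := by exact_mod_cast hn
  have h1 : (n : ℝ) - 1 ≠ 0 := by linarith
  have h2 : (n : ℝ) - 2 ≠ 0 := by linarith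
  simp only [h.covDeriv_schouten hx]
  rw [contract_sub, contract_const_mul, contract_const_mul, h.div_ricci hx]
  have := h.contract_metric_mul hx j (fun s => pd s (scalar G) x)
  simp only [mul_comm (pd _ _ x)]
  rw [this]
  field_simp
  ring

/-- The divergence of the Weyl tensor is a multiple of the Cotton tensor. -/
theorem divWeyl_eq (h : IsMetricOn G U) (hn : 3 ≤ n) (hx : x ∈ U) (j k l : Fin n) :
    divWeyl G j k l x = ((n : ℝ) - 3) / ((n : ℝ) - 2) *
      (covDeriv₂ G (ricci G) k j l x - covDeriv₂ G (ricci G) j k l x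
        + (pd j (scalar G) x * G x k l - pd k (scalar G) x * G x j l) / (2 * ((n : ℝ) - 1))) := by
  have hn' : (3 : ℝ) ≤ n := by exact_mod_cast hn
  have h1 : (n : ℝ) - 1 ≠ 0 := by linarith
  have h2 : (n : ℝ) - 2 ≠ 0 := by linarith
  have e : divWeyl G j k l x
      = contract (G x)⁻¹ (fun m s => covDeriv₄ G (weyl G) s j k l m x) := rfl
  rw [e]
  simp only [h.covDeriv_weyl hn hx]
  rw [contract_sub, contract_add, contract_add, contract_add, contract_mul_const,
    contract_mul_const, h.div_riemann hx, h.div_schouten hn hx, h.div_schouten hn hx,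
    h.contract_metric_mul hx j (fun s => covDeriv₂ G (schouten G) s k l x),
    h.contract_metric_mul hx k (fun s => covDeriv₂ G (schouten G) s j l x),
    h.covDeriv_schouten hx, h.covDeriv_schouten hx]
  field_simp
  ring

end IsMetricOn

end DivergenceOfWeyl

/-! ### Consequences of the concircular equation for the curvature. -/

section ConcircularField

variable {n : ℕ}

/-- The contravariant components of the covector field `w`. -/
def raise (G : Coord n → Matrix (Fin n) (Fin n) ℝ) (w : Fin n → Coord n → ℝ) (x : Coord n)
    (a : Fin n) : ℝ :=
  ∑ b, (G x)⁻¹ a b * w b x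

/-- The squared length `g^{ab} w_a w_b`. -/
def normSq (G : Coord n → Matrix (Fin n) (Fin n) ℝ) (w : Fin n → Coord n → ℝ) (x : Coord n) : ℝ :=
  contract (G x)⁻¹ (fun a b => w a x * w b x)

/-- A nowhere null covector field `w` with `∇_j w_k = r g_{jk}`. -/
structure IsConcircularOn (G : Coord n → Matrix (Fin n) (Fin n) ℝ) (U : Set (Coord n))
    (w : Fin n → Coord n → ℝ) (r : Coord n → ℝ) : Prop extends IsMetricOn G U where
  smooth_covector : ∀ k, ContDiffOn ℝ ∞ (w k) U
  smooth_potential : ContDiffOn ℝ ∞ r U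
  normSq_ne_zero : ∀ x ∈ U, normSq G w x ≠ 0
  concircular : ∀ x ∈ U, ∀ j k, covDeriv₁ G w j k x = r x * G x j k

/-- The factor `σ` in `∂_i r = σ w_i`. -/
def slope (G : Coord n → Matrix (Fin n) (Fin n) ℝ) (w : Fin n → Coord n → ℝ) (r : Coord n → ℝ)
    (x : Coord n) : ℝ :=
  pairing (raise G w x) (fun a => pd a r x) / normSq G w x

/-- The Hessian `∇_s ∂_k r`, expressed through the slope. -/
def hess (G : Coord n → Matrix (Fin n) (Fin n) ℝ) (w : Fin n → Coord n → ℝ) (r : Coord n → ℝ)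
    (s k : Fin n) (x : Coord n) : ℝ :=
  pd s (slope G w r) x * w k x + slope G w r x * r x * G x s k

theorem pairing_comm (u v : Fin n → ℝ) (f : Fin n → Fin n → ℝ) :
    pairing u (fun a => pairing v (fun b => f a b))
      = pairing v (fun b => pairing u (fun a => f a b)) := by
  simp only [pairing, Finset.mul_sum]
  rw [Finset.sum_comm]
  exact Finset.sum_congr rfl fun a _ => Finset.sum_congr rfl fun b _ => by ring

variable {G : Coord n → Matrix (Fin n) (Fin n) ℝ} {U : Set (Coord n)} {w : Fin n → Coord n → ℝ}
  {r : Coord n → ℝ} {x : Coord n}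

theorem pairing_raise (f : Fin n → ℝ) :
    pairing (raise G w x) f = contract (G x)⁻¹ (fun a b => f a * w b x) := by
  simp only [pairing, raise, contract, Finset.sum_mul]
  exact Finset.sum_congr rfl fun a _ => Finset.sum_congr rfl fun b _ => by ring

theorem pairing_raise_covector : pairing (raise G w x) (fun a => w a x) = normSq G w x :=
  pairing_raise _

namespace IsConcircularOn

theorem pairing_metric (h : IsConcircularOn G U w r) (hx : x ∈ U) (k : Fin n) :
    pairing (raise G w x) (fun a => G x k a) = w k x := by
  rw [pairing_raise]; exact h.contract_metric_mul hx k (fun b => w b x)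

theorem pairing_metric' (h : IsConcircularOn G U w r) (hx : x ∈ U) (k : Fin n) :
    pairing (raise G w x) (fun a => G x a k) = w k x := by
  simp only [h.apply_comm x _ k]; exact h.pairing_metric hx k

theorem contract_covector_mul (h : IsConcircularOn G U w r) (f : Fin n → ℝ) :
    contract (G x)⁻¹ (fun a b => w a x * f b) = pairing (raise G w x) f := by
  rw [pairing_raise, ← contract_swap _ (h.invMetric_comm x)]
  simp only [mul_comm]

theorem eq_zero_of_mul_covector (h : IsConcircularOn G U w r) (hx : x ∈ U) {c : ℝ}
    (hc : ∀ k, c * w k x = 0) : c = 0 := by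
  have h1 : pairing (raise G w x) (fun k => c * w k x) = 0 := by simp [hc, pairing]
  rw [pairing_const_mul, pairing_raise_covector] at h1
  exact (mul_eq_zero.1 h1).resolve_right (h.normSq_ne_zero x hx)

/-- Contract the proportionality with `w^j` and divide by the squared length. This is how a
differential is recognised as a multiple of `w` throughout. -/
theorem eq_mul_covector (h : IsConcircularOn G U w r) (hx : x ∈ U) {v : Fin n → ℝ}
    (hv : ∀ i j, v i * w j x = v j * w i x) (i : Fin n) :
    v i = pairing (raise G w x) v / normSq G w x * w i x := by
  have h1 : pairing (raise G w x) (fun j => v i * w j x)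
      = pairing (raise G w x) (fun j => v j * w i x) := by simp only [hv i]
  rw [pairing_const_mul, pairing_raise_covector, pairing_mul_const] at h1
  field_simp [h.normSq_ne_zero x hx]
  exact h1

theorem pd_covector (h : IsConcircularOn G U w r) (hx : x ∈ U) (j k : Fin n) :
    pd j (w k) x = r x * G x j k + ∑ m, christoffel G m j k x * w m x :=
  eq_add_of_sub_eq (h.concircular x hx j k)

theorem pd_metric (h : IsMetricOn G U) (hx : x ∈ U) (s j k : Fin n) :
    pd s (fun y => G y j k) x = ∑ a, christoffel G a s j x * G x a k
      + ∑ a, christoffel G a s k x * G x j a := by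
  have := h.covDeriv_metric hx s j k
  unfold covDeriv₂ at this
  linarith

/-- The Ricci identity for `w`: second partials of `w_k` are computed from the concircular equation
and then commuted. -/
theorem sum_curvature_mul (h : IsConcircularOn G U w r) (hx : x ∈ U) (i j k : Fin n) :
    ∑ m, curvature G i j x m k * w m x = pd i r x * G x j k - pd j r x * G x i k := by
  have hw := fun k => differentiableAt_of_contDiffOn h.isOpen (h.smooth_covector k) hx
  have hr := differentiableAt_of_contDiffOn h.isOpen h.smooth_potential hx
  have hG := fun a b => h.smooth.differentiableAt h.isOpen hx a b
  have hΓ : ∀ j m k, DifferentiableAt ℝ (christoffel G m j k) x := fun j m k =>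
    (h.smooth_connection j).differentiableAt h.isOpen hx m k
  have key : ∀ i j, pd i (pd j (w k)) x = pd i r x * G x j k
      + r x * pd i (fun y => G y j k) x
      + (∑ m, pd i (christoffel G m j k) x * w m x
        + r x * ∑ m, christoffel G m j k x * G x i m
        + ∑ a, (∑ m, christoffel G a i m x * christoffel G m j k x) * w a x) := by
    intro i j
    have hs : DifferentiableAt ℝ (fun y => ∑ m, christoffel G m j k y * w m y) x :=
      DifferentiableAt.fun_sum fun m _ => (hΓ j m k).fun_mul (hw m)
    rw [pd_congr h.isOpen (fun y hy => h.pd_covector hy j k) hx, pd_add (hr.fun_mul (hG j k)) hs,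
      pd_mul hr (hG j k), pd_sum _ (fun m _ => (hΓ j m k).fun_mul (hw m))]
    congr 1
    have e : ∀ m, pd i (fun y => christoffel G m j k y * w m y) x
        = pd i (christoffel G m j k) x * w m x + r x * (christoffel G m j k x * G x i m)
          + ∑ a, christoffel G a i m x * christoffel G m j k x * w a x := by
      intro m
      rw [pd_mul (hΓ j m k) (hw m), h.pd_covector hx i m, mul_add, Finset.mul_sum]
      have : ∀ a, christoffel G m j k x * (christoffel G a i m x * w a x)
          = christoffel G a i m x * christoffel G m j k x * w a x := fun a => by ring
      simp only [this]
      ring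
    simp only [e, Finset.sum_add_distrib, Finset.mul_sum, Finset.sum_mul]
    rw [Finset.sum_comm (f := fun m a => christoffel G a i m x * christoffel G m j k x * w a x)]
  have h0 := pd_comm h.isOpen (h.smooth_covector k) hx i j
  rw [key, key, pd_metric h.toIsMetricOn hx, pd_metric h.toIsMetricOn hx] at h0
  have h1 : ∑ a, christoffel G a i j x * G x a k = ∑ a, christoffel G a j i x * G x a k :=
    Finset.sum_congr rfl fun a _ => by rw [h.christoffel_comm]
  have h2 : ∑ m, curvature G i j x m k * w m x
      = ∑ m, pd j (christoffel G m i k) x * w m x - ∑ m, pd i (christoffel G m j k) x * w m x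
        + (∑ a, (∑ m, christoffel G a j m x * christoffel G m i k x) * w a x
          - ∑ a, (∑ m, christoffel G a i m x * christoffel G m j k x) * w a x) := by
    rw [← Finset.sum_sub_distrib, ← Finset.sum_sub_distrib, ← Finset.sum_add_distrib]
    refine Finset.sum_congr rfl fun m _ => ?_
    simp only [curvature, Matrix.of_apply, riemannUp, Finset.sum_sub_distrib]
    ring
  rw [h2]
  rw [h1] at h0
  linear_combination -h0

theorem pairing_lower (h : IsConcircularOn G U w r) (hx : x ∈ U) (c : Fin n → ℝ) :
    pairing (raise G w x) (fun l => ∑ b, c b * G x b l) = ∑ b, c b * w b x := by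
  have : pairing (raise G w x) (fun l => ∑ b, c b * G x b l)
      = ∑ b, c b * pairing (raise G w x) (fun l => G x b l) := by
    simp only [pairing, Finset.mul_sum]
    rw [Finset.sum_comm]
    exact Finset.sum_congr rfl fun a _ => Finset.sum_congr rfl fun b _ => by ring
  simp only [this, h.pairing_metric hx]

theorem pairing_riemann' (h : IsConcircularOn G U w r) (hx : x ∈ U) (i j k : Fin n) :
    pairing (raise G w x) (fun l => riemann G i j k l x)
      = pd i r x * G x j k - pd j r x * G x i k := by
  rw [← h.sum_curvature_mul hx, ← h.pairing_lower hx]; rfl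

/-- Contracting `sum_curvature_mul` with `w^k` as well gives zero by skewness of the Riemann tensor
in its last pair, so `dr` and `w` are proportional. -/
theorem pd_potential (h : IsConcircularOn G U w r) (hx : x ∈ U) (i : Fin n) :
    pd i r x = slope G w r x * w i x := by
  refine h.eq_mul_covector hx (v := fun i => pd i r x) (fun i j => ?_) i
  have h1 : pairing (raise G w x) (fun k => pairing (raise G w x)
      (fun l => riemann G i j k l x)) = 0 := by
    have e := pairing_comm (raise G w x) (raise G w x) (fun k l => riemann G i j k l x)
    have e2 : pairing (raise G w x) (fun l => pairing (raise G w x)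
        (fun k => riemann G i j k l x)) = - pairing (raise G w x) (fun k => pairing (raise G w x)
        (fun l => riemann G i j k l x)) := by
      rw [← pairing_neg]
      congr 1
      funext l
      rw [← pairing_neg]
      congr 1
      funext k
      exact h.riemann_skew_right hx i j l k
    linarith
  simp only [h.pairing_riemann' hx] at h1
  rw [pairing_sub, pairing_const_mul, pairing_const_mul, h.pairing_metric hx,
    h.pairing_metric hx] at h1
  linarith

theorem pairing_riemann (h : IsConcircularOn G U w r) (hx : x ∈ U) (i j k : Fin n) :
    pairing (raise G w x) (fun l => riemann G i j k l x)
      = slope G w r x * (w i x * G x j k - w j x * G x i k) := by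
  rw [h.pairing_riemann' hx, h.pd_potential hx, h.pd_potential hx]; ring

theorem pairing_ricci (h : IsConcircularOn G U w r) (hx : x ∈ U) (k : Fin n) :
    pairing (raise G w x) (fun l => ricci G k l x)
      = -((n : ℝ) - 1) * slope G w r x * w k x := by
  have e : ∀ l, ricci G k l x = contract (G x)⁻¹ (fun j m => riemann G j k m l x) := fun l => by
    rw [← neg_neg (ricci G k l x), ← h.contract_riemann hx, ← contract_neg]
    simp only [fun j m => h.riemann_skew_right hx j k l m]
  simp only [e]
  rw [pairing_contract]
  simp only [h.pairing_riemann hx]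
  rw [contract_const_mul, contract_sub, IsMetricOn.contract_mul_metric h.toIsMetricOn hx k (fun j => w j x),
    h.contract_const_mul_metric hx]
  ring

theorem smooth_raise (h : IsConcircularOn G U w r) (a : Fin n) :
    ContDiffOn ℝ ∞ (fun x => raise G w x a) U :=
  ContDiffOn.sum fun b _ => (h.smooth_inv a b).mul (h.smooth_covector b)

theorem smooth_normSq (h : IsConcircularOn G U w r) : ContDiffOn ℝ ∞ (normSq G w) U := by
  have : ContDiffOn ℝ ∞ (fun x => ∑ a, ∑ b, (G x)⁻¹ a b * (w a x * w b x)) U :=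
    ContDiffOn.sum fun a _ => ContDiffOn.sum fun b _ =>
      (h.smooth_inv a b).mul ((h.smooth_covector a).mul (h.smooth_covector b))
  exact this

theorem smooth_slope (h : IsConcircularOn G U w r) : ContDiffOn ℝ ∞ (slope G w r) U :=
  (ContDiffOn.sum fun a _ => (h.smooth_raise a).mul
    (contDiffOn_pd h.isOpen h.smooth_potential a)).div h.smooth_normSq h.normSq_ne_zero

/-- Second partials of `r` commute, `dr` is the slope times `w`, and `∇w` is symmetric. By
`eq_mul_covector` the differential of the slope is again a multiple of `w`. -/
theorem pd_slope_mul (h : IsConcircularOn G U w r) (hx : x ∈ U) (i j : Fin n) :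
    pd i (slope G w r) x * w j x = pd j (slope G w r) x * w i x := by
  have hw := fun k => differentiableAt_of_contDiffOn h.isOpen (h.smooth_covector k) hx
  have hs := differentiableAt_of_contDiffOn h.isOpen h.smooth_slope hx
  have key : ∀ i j, pd i (pd j r) x = pd i (slope G w r) x * w j x
      + slope G w r x * pd i (w j) x := fun i j => by
    rw [pd_congr h.isOpen (fun y hy => h.pd_potential hy j) hx, pd_mul hs (hw j)]
  have h0 := pd_comm h.isOpen h.smooth_potential hx i j
  rw [key, key, h.pd_covector hx, h.pd_covector hx, h.apply_comm x j i] at h0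
  simp only [h.christoffel_comm _ j i] at h0
  linarith

theorem hess_comm (h : IsConcircularOn G U w r) (hx : x ∈ U) (i j : Fin n) :
    hess G w r i j x = hess G w r j i x := by
  rw [hess, hess, h.pd_slope_mul hx, h.apply_comm x i j]

/-- Covariant derivative of `pairing_riemann`. The last term is the one in which the derivative
falls on `w` and reproduces the metric times `r`. -/
theorem pairing_covRiemann (h : IsConcircularOn G U w r) (hx : x ∈ U) (s i j k : Fin n) :
    pairing (raise G w x) (fun l => covDeriv₄ G (riemann G) s i j k l x)
      = hess G w r s i x * G x j k - hess G w r s j x * G x i k - r x * riemann G i j k s x := by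
  have hw := fun k => differentiableAt_of_contDiffOn h.isOpen (h.smooth_covector k) hx
  have hσ := differentiableAt_of_contDiffOn h.isOpen h.smooth_slope hx
  have hG := fun a b => h.smooth.differentiableAt h.isOpen hx a b
  have hR := fun i j m k => (h.smooth_curvature i j).differentiableAt h.isOpen hx m k
  -- Writing the contraction as `R_{ijk}{}^m w_m` keeps `w` covariant, so no derivative of the
  -- inverse metric occurs. The derivative of `T` is computed twice, from this definition in `h1`
  -- and from `hTU` in `h3`.
  set T : Fin n → Fin n → Fin n → Coord n → ℝ := fun i j k y => ∑ m, curvature G i j y m k * w m y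
    with hT
  have hTU : ∀ i j k, ∀ y ∈ U, T i j k y = slope G w r y * (w i y * G y j k - w j y * G y i k) :=
    fun i j k y hy => by
      rw [hT]
      simp only [h.sum_curvature_mul hy, h.pd_potential hy]
      ring
  have h1 : pd s (T i j k) x = ∑ m, pd s (fun y => curvature G i j y m k) x * w m x
      + r x * riemann G i j k s x
      + ∑ m, (∑ a, christoffel G m s a x * curvature G i j x a k) * w m x := by
    rw [hT]
    simp only
    rw [pd_sum _ (fun m _ => (hR i j m k).fun_mul (hw m))]
    have e : ∀ m, pd s (fun y => curvature G i j y m k * w m y) x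
        = pd s (fun y => curvature G i j y m k) x * w m x
          + r x * (riemannUp G i j k m x * G x m s)
          + ∑ a, christoffel G a s m x * curvature G i j x m k * w a x := by
      intro m
      rw [pd_mul (hR i j m k) (hw m), h.pd_covector hx s m, mul_add, Finset.mul_sum,
        h.apply_comm x s m]
      have : ∀ a, curvature G i j x m k * (christoffel G a s m x * w a x)
          = christoffel G a s m x * curvature G i j x m k * w a x := fun a => by ring
      simp only [this]
      simp only [curvature, Matrix.of_apply]
      ring
    simp only [e, Finset.sum_add_distrib, Finset.sum_mul, riemann, Finset.mul_sum]
    rw [Finset.sum_comm (f := fun m a => christoffel G a s m x * curvature G i j x m k * w a x)]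
  have h2 : pairing (raise G w x) (fun l => covDeriv₄ G (riemann G) s i j k l x)
      = pd s (T i j k) x - r x * riemann G i j k s x - ∑ a, christoffel G a s i x * T a j k x
        - ∑ a, christoffel G a s j x * T i a k x - ∑ a, christoffel G a s k x * T i j a x := by
    simp only [h.covDeriv_riemann hx, Matrix.mul_apply, Matrix.transpose_apply]
    rw [h.pairing_lower hx, h1]
    simp only [covCurvature, Matrix.sub_apply, Matrix.add_apply, Matrix.mul_apply,
      Matrix.sum_apply, Matrix.smul_apply, smul_eq_mul, sub_mul, add_mul, Finset.sum_sub_distrib,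
      Finset.sum_add_distrib]
    have e1 : ∑ m, (∑ a, curvature G i j x m a * connection G s x a k) * w m x
        = ∑ a, christoffel G a s k x * T i j a x := by
      simp only [hT, Finset.mul_sum, Finset.sum_mul]
      rw [Finset.sum_comm]
      refine Finset.sum_congr rfl fun a _ => Finset.sum_congr rfl fun m _ => ?_
      simp only [connection, Matrix.of_apply]; ring
    have e2 : ∑ m, (∑ a, christoffel G a s i x * curvature G a j x m k) * w m x
        = ∑ a, christoffel G a s i x * T a j k x := by
      simp only [hT, Finset.mul_sum, Finset.sum_mul]
      rw [Finset.sum_comm]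
      exact Finset.sum_congr rfl fun a _ => Finset.sum_congr rfl fun m _ => by ring
    have e3 : ∑ m, (∑ a, christoffel G a s j x * curvature G i a x m k) * w m x
        = ∑ a, christoffel G a s j x * T i a k x := by
      simp only [hT, Finset.mul_sum, Finset.sum_mul]
      rw [Finset.sum_comm]
      exact Finset.sum_congr rfl fun a _ => Finset.sum_congr rfl fun m _ => by ring
    rw [e1, e2, e3]
    simp only [connection, Matrix.of_apply, pdM]
    ring
  have h3 : pd s (T i j k) x = pd s (slope G w r) x * (w i x * G x j k - w j x * G x i k)
      + slope G w r x * ((pd s (w i) x * G x j k + w i x * pd s (fun y => G y j k) x)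
        - (pd s (w j) x * G x i k + w j x * pd s (fun y => G y i k) x)) := by
    rw [pd_congr h.isOpen (hTU i j k) hx,
      pd_mul hσ (((hw i).fun_mul (hG j k)).fun_sub ((hw j).fun_mul (hG i k))),
      pd_sub ((hw i).fun_mul (hG j k)) ((hw j).fun_mul (hG i k)), pd_mul (hw i) (hG j k),
      pd_mul (hw j) (hG i k)]
  have lin : ∀ (f u v : Fin n → ℝ) (c p q : ℝ), ∑ a, f a * (c * (u a * p - q * v a))
      = c * (p * ∑ a, f a * u a - q * ∑ a, f a * v a) := by
    intro f u v c p q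
    simp only [Finset.mul_sum, ← Finset.sum_sub_distrib]
    exact Finset.sum_congr rfl fun a _ => by ring
  have l1 : ∑ a, christoffel G a s i x * T a j k x = slope G w r x *
      (G x j k * ∑ a, christoffel G a s i x * w a x
        - w j x * ∑ a, christoffel G a s i x * G x a k) := by
    simp only [hTU _ _ _ x hx]
    exact lin _ (fun a => w a x) _ _ _ _
  have l2 : ∑ a, christoffel G a s j x * T i a k x = - (slope G w r x *
      (G x i k * ∑ a, christoffel G a s j x * w a x
        - w i x * ∑ a, christoffel G a s j x * G x a k)) := by
    rw [← lin _ (fun a => w a x) _ _ _ _, ← Finset.sum_neg_distrib]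
    refine Finset.sum_congr rfl fun a _ => ?_
    rw [hTU _ _ _ x hx]; ring
  have l3 : ∑ a, christoffel G a s k x * T i j a x = slope G w r x *
      (w i x * ∑ a, christoffel G a s k x * G x j a
        - w j x * ∑ a, christoffel G a s k x * G x i a) := by
    rw [← lin _ (fun a => G x j a) _ _ _ _]
    refine Finset.sum_congr rfl fun a _ => ?_
    rw [hTU _ _ _ x hx]; ring
  rw [h2, h3, l1, l2, l3, h.pd_covector hx, h.pd_covector hx, pd_metric h.toIsMetricOn hx,
    pd_metric h.toIsMetricOn hx]
  unfold hess
  ring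

theorem pairing_covRicci (h : IsConcircularOn G U w r) (hx : x ∈ U) (s k : Fin n) :
    pairing (raise G w x) (fun l => covDeriv₂ G (ricci G) s k l x)
      = -((n : ℝ) - 1) * hess G w r s k x - r x * ricci G k s x := by
  have e : ∀ l, covDeriv₂ G (ricci G) s k l x
      = contract (G x)⁻¹ (fun j m => covDeriv₄ G (riemann G) s j k m l x) := fun l => by
    rw [← neg_neg (covDeriv₂ G _ s k l x), ← h.contract_covRiemann hx, ← contract_neg]
    simp only [fun j m => h.covRiemann_skew_right hx s j k l m]
  simp only [e]
  rw [pairing_contract]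
  simp only [h.pairing_covRiemann hx, fun j m => h.riemann_skew_right hx j k s m]
  rw [contract_sub, contract_sub, contract_const_mul, contract_neg, h.contract_riemann hx,
    IsMetricOn.contract_mul_metric h.toIsMetricOn hx k (fun j => hess G w r s j x),
    h.contract_const_mul_metric hx]
  ring

theorem contract_riemann_outer (h : IsConcircularOn G U w r) (hx : x ∈ U) (l k : Fin n) :
    contract (G x)⁻¹ (fun m s => riemann G l m k s x) = ricci G l k x := by
  rw [← neg_neg (ricci G l k x), ← h.contract_riemann hx, ← contract_neg]
  congr 1
  funext m s
  exact IsMetricOn.riemann_skew_left m l k s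

/-- The contracted Bianchi identity turns the left side into a divergence of the Riemann tensor.
Pair symmetry moves the index contracted with `w` to the last place, where `pairing_covRiemann`
applies. No assumption on the Weyl tensor enters. -/
theorem pairing_cotton (h : IsConcircularOn G U w r) (hx : x ∈ U) (k l : Fin n) :
    pairing (raise G w x)
        (fun j => covDeriv₂ G (ricci G) k j l x - covDeriv₂ G (ricci G) j k l x)
      = r x * ricci G l k x
        + contract (G x)⁻¹ (fun m s => hess G w r s m x) * G x l k - hess G w r k l x := by
  have e : ∀ j m s, covDeriv₄ G (riemann G) s j k l m x
      = - covDeriv₄ G (riemann G) s l m k j x := fun j m s => by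
    rw [← h.covRiemann_swap_pairs hx, h.covRiemann_skew_right hx]
  simp only [← h.div_riemann hx]
  rw [pairing_contract]
  simp only [e, pairing_neg, h.pairing_covRiemann hx]
  have e1 : contract (G x)⁻¹ (fun m s => hess G w r s l x * G x m k) = hess G w r k l x := by
    rw [← h.contract_metric_mul hx k (fun s => hess G w r s l x)]
    simp only [h.apply_comm x k, mul_comm]
  rw [contract_neg, contract_sub, contract_sub, contract_const_mul, contract_mul_const, e1,
    h.contract_riemann_outer hx]
  ring

end IsConcircularOn

end ConcircularField

/-! ### Perfect fluids and harmonic Weyl tensor in one chart. -/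

section PerfectFluid

variable {n : ℕ} {G : Coord n → Matrix (Fin n) (Fin n) ℝ} {U : Set (Coord n)}
  {w : Fin n → Coord n → ℝ} {r : Coord n → ℝ} {x : Coord n}

/-- The eigenvalue of the Ricci tensor on the concircular field. -/
def eigenvalue (G : Coord n → Matrix (Fin n) (Fin n) ℝ) (w : Fin n → Coord n → ℝ)
    (r : Coord n → ℝ) (x : Coord n) : ℝ :=
  -((n : ℝ) - 1) * slope G w r x

/-- The squared length of the part of the Ricci tensor that is orthogonal to the concircular field
and trace-free. -/
def anisotropy (G : Coord n → Matrix (Fin n) (Fin n) ℝ) (w : Fin n → Coord n → ℝ)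
    (r : Coord n → ℝ) (x : Coord n) : ℝ :=
  (mixedRicci G x * mixedRicci G x).trace - eigenvalue G w r x * eigenvalue G w r x
    - 1 / ((n : ℝ) - 1) * ((scalar G x - eigenvalue G w r x) * (scalar G x - eigenvalue G w r x))

theorem contract_fluid (h : IsConcircularOn G U w r) (hx : x ∈ U) (A B : ℝ) :
    contract (G x)⁻¹ (fun a b => A * G x a b + B * (w a x * w b x)) = A * n + B * normSq G w x := by
  rw [contract_add, h.contract_const_mul_metric hx, contract_const_mul]; rfl

theorem pairing_fluid (h : IsConcircularOn G U w r) (hx : x ∈ U) (A B : ℝ) (k : Fin n) :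
    pairing (raise G w x) (fun l => A * G x k l + B * (w k x * w l x))
      = (A + B * normSq G w x) * w k x := by
  rw [pairing_add, pairing_const_mul, pairing_const_mul, pairing_const_mul, h.pairing_metric hx,
    pairing_raise_covector]
  ring

theorem trace_inv_mul_inv_mul (h : IsMetricOn G U) (K L : Matrix (Fin n) (Fin n) ℝ) :
    ((G x)⁻¹ * K * ((G x)⁻¹ * L)).trace
      = contract (G x)⁻¹ (fun a b => contract (G x)⁻¹ (fun c d => K a c * L d b)) := by
  rw [Matrix.mul_assoc, h.trace_inv_mul]
  congr 1
  funext a b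
  simp only [contract, Matrix.mul_apply, Finset.mul_sum]
  exact Finset.sum_congr rfl fun c _ => Finset.sum_congr rfl fun d _ => by ring

/-- Against a combination of `g` and `w w`, a tensor with eigenvector `w` contributes only its trace
and its eigenvalue. In particular a trace-free tensor annihilating `w` is orthogonal to all fluid
tensors. -/
theorem trace_mul_fluid (h : IsConcircularOn G U w r) (hx : x ∈ U)
    (K : Matrix (Fin n) (Fin n) ℝ) {μ : ℝ}
    (hK : ∀ k, pairing (raise G w x) (fun l => K k l) = μ * w k x) (A B : ℝ) :
    ((G x)⁻¹ * K * ((G x)⁻¹ * Matrix.of fun a b => A * G x a b + B * (w a x * w b x))).trace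
      = A * contract (G x)⁻¹ (fun a b => K a b) + B * (μ * normSq G w x) := by
  rw [trace_inv_mul_inv_mul h.toIsMetricOn]
  have e : ∀ a b, contract (G x)⁻¹ (fun c d => K a c *
      Matrix.of (fun a b => A * G x a b + B * (w a x * w b x)) d b)
      = A * (K a b + 0) + B * μ * (w a x * w b x) := by
    intro a b
    have e1 : ∀ c d, K a c * Matrix.of (fun a b => A * G x a b + B * (w a x * w b x)) d b
        = A * (K a c * G x b d) + B * w b x * (K a c * w d x) := fun c d => by
      rw [h.apply_comm x b d]
      simp only [Matrix.of_apply]; ring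
    simp only [e1]
    rw [contract_add, contract_const_mul, contract_const_mul,
      h.contract_mul_metric hx b (fun c => K a c), ← pairing_raise, hK]
    ring
  simp only [e]
  rw [contract_add, contract_const_mul, contract_const_mul, normSq]
  simp only [add_zero]
  ring

theorem trace_mixedRicci_mul_fluid (h : IsConcircularOn G U w r) (hx : x ∈ U) (A B : ℝ) :
    (mixedRicci G x * ((G x)⁻¹ * Matrix.of fun a b => A * G x a b + B * (w a x * w b x))).trace
      = A * scalar G x + B * (eigenvalue G w r x * normSq G w x) :=
  trace_mul_fluid h hx (ricciMatrix G x) (fun k => h.pairing_ricci hx k) A B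

namespace IsConcircularOn

theorem eigenvalue_of_fluid (h : IsConcircularOn G U w r) (hx : x ∈ U) {A B : ℝ}
    (hR : ∀ k l, ricci G k l x = A * G x k l + B * (w k x * w l x)) :
    A + B * normSq G w x = eigenvalue G w r x := by
  rw [← sub_eq_zero]
  refine h.eq_zero_of_mul_covector hx fun k => ?_
  have := h.pairing_ricci hx k
  simp only [hR] at this
  rw [pairing_fluid h hx] at this
  unfold eigenvalue
  linarith

theorem scalar_of_fluid (h : IsConcircularOn G U w r) (hx : x ∈ U) {A B : ℝ}
    (hR : ∀ k l, ricci G k l x = A * G x k l + B * (w k x * w l x)) :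
    scalar G x = A * n + B * normSq G w x := by
  rw [← contract_fluid h hx]
  simp only [← hR]
  rfl

theorem covDeriv_fluid (h : IsConcircularOn G U w r) (hx : x ∈ U) {α b : Coord n → ℝ}
    (hα : ContDiffOn ℝ ∞ α U) (hb : ContDiffOn ℝ ∞ b U)
    (hR : ∀ y ∈ U, ∀ k l, ricci G k l y = α y * G y k l + b y * (w k y * w l y)) (s k l : Fin n) :
    covDeriv₂ G (ricci G) s k l x = pd s α x * G x k l + pd s b x * (w k x * w l x)
      + b x * r x * (G x s k * w l x + w k x * G x s l) := by
  have hw := fun k => differentiableAt_of_contDiffOn h.isOpen (h.smooth_covector k) hx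
  have hα' := differentiableAt_of_contDiffOn h.isOpen hα hx
  have hb' := differentiableAt_of_contDiffOn h.isOpen hb hx
  have hG := h.smooth.differentiableAt h.isOpen hx k l
  unfold covDeriv₂
  rw [pd_congr h.isOpen (fun y hy => hR y hy k l) hx,
    pd_add (hα'.fun_mul hG) (hb'.fun_mul ((hw k).fun_mul (hw l))), pd_mul hα' hG,
    pd_mul hb' ((hw k).fun_mul (hw l)), pd_mul (hw k) (hw l), pd_metric h.toIsMetricOn hx,
    h.pd_covector hx, h.pd_covector hx]
  have e1 : ∑ a, christoffel G a s k x * ricci G a l x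
      = α x * ∑ a, christoffel G a s k x * G x a l
        + b x * w l x * ∑ a, christoffel G a s k x * w a x := by
    simp only [hR x hx, Finset.mul_sum, ← Finset.sum_add_distrib]
    exact Finset.sum_congr rfl fun a _ => by ring
  have e2 : ∑ a, christoffel G a s l x * ricci G k a x
      = α x * ∑ a, christoffel G a s l x * G x k a
        + b x * w k x * ∑ a, christoffel G a s l x * w a x := by
    simp only [hR x hx, Finset.mul_sum, ← Finset.sum_add_distrib]
    exact Finset.sum_congr rfl fun a _ => by ring
  rw [e1, e2]
  ring

/-- A perfect fluid with respect to a concircular field has harmonic Weyl tensor. -/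
theorem divWeyl_eq_zero_of_fluid (h : IsConcircularOn G U w r) (hn : 3 ≤ n) (hx : x ∈ U)
    {α b : Coord n → ℝ} (hα : ContDiffOn ℝ ∞ α U) (hb : ContDiffOn ℝ ∞ b U)
    (hR : ∀ y ∈ U, ∀ k l, ricci G k l y = α y * G y k l + b y * (w k y * w l y)) (j k l : Fin n) :
    divWeyl G j k l x = 0 := by
  rw [h.divWeyl_eq hn hx]
  -- In dimension three the factor `n - 3` in `divWeyl_eq` is zero.
  rcases hn.eq_or_lt with rfl | hn4
  · simp
  have hn' : (4 : ℝ) ≤ n := by exact_mod_cast hn4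
  have hn1 : (n : ℝ) - 1 ≠ 0 := by linarith
  have hn3 : (n : ℝ) - 3 ≠ 0 := by linarith
  have hs := h.normSq_ne_zero x hx
  have hD := h.covDeriv_fluid hx hα hb hR
  obtain ⟨σ', hσ⟩ : ∃ c, ∀ i, pd i (slope G w r) x = c * w i x :=
    ⟨_, h.eq_mul_covector hx (v := fun i => pd i (slope G w r) x)
      fun i j => h.pd_slope_mul hx i j⟩
  have hl := h.eigenvalue_of_fluid hx (hR x hx)
  -- The contraction of `∇_s R_{kl}` with `w^l`, evaluated in two ways; the terms in `g_{sk}` cancel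
  -- by the eigenvalue relation `hl`. Next, `h2` is the metric trace and `h3` the divergence.
  have h1 : ∀ s, pd s α x + pd s b x * normSq G w x
      = -(((n : ℝ) - 1) * σ' + 2 * b x * r x) * w s x := by
    intro s
    rw [← sub_eq_zero]
    refine h.eq_zero_of_mul_covector hx fun k => ?_
    have e := h.pairing_covRicci hx s k
    simp only [hD] at e
    rw [pairing_add, pairing_add, pairing_const_mul, pairing_const_mul, pairing_const_mul,
      pairing_const_mul, pairing_add, pairing_const_mul, pairing_const_mul, h.pairing_metric hx,
      h.pairing_metric hx, pairing_raise_covector, hR x hx, hess, hσ, h.apply_comm x k s] at e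
    unfold eigenvalue at hl
    linear_combination e - r x * G x s k * hl
  have h2 : ∀ s, pd s (scalar G) x = n * pd s α x + pd s b x * normSq G w x
      + 2 * b x * r x * w s x := by
    intro s
    rw [h.pd_scalar hx]
    simp only [hD]
    rw [contract_add, contract_fluid h hx, contract_const_mul, contract_add,
      h.contract_metric_mul hx s (fun b => w b x), h.contract_mul_metric hx s (fun b => w b x)]
    ring
  have h3 : ∀ k, pd k α x + pairing (raise G w x) (fun s => pd s b x) * w k x
      + b x * r x * (n + 1) * w k x = pd k (scalar G) x / 2 := by
    intro k
    rw [← h.div_ricci hx k]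
    simp only [hD]
    have e : ∀ m s, pd s α x * G x k m + pd s b x * (w k x * w m x)
        + b x * r x * (G x s k * w m x + w k x * G x s m)
        = G x k m * pd s α x + w k x * (w m x * pd s b x)
          + (b x * r x * (w m x * G x k s) + b x * r x * w k x * G x m s) := fun m s => by
      rw [h.apply_comm x s k, h.apply_comm x s m]; ring
    simp only [e]
    rw [contract_add, contract_add, contract_add, h.contract_metric_mul hx k (fun s => pd s α x),
      contract_const_mul, h.contract_covector_mul, contract_const_mul,
      h.contract_mul_metric hx k (fun m => w m x), h.contract_const_mul_metric hx]
    ring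
  -- Eliminating `db` between `h1` and `h2`, and then `dR` by `h3`, leaves `(n - 3) dα` equal to a
  -- multiple of `w`; the witness is that multiple divided by `n - 3`.
  obtain ⟨a, ha⟩ : ∃ a, ∀ i, pd i α x = a * w i x := by
    refine ⟨(2 * pairing (raise G w x) (fun s => pd s b x) + 2 * b x * r x * (n + 1)
      + ((n : ℝ) - 1) * σ') / ((n : ℝ) - 3), fun i => ?_⟩
    have := h3 i
    have := h2 i
    have := h1 i
    field_simp
    linarith
  obtain ⟨c, hc⟩ : ∃ c, ∀ i, pd i b x = c * w i x := by
    refine ⟨(-(((n : ℝ) - 1) * σ' + 2 * b x * r x) - a) / normSq G w x, fun i => ?_⟩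
    have := h1 i
    rw [ha] at this
    field_simp
    linarith
  have h4 : ∀ s, pd s (scalar G) x = 2 * ((n : ℝ) - 1) * (a - b x * r x) * w s x := by
    intro s
    have e2 := h2 s
    have e3 := h3 s
    simp only [hc] at e3
    rw [pairing_const_mul, pairing_raise_covector, ha] at e3
    rw [ha, hc] at e2
    linarith
  -- The `db` terms cancel under antisymmetrisation. What is left is `(a - b r)(w_k g_{jl} - w_j
  -- g_{kl})`, which the scalar term balances by `h4`.
  have h5 : covDeriv₂ G (ricci G) k j l x - covDeriv₂ G (ricci G) j k l x
      + (pd j (scalar G) x * G x k l - pd k (scalar G) x * G x j l) / (2 * ((n : ℝ) - 1)) = 0 := by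
    rw [hD, hD, h4, h4, ha, ha, hc, hc, h.apply_comm x k j]
    field_simp
    ring
  rw [h5, mul_zero]

/-- For `n ≥ 4` the Cotton tensor vanishes. Contracted with `w^l`, the Ricci part drops out because
`w^l ∇_s R_{kl}` is symmetric in `s` and `k`; hence `dR` is proportional to `w`, which supplies `τ`.
-/
theorem cotton_of_divWeyl (h : IsConcircularOn G U w r) (hn : 4 ≤ n) (hx : x ∈ U)
    (hC : ∀ j k l, divWeyl G j k l x = 0) :
    ∃ τ : ℝ, ∀ j k l, covDeriv₂ G (ricci G) k j l x - covDeriv₂ G (ricci G) j k l x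
      = τ * (w k x * G x j l - w j x * G x k l) := by
  have hn' : (4 : ℝ) ≤ n := by exact_mod_cast hn
  have hn1 : (n : ℝ) - 1 ≠ 0 := by linarith
  have hn2 : (n : ℝ) - 2 ≠ 0 := by linarith
  have hn3 : (n : ℝ) - 3 ≠ 0 := by linarith
  have h1 : ∀ j k l, covDeriv₂ G (ricci G) k j l x - covDeriv₂ G (ricci G) j k l x
      + (pd j (scalar G) x * G x k l - pd k (scalar G) x * G x j l) / (2 * ((n : ℝ) - 1)) = 0 := by
    intro j k l
    have := hC j k l
    rw [h.divWeyl_eq (by omega) hx] at this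
    exact (mul_eq_zero.1 this).resolve_left (div_ne_zero hn3 hn2)
  have h2 : ∀ j k l, covDeriv₂ G (ricci G) k j l x - covDeriv₂ G (ricci G) j k l x
      = 1 / (2 * ((n : ℝ) - 1)) *
        (pd k (scalar G) x * G x j l - pd j (scalar G) x * G x k l) := fun j k l => by
    linear_combination h1 j k l
  have h3 : ∀ j k, pd j (scalar G) x * w k x = pd k (scalar G) x * w j x := by
    intro j k
    have e : pairing (raise G w x)
        (fun l => covDeriv₂ G (ricci G) k j l x - covDeriv₂ G (ricci G) j k l x) = 0 := by
      rw [pairing_sub, h.pairing_covRicci hx, h.pairing_covRicci hx, h.hess_comm hx,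
        h.ricci_comm hx]
      ring
    simp only [h2] at e
    rw [pairing_const_mul, pairing_sub, pairing_const_mul, pairing_const_mul, h.pairing_metric hx,
      h.pairing_metric hx] at e
    have := (mul_eq_zero.1 e).resolve_left (by positivity)
    linarith
  have h4 := h.eq_mul_covector hx (v := fun i => pd i (scalar G) x) h3
  refine ⟨1 / (2 * ((n : ℝ) - 1)) *
    (pairing (raise G w x) (fun i => pd i (scalar G) x) / normSq G w x), fun j k l => ?_⟩
  rw [h2, h4 j, h4 k]
  ring

/-- The antisymmetrised derivative of the Ricci tensor, contracted with `w^j`, has two values: a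
fluid tensor by `cotton_of_divWeyl`, and `r R_{kl}` plus a fluid tensor by `pairing_cotton`. -/
theorem mul_ricci_eq_fluid (h : IsConcircularOn G U w r) (hn : 4 ≤ n) (hx : x ∈ U)
    (hC : ∀ j k l, divWeyl G j k l x = 0) :
    ∃ A B : ℝ, ∀ k l, r x * ricci G k l x = A * G x k l + B * (w k x * w l x) := by
  obtain ⟨τ, hτ⟩ := h.cotton_of_divWeyl hn hx hC
  obtain ⟨σ', hσ⟩ : ∃ c, ∀ i, pd i (slope G w r) x = c * w i x :=
    ⟨_, h.eq_mul_covector hx (v := fun i => pd i (slope G w r) x)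
      fun i j => h.pd_slope_mul hx i j⟩
  refine ⟨slope G w r x * r x - contract (G x)⁻¹ (fun m s => hess G w r s m x)
    - τ * normSq G w x, σ' + τ, fun k l => ?_⟩
  have e := h.pairing_cotton hx k l
  simp only [hτ] at e
  rw [pairing_const_mul, pairing_sub, pairing_const_mul, pairing_mul_const,
    h.pairing_metric' hx, pairing_raise_covector, hess, hσ, h.ricci_comm hx, h.apply_comm x l k] at e
  linear_combination -e

/-- The Cotton relation exchanges the differentiated index for a Ricci index. `pairing_covRicci`
then leaves the Hessian and `r R_{kl}`, both of fluid form. Unlike `mul_ricci_eq_fluid`, this keeps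
its force where `r = 0`. -/
theorem pairing_covRicci_eq_fluid (h : IsConcircularOn G U w r) (hn : 4 ≤ n) (hx : x ∈ U)
    (hC : ∀ j k l, divWeyl G j k l x = 0) :
    ∃ A B : ℝ, ∀ k l, pairing (raise G w x) (fun j => covDeriv₂ G (ricci G) j k l x)
      = A * G x k l + B * (w k x * w l x) := by
  obtain ⟨τ, hτ⟩ := h.cotton_of_divWeyl hn hx hC
  obtain ⟨A, B, hAB⟩ := h.mul_ricci_eq_fluid hn hx hC
  obtain ⟨σ', hσ⟩ : ∃ c, ∀ i, pd i (slope G w r) x = c * w i x :=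
    ⟨_, h.eq_mul_covector hx (v := fun i => pd i (slope G w r) x)
      fun i j => h.pd_slope_mul hx i j⟩
  refine ⟨-((n : ℝ) - 1) * (slope G w r x * r x) - A + τ * normSq G w x,
    -((n : ℝ) - 1) * σ' - B - τ, fun k l => ?_⟩
  have e1 : ∀ j, covDeriv₂ G (ricci G) j k l x = covDeriv₂ G (ricci G) k l j x
      - τ * (w k x * G x j l - w j x * G x k l) := fun j => by
    rw [h.covRicci_comm hx k l j]
    linarith [hτ j k l]
  simp only [e1]
  rw [pairing_sub, h.pairing_covRicci hx, pairing_const_mul, pairing_sub, pairing_const_mul,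
    pairing_mul_const, h.pairing_metric' hx, pairing_raise_covector, hAB, hess, hσ,
    h.apply_comm x l k]
  ring

/-- The anisotropy is quadratic in the Ricci tensor; replacing one factor by the fluid form of `r
R_{kl}` gives the pairing of a fluid tensor with a tensor orthogonal to all fluid tensors. Nothing
is divided by `r`. -/
theorem mul_anisotropy_eq_zero (h : IsConcircularOn G U w r) (hn : 4 ≤ n) (hx : x ∈ U)
    (hC : ∀ j k l, divWeyl G j k l x = 0) : r x * anisotropy G w r x = 0 := by
  have hn' : (4 : ℝ) ≤ n := by exact_mod_cast hn
  have hn1 : (n : ℝ) - 1 ≠ 0 := by linarith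
  obtain ⟨A, B, hAB⟩ := h.mul_ricci_eq_fluid hn hx hC
  have h1 : r x * scalar G x = A * n + B * normSq G w x := by
    rw [← contract_fluid h hx]
    simp only [← hAB]
    rw [contract_const_mul]
    rfl
  have h2 : r x * eigenvalue G w r x = A + B * normSq G w x := by
    rw [← sub_eq_zero]
    refine h.eq_zero_of_mul_covector hx fun k => ?_
    have e : pairing (raise G w x) (fun l => r x * ricci G k l x)
        = (A + B * normSq G w x) * w k x := by
      rw [← pairing_fluid h hx]
      simp only [hAB]
    rw [pairing_const_mul, h.pairing_ricci hx] at e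
    unfold eigenvalue
    linarith
  have h3 : r x * (mixedRicci G x * mixedRicci G x).trace
      = A * scalar G x + B * (eigenvalue G w r x * normSq G w x) := by
    rw [← trace_mixedRicci_mul_fluid h hx, ← smul_eq_mul, ← Matrix.trace_smul, ← Matrix.mul_smul]
    congr 2
    rw [mixedRicci, ← Matrix.mul_smul]
    congr 1
    ext k l
    exact hAB k l
  unfold anisotropy
  field_simp
  linear_combination ((n : ℝ) - 1) * h3 - ((n : ℝ) - 1) * eigenvalue G w r x * h2
    - (scalar G x - eigenvalue G w r x) * (h1 - h2)

theorem smooth_eigenvalue (h : IsConcircularOn G U w r) :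
    ContDiffOn ℝ ∞ (eigenvalue G w r) U :=
  contDiffOn_const.mul h.smooth_slope

theorem smooth_trace_mixedRicci_mul_self (h : IsMetricOn G U) :
    ContDiffOn ℝ ∞ (fun y => (mixedRicci G y * mixedRicci G y).trace) U := by
  have := h.smooth_mixedRicci.mul h.smooth_mixedRicci
  exact ContDiffOn.sum fun a _ => this a a

theorem smooth_anisotropy (h : IsConcircularOn G U w r) :
    ContDiffOn ℝ ∞ (anisotropy G w r) U := by
  have hd := h.smooth_scalar.sub h.smooth_eigenvalue
  exact ((smooth_trace_mixedRicci_mul_self h.toIsMetricOn).sub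
    (h.smooth_eigenvalue.mul h.smooth_eigenvalue)).sub (contDiffOn_const.mul (hd.mul hd))

/-- The same orthogonality: along `w` the derivative of the anisotropy pairs its defining tensor
with the derivative of the Ricci tensor, which is of fluid form. The coefficients `A`, `B` determine
the derivatives of the scalar, the eigenvalue and the squared length. -/
theorem pairing_pd_anisotropy (h : IsConcircularOn G U w r) (hn : 4 ≤ n) (hx : x ∈ U)
    (hC : ∀ j k l, divWeyl G j k l x = 0) :
    pairing (raise G w x) (fun s => pd s (anisotropy G w r) x) = 0 := by
  have hn' : (4 : ℝ) ≤ n := by exact_mod_cast hn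
  have hn1 : (n : ℝ) - 1 ≠ 0 := by linarith
  obtain ⟨A, B, hAB⟩ := h.pairing_covRicci_eq_fluid hn hx hC
  obtain ⟨σ', hσ⟩ : ∃ c, ∀ i, pd i (slope G w r) x = c * w i x :=
    ⟨_, h.eq_mul_covector hx (v := fun i => pd i (slope G w r) x)
      fun i j => h.pd_slope_mul hx i j⟩
  have hQ := differentiableAt_of_contDiffOn h.isOpen
    (smooth_trace_mixedRicci_mul_self h.toIsMetricOn) hx
  have hR := differentiableAt_of_contDiffOn h.isOpen h.smooth_scalar hx
  have hS := differentiableAt_of_contDiffOn h.isOpen h.smooth_slope hx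
  have hl := differentiableAt_of_contDiffOn h.isOpen h.smooth_eigenvalue hx
  have h1 : pairing (raise G w x) (fun s => pd s (scalar G) x) = A * n + B * normSq G w x := by
    simp only [h.pd_scalar hx]
    rw [pairing_contract]
    simp only [hAB]
    exact contract_fluid h hx A B
  have h2 : pairing (raise G w x) (fun s => pd s (eigenvalue G w r) x)
      = A + B * normSq G w x := by
    have e1 : ∀ s, pd s (eigenvalue G w r) x = -((n : ℝ) - 1) * σ' * w s x := fun s => by
      have : pd s (eigenvalue G w r) x = -((n : ℝ) - 1) * pd s (slope G w r) x :=
        pd_const_mul _ hS s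
      rw [this, hσ]; ring
    simp only [e1]
    -- The derivative of the eigenvalue is read off by contracting the derivative of the Ricci
    -- tensor along `w` once more with `w`.
    rw [pairing_const_mul, pairing_raise_covector, ← sub_eq_zero]
    refine h.eq_zero_of_mul_covector hx fun k => ?_
    have e2 : pairing (raise G w x) (fun j => pairing (raise G w x)
        (fun l => covDeriv₂ G (ricci G) j k l x)) = (A + B * normSq G w x) * w k x := by
      rw [pairing_comm]
      simp only [hAB]
      exact pairing_fluid h hx A B k
    have e3 : ∀ j, -((n : ℝ) - 1) * hess G w r j k x - r x * ricci G k j x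
        = -((n : ℝ) - 1) * σ' * w k x * w j x
          + (-((n : ℝ) - 1) * (slope G w r x * r x) * G x k j - r x * ricci G k j x) := fun j => by
      rw [hess, hσ, h.apply_comm x k j]; ring
    simp only [h.pairing_covRicci hx, e3] at e2
    rw [pairing_add, pairing_sub, pairing_const_mul, pairing_const_mul, pairing_const_mul,
      pairing_raise_covector, h.pairing_metric hx, h.pairing_ricci hx] at e2
    linear_combination e2
  have h3 : pairing (raise G w x)
      (fun s => pd s (fun y => (mixedRicci G y * mixedRicci G y).trace) x)
      = 2 * (A * scalar G x + B * (eigenvalue G w r x * normSq G w x)) := by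
    rw [← trace_mixedRicci_mul_fluid h hx]
    simp only [h.pd_trace_mixedRicci_mul_self hx]
    rw [pairing_const_mul, mixedRicci]
    congr 1
    simp only [trace_inv_mul_inv_mul h.toIsMetricOn]
    rw [pairing_contract]
    congr 1
    funext a b
    rw [pairing_contract]
    congr 1
    funext c d
    rw [pairing_const_mul, Matrix.of_apply, ← hAB]
    rfl
  have h4 : ∀ s, pd s (anisotropy G w r) x
      = pd s (fun y => (mixedRicci G y * mixedRicci G y).trace) x
        - 2 * eigenvalue G w r x * pd s (eigenvalue G w r) x
        - 2 / ((n : ℝ) - 1) * (scalar G x - eigenvalue G w r x)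
          * (pd s (scalar G) x - pd s (eigenvalue G w r) x) := by
    intro s
    have hd := hR.fun_sub hl
    have e : pd s (anisotropy G w r) x = _ :=
      pd_sub (hQ.fun_sub (hl.fun_mul hl)) ((hd.fun_mul hd).const_mul (1 / ((n : ℝ) - 1))) s
    rw [e, pd_sub hQ (hl.fun_mul hl), pd_mul hl hl, pd_const_mul _ (hd.fun_mul hd), pd_mul hd hd,
      pd_sub hR hl]
    ring
  simp only [h4]
  rw [pairing_sub, pairing_sub, pairing_const_mul, pairing_const_mul, pairing_sub, h1, h2, h3]
  field_simp
  ring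

end IsConcircularOn

end PerfectFluid

/-! ### Two facts of linear algebra: definiteness of a trace form, and Weyl-type tensors in
dimension three. -/

open scoped MatrixOrder in
-- With `P = Cᵀ C` the trace is the sum of the squares of the entries of `C F Cᵀ`.
theorem eq_zero_of_trace_mul_self {n : ℕ} {P F : Matrix (Fin n) (Fin n) ℝ} (hP : P.PosDef)
    (hF : F.transpose = F) (h : (P * F * (P * F)).trace = 0) : F = 0 := by
  obtain ⟨C, hC⟩ := CStarAlgebra.nonneg_iff_eq_star_mul_self.1 hP.posSemidef.nonneg
  have hd := hP.det_pos
  rw [Matrix.star_eq_conjTranspose, Matrix.conjTranspose_eq_transpose_of_trivial] at hC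
  rw [hC, Matrix.det_mul, Matrix.det_transpose] at hd
  have hu : IsUnit C.det := isUnit_iff_ne_zero.2 fun h0 => by simp [h0] at hd
  have hut : IsUnit C.transpose.det := by rwa [Matrix.det_transpose]
  have h1 : ((C * F * C.transpose).conjTranspose * (C * F * C.transpose)).trace = 0 := by
    rw [← h, Matrix.conjTranspose_eq_transpose_of_trivial, Matrix.transpose_mul,
      Matrix.transpose_mul, Matrix.transpose_transpose, hF, hC, ← Matrix.mul_assoc,
      Matrix.trace_mul_comm _ C.transpose]
    simp only [Matrix.mul_assoc]
  have h2 := Matrix.trace_conjTranspose_mul_self_eq_zero_iff.1 h1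
  have h3 : C⁻¹ * (C * F * C.transpose) * (C.transpose)⁻¹ = F := by
    rw [← Matrix.mul_assoc, ← Matrix.mul_assoc, Matrix.nonsing_inv_mul _ hu, Matrix.one_mul,
      Matrix.mul_assoc, Matrix.mul_nonsing_inv _ hut, Matrix.mul_one]
  rw [← h3, h2]
  simp

/-- In dimension three a tensor with the symmetries of the Weyl tensor vanishes. -/
theorem eq_zero_of_skew_of_contract_eq_zero {H : Matrix (Fin 3) (Fin 3) ℝ}
    (hH : ∀ a b, H a b = H b a) (hdet : H.det ≠ 0) {T : Fin 3 → Fin 3 → Fin 3 → Fin 3 → ℝ}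
    (h1 : ∀ j k l m, T k j l m = - T j k l m) (h2 : ∀ j k l m, T j k m l = - T j k l m)
    (h3 : ∀ k l, contract H (fun j m => T j k l m) = 0) (j k l m : Fin 3) : T j k l m = 0 := by
  have h1' : ∀ j l m, T j j l m = 0 := fun j l m => by linarith [h1 j j l m]
  have h2' : ∀ j k l, T j k l l = 0 := fun j k l => by linarith [h2 j k l l]
  -- Index pairs are labelled by the missing index, with addition modulo three. In this double-dual
  -- form `T` is, up to the determinant, the trace-reversed contraction with raised indices, as the
  -- Riemann tensor is determined by the Einstein tensor in dimension three.
  have key : ∀ a b : Fin 3, H.det * T (a + 1) (a + 2) (b + 1) (b + 2)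
      = ∑ k, ∑ l, (H b k * H l a - 1 / 2 * H l k * H a b) * contract H (fun j m => T j k l m) := by
    intro a b
    rw [Matrix.det_fin_three]
    fin_cases a <;> fin_cases b <;>
      simp only [Fin.zero_eta, Fin.mk_one, Fin.reduceFinMk, Fin.reduceAdd, Fin.isValue, zero_add,
        contract, Fin.sum_univ_three, h1', h2', h1 0 1, h1 0 2, h1 1 2, h2 _ _ 0 1, h2 _ _ 0 2,
        h2 _ _ 1 2, hH 1 0, hH 2 0, hH 2 1] <;> ring
  have hS : ∀ a b : Fin 3, T (a + 1) (a + 2) (b + 1) (b + 2) = 0 := by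
    intro a b
    have := key a b
    simp only [h3, mul_zero, Finset.sum_const_zero] at this
    exact (mul_eq_zero.1 this).resolve_left hdet
  have hl : ∀ (f : Fin 3 → Fin 3 → ℝ), (∀ a b, f b a = - f a b) → (∀ a, f (a + 1) (a + 2) = 0) →
      ∀ a b, f a b = 0 := by
    intro f hf h0 a b
    have e0 := h0 0
    have e1 := h0 1
    have e2 := h0 2
    have := hf a a
    have := hf 0 1
    have := hf 0 2
    have := hf 1 2
    fin_cases a <;> fin_cases b <;> simp at * <;> linarith
  exact hl (fun j k => T j k l m) (fun j k => h1 j k l m)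
    (fun a => hl (fun l m => T (a + 1) (a + 2) l m) (fun l m => h2 _ _ l m) (hS a) l m) j k

/-! ### Criteria for the perfect-fluid form at a point. -/

section PointwiseFluid

variable {n : ℕ} {G : Coord n → Matrix (Fin n) (Fin n) ℝ} {U : Set (Coord n)}
  {w : Fin n → Coord n → ℝ} {r : Coord n → ℝ} {x : Coord n}

/-- The eigenvalue of the Ricci tensor of a perfect fluid on the orthogonal complement of the
concircular field. -/
def transverseEigenvalue (G : Coord n → Matrix (Fin n) (Fin n) ℝ) (w : Fin n → Coord n → ℝ)
    (r : Coord n → ℝ) (x : Coord n) : ℝ :=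
  1 / ((n : ℝ) - 1) * (scalar G x - eigenvalue G w r x)

/-- The Ricci tensor at `x` has perfect-fluid form. -/
def IsFluidAt (G : Coord n → Matrix (Fin n) (Fin n) ℝ) (w : Fin n → Coord n → ℝ)
    (r : Coord n → ℝ) (x : Coord n) : Prop :=
  ∀ k l, ricci G k l x = transverseEigenvalue G w r x * G x k l
    + (eigenvalue G w r x - transverseEigenvalue G w r x) / normSq G w x * (w k x * w l x)

namespace IsConcircularOn

theorem isFluidAt_of_eq (h : IsConcircularOn G U w r) (hn : 3 ≤ n) (hx : x ∈ U) {A B : ℝ}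
    (hR : ∀ k l, ricci G k l x = A * G x k l + B * (w k x * w l x)) : IsFluidAt G w r x := by
  have hn' : (3 : ℝ) ≤ n := by exact_mod_cast hn
  have hn1 : (n : ℝ) - 1 ≠ 0 := by linarith
  have hs := h.normSq_ne_zero x hx
  have h1 := h.eigenvalue_of_fluid hx hR
  have h2 := h.scalar_of_fluid hx hR
  have h3 : transverseEigenvalue G w r x = A := by
    rw [transverseEigenvalue, h2, ← h1]
    field_simp
    ring
  intro k l
  rw [hR, h3, ← h1]
  field_simp
  ring

/-- The Weyl tensor vanishes for algebraic reasons, so contracting its last index with `w` gives a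
relation between the Schouten tensor, `g` and `w`. A second contraction solves it for the Ricci
tensor. -/
theorem isFluidAt_of_dim_three {G : Coord 3 → Matrix (Fin 3) (Fin 3) ℝ} {U : Set (Coord 3)}
    {w : Fin 3 → Coord 3 → ℝ} {r : Coord 3 → ℝ} {x : Coord 3} (h : IsConcircularOn G U w r)
    (hx : x ∈ U) : IsFluidAt G w r x := by
  have hs := h.normSq_ne_zero x hx
  have hP : ∀ k l, schouten G k l x = ricci G k l x - 1 / 4 * (scalar G x * G x k l) :=
    fun k l => by unfold schouten; norm_num
  have hW : ∀ j k l m, weyl G j k l m x = riemann G j k l m x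
      + (metricSchouten G j k l m x - metricSchouten G k j l m x) := fun j k l m => by
    rw [weyl_eq le_rfl]; ring
  have hWz : ∀ j k l m, weyl G j k l m x = 0 := by
    refine eq_zero_of_skew_of_contract_eq_zero (h.invMetric_comm x)
      (Matrix.isUnit_nonsing_inv_det _ (h.isUnit_det hx)).ne_zero ?_ ?_ ?_
    · intro j k l m
      rw [hW, hW, IsMetricOn.riemann_skew_left]; ring
    · intro j k l m
      rw [hW, hW, h.riemann_skew_right hx]
      unfold metricSchouten
      ring
    · intro k l
      have e : ∀ j m, metricSchouten G j k l m x - metricSchouten G k j l m x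
          = schouten G k l x * G x j m + (schouten G j m x * G x k l
            - (G x k m * schouten G j l x + schouten G k m x * G x l j)) := fun j m => by
        rw [h.apply_comm x l j]; unfold metricSchouten; ring
      have hsw : contract (G x)⁻¹ (fun j m => schouten G k m x * G x l j) = schouten G k l x := by
        rw [← contract_swap _ (h.invMetric_comm x)]
        exact h.contract_mul_metric hx l (fun m => schouten G k m x)
      have hsw' : contract (G x)⁻¹ (fun j m => G x k m * schouten G j l x)
          = schouten G k l x := by
        rw [← contract_swap _ (h.invMetric_comm x)]
        exact h.contract_metric_mul hx k (fun j => schouten G j l x)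
      have htr : contract (G x)⁻¹ (fun j m => schouten G j m x) = 1 / 4 * scalar G x := by
        simp only [hP, ← mul_assoc]
        rw [contract_sub, h.contract_const_mul_metric hx]
        have : contract (G x)⁻¹ (fun j m => ricci G j m x) = scalar G x := rfl
        rw [this]
        push_cast
        ring
      simp only [hW, e]
      rw [contract_add, contract_add, contract_sub, contract_add, h.contract_riemann hx,
        contract_mul_const, hsw, hsw', htr, h.contract_const_mul_metric hx, hP]
      push_cast
      ring
  have hPV : ∀ k, pairing (raise G w x) (fun l => schouten G k l x)
      = (eigenvalue G w r x - 1 / 4 * scalar G x) * w k x := fun k => by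
    simp only [hP, ← mul_assoc]
    rw [pairing_sub, pairing_const_mul, h.pairing_metric hx, h.pairing_ricci hx]
    unfold eigenvalue
    ring
  -- The slope comes from the Riemann tensor, the bracket is the eigenvalue of the Schouten tensor
  -- on `w`.
  set c := slope G w r x + (eigenvalue G w r x - 1 / 4 * scalar G x) with hc
  have h1 : ∀ j k l, w j x * (schouten G k l x + c * G x k l)
      = w k x * (schouten G j l x + c * G x j l) := by
    intro j k l
    have e1 : pairing (raise G w x) (fun m => weyl G j k l m x) = 0 := by
      simp only [hWz, pairing, mul_zero, Finset.sum_const_zero]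
    simp only [hW, metricSchouten] at e1
    rw [pairing_add, pairing_sub, pairing_add, pairing_add, pairing_mul_const, pairing_mul_const,
      pairing_mul_const, pairing_mul_const, h.pairing_metric hx, h.pairing_metric hx, hPV, hPV,
      h.pairing_riemann hx] at e1
    rw [hc]
    linear_combination e1
  have h2 : ∀ k l, normSq G w x * (schouten G k l x + c * G x k l)
      = w k x * ((eigenvalue G w r x - 1 / 4 * scalar G x + c) * w l x) := by
    intro k l
    have e1 : pairing (raise G w x) (fun j => w j x * (schouten G k l x + c * G x k l))
        = pairing (raise G w x) (fun j => w k x * (schouten G j l x + c * G x j l)) := by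
      simp only [h1 _ k l]
    have e2 : ∀ j, schouten G j l x = schouten G l j x := fun j => by
      rw [hP, hP, h.ricci_comm hx, h.apply_comm]
    rw [pairing_mul_const, pairing_raise_covector, pairing_const_mul, pairing_add,
      pairing_const_mul, h.pairing_metric' hx] at e1
    simp only [e2] at e1
    rw [hPV] at e1
    rw [e2 k]
    linear_combination e1
  refine h.isFluidAt_of_eq le_rfl hx (A := 1 / 4 * scalar G x - c)
    (B := (eigenvalue G w r x - 1 / 4 * scalar G x + c) / normSq G w x) fun k l => ?_
  have := h2 k l
  rw [hP] at this
  field_simp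
  linear_combination 4 * this

/-- Let `F` be the Ricci tensor minus its expected fluid form. It annihilates `w` and is trace-free,
and the anisotropy is its squared length. Reversing the metric along `w` does not change this length
but makes the metric positive definite, so `F = 0`. -/
theorem isFluidAt_of_anisotropy_eq_zero (h : IsConcircularOn G U w r) (hn : 3 ≤ n) (hx : x ∈ U)
    (hpos : (Matrix.of fun a b => G x a b - 2 / normSq G w x * (w a x * w b x)).PosDef)
    (hf : anisotropy G w r x = 0) : IsFluidAt G w r x := by
  have hn' : (3 : ℝ) ≤ n := by exact_mod_cast hn
  have hn1 : (n : ℝ) - 1 ≠ 0 := by linarith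
  have hs := h.normSq_ne_zero x hx
  set A := transverseEigenvalue G w r x with hA
  set B := (eigenvalue G w r x - A) / normSq G w x with hB
  set L : Matrix (Fin n) (Fin n) ℝ := Matrix.of fun a b => A * G x a b + B * (w a x * w b x)
    with hL
  set F := ricciMatrix G x - L with hF
  have hBs : B * normSq G w x = eigenvalue G w r x - A := div_mul_cancel₀ _ hs
  have hFV : ∀ k, pairing (raise G w x) (fun l => F k l) = 0 := fun k => by
    have e : ∀ l, F k l = ricci G k l x - (A * G x k l + B * (w k x * w l x)) := fun l => rfl
    simp only [e]
    rw [pairing_sub, h.pairing_ricci hx, pairing_fluid h hx, hBs]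
    unfold eigenvalue
    ring
  have hFs : F.transpose = F := by
    ext k l
    have : ricci G l k x - (A * G x l k + B * (w l x * w k x))
        = ricci G k l x - (A * G x k l + B * (w k x * w l x)) := by
      rw [h.ricci_comm hx l k, h.apply_comm x l k]; ring
    exact this
  have hFt : contract (G x)⁻¹ (fun a b => F a b) = 0 := by
    have e : ∀ k l, F k l = ricci G k l x - (A * G x k l + B * (w k x * w l x)) :=
      fun _ _ => rfl
    simp only [e]
    rw [contract_sub, contract_fluid h hx, hBs]
    have : contract (G x)⁻¹ (fun a b => ricci G a b x) = scalar G x := rfl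
    rw [this, hA, transverseEigenvalue]
    field_simp
    ring
  have h1 : ((G x)⁻¹ * F * ((G x)⁻¹ * F)).trace = 0 := by
    have e1 : ((G x)⁻¹ * F * ((G x)⁻¹ * L)).trace = 0 := by
      rw [hL, trace_mul_fluid h hx F (μ := 0) (fun k => by rw [hFV, zero_mul]), hFt]
      ring
    have e2 : ((G x)⁻¹ * F * ((G x)⁻¹ * F)).trace
        = (mixedRicci G x * mixedRicci G x).trace - (mixedRicci G x * ((G x)⁻¹ * L)).trace
          - ((G x)⁻¹ * F * ((G x)⁻¹ * L)).trace := by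
      have e3 : ((G x)⁻¹ * F * ((G x)⁻¹ * ricciMatrix G x)).trace
          = (mixedRicci G x * ((G x)⁻¹ * F)).trace := Matrix.trace_mul_comm _ _
      have e4 : (G x)⁻¹ * F = mixedRicci G x - (G x)⁻¹ * L := by rw [hF, mul_sub]; rfl
      rw [← Matrix.trace_sub, ← mul_sub, ← e4, ← e3, ← Matrix.trace_sub, ← mul_sub, ← mul_sub]
    rw [e2, e1, hL, trace_mixedRicci_mul_fluid h hx]
    have hf' := hf
    unfold anisotropy at hf'
    have hA' : A * ((n : ℝ) - 1) = scalar G x - eigenvalue G w r x := by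
      rw [hA, transverseEigenvalue]; field_simp
    have : 1 / ((n : ℝ) - 1) * ((scalar G x - eigenvalue G w r x)
        * (scalar G x - eigenvalue G w r x)) = A * (scalar G x - eigenvalue G w r x) := by
      rw [hA, transverseEigenvalue]; ring
    rw [this] at hf'
    linear_combination hf' - eigenvalue G w r x * hBs
  set K : Matrix (Fin n) (Fin n) ℝ :=
    Matrix.of fun a b => G x a b - 2 / normSq G w x * (w a x * w b x) with hK
  have hKu : IsUnit K.det := isUnit_iff_ne_zero.2 hpos.det_pos.ne'
  -- `K` differs from `G` by a multiple of `w w`, and `w` contracts to zero with `F`.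
  have h2 : K * ((G x)⁻¹ * F) = F := by
    have e : K = G x - Matrix.of (fun a b => 2 / normSq G w x * (w a x * w b x)) := rfl
    rw [e, Matrix.sub_mul, ← Matrix.mul_assoc, Matrix.mul_nonsing_inv _ (h.isUnit_det hx),
      Matrix.one_mul, sub_eq_self]
    ext a c
    have e2 : (Matrix.of (fun a b => 2 / normSq G w x * (w a x * w b x)) * ((G x)⁻¹ * F)) a c
        = 2 / normSq G w x * w a x * contract (G x)⁻¹ (fun b d => w b x * F d c) := by
      simp only [Matrix.mul_apply, contract, Finset.mul_sum, Matrix.of_apply]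
      exact Finset.sum_congr rfl fun b _ => Finset.sum_congr rfl fun d _ => by ring
    have e3 : ∀ d, F d c = F c d := fun d => congrFun (congrFun hFs c) d
    rw [e2, h.contract_covector_mul (fun d => F d c)]
    simp only [e3]
    rw [hFV]
    simp
  have h3 : (G x)⁻¹ * F = K⁻¹ * F := by
    rw [← h2, ← Matrix.mul_assoc K⁻¹, Matrix.nonsing_inv_mul _ hKu, Matrix.one_mul, h2]
  rw [h3] at h1
  have h4 := eq_zero_of_trace_mul_self hpos.inv hFs h1
  intro k l
  have h5 := congrFun (congrFun h4 k) l
  have e : F k l = ricci G k l x - (A * G x k l + B * (w k x * w l x)) := rfl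
  rw [e] at h5
  exact sub_eq_zero.1 h5

end IsConcircularOn

end PointwiseFluid

/-! ### Transformation laws under a change of coordinates. -/

section CoordinateChange

variable {n : ℕ} {φ : Coord n → Coord n} {W U' : Set (Coord n)} {x : Coord n}

/-- The Jacobian matrix of a map between coordinate spaces. -/
def jacobian (φ : Coord n → Coord n) (x : Coord n) : Matrix (Fin n) (Fin n) ℝ :=
  Matrix.of fun a i => pd i (fun y => φ y a) x

theorem contDiffOn_apply (hφ : ContDiffOn ℝ ∞ φ W) (a : Fin n) :
    ContDiffOn ℝ ∞ (fun y => φ y a) W :=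
  (contDiff_euclidean.1 contDiff_id a).comp_contDiffOn hφ

theorem smooth_jacobian (hW : IsOpen W) (hφ : ContDiffOn ℝ ∞ φ W) : SmoothOn (jacobian φ) W :=
  fun a i => contDiffOn_pd hW (contDiffOn_apply hφ a) i

theorem fderiv_single (hφ : DifferentiableAt ℝ φ x) (i : Fin n) :
    fderiv ℝ φ x (EuclideanSpace.single i 1)
      = ∑ a, jacobian φ x a i • EuclideanSpace.single a (1 : ℝ) := by
  ext b
  have h1 : pd i (fun y => φ y b) x = fderiv ℝ φ x (EuclideanSpace.single i 1) b := by
    have := ((EuclideanSpace.proj (𝕜 := ℝ) b).hasFDerivAt.comp x hφ.hasFDerivAt).fderiv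
    exact congrFun (congrArg DFunLike.coe this) (EuclideanSpace.single i 1)
  rw [← h1]
  simp [jacobian, Finset.sum_apply, Pi.single_apply]

theorem pd_comp {f : Coord n → ℝ} (hφ : DifferentiableAt ℝ φ x)
    (hf : DifferentiableAt ℝ f (φ x)) (i : Fin n) :
    pd i (fun y => f (φ y)) x = ∑ a, jacobian φ x a i * pd a f (φ x) := by
  have : fderiv ℝ (fun y => f (φ y)) x = (fderiv ℝ f (φ x)).comp (fderiv ℝ φ x) :=
    fderiv_comp x hf hφ
  simp only [pd, this, ContinuousLinearMap.comp_apply, fderiv_single hφ, map_sum, map_smul,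
    smul_eq_mul]

theorem SmoothOn.comp {A : Coord n → Matrix (Fin n) (Fin n) ℝ} (hA : SmoothOn A U')
    (hφ : ContDiffOn ℝ ∞ φ W) (hm : Set.MapsTo φ W U') : SmoothOn (fun y => A (φ y)) W :=
  fun a b => (hA a b).comp hφ hm

theorem pdM_comp {A : Coord n → Matrix (Fin n) (Fin n) ℝ} (hU' : IsOpen U') (hA : SmoothOn A U')
    (hφ : DifferentiableAt ℝ φ x) (hx : φ x ∈ U') (i : Fin n) :
    pdM i (fun y => A (φ y)) x = ∑ a, jacobian φ x a i • pdM a A (φ x) := by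
  ext k l
  simp only [Matrix.sum_apply, Matrix.smul_apply, smul_eq_mul]
  exact pd_comp hφ (hA.differentiableAt hU' hx k l) i

theorem pdM_sum_smul {c : Fin n → Coord n → ℝ} {A : Fin n → Coord n → Matrix (Fin n) (Fin n) ℝ}
    (hW : IsOpen W) (hc : ∀ a, ContDiffOn ℝ ∞ (c a) W) (hA : ∀ a, SmoothOn (A a) W) (hx : x ∈ W)
    (i : Fin n) :
    pdM i (fun y => ∑ a, c a y • A a y) x
      = ∑ a, pd i (c a) x • A a x + ∑ a, c a x • pdM i (A a) x := by
  have hc' := fun a => differentiableAt_of_contDiffOn hW (hc a) hx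
  have hA' := fun a k l => (hA a).differentiableAt hW hx k l
  ext k l
  simp only [Matrix.add_apply, Matrix.sum_apply, Matrix.smul_apply, smul_eq_mul, pdM,
    Matrix.of_apply]
  rw [pd_sum _ (F := fun a y => c a y * A a y k l) (fun a _ => (hc' a).fun_mul (hA' a k l)),
    ← Finset.sum_add_distrib]
  exact Finset.sum_congr rfl fun a _ => pd_mul (hc' a) (hA' a k l) i

/-- The matrices of the pulled-back connection form. -/
def pullbackConnection (G' : Coord n → Matrix (Fin n) (Fin n) ℝ) (φ : Coord n → Coord n)
    (i : Fin n) (x : Coord n) : Matrix (Fin n) (Fin n) ℝ :=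
  ∑ a, jacobian φ x a i • connection G' a (φ x)

variable {G G' : Coord n → Matrix (Fin n) (Fin n) ℝ}

/-- The metric `G` is the pullback of `G'` under the coordinate change `φ`. -/
structure IsPullbackOn (φ : Coord n → Coord n) (G G' : Coord n → Matrix (Fin n) (Fin n) ℝ)
    (W U' : Set (Coord n)) : Prop where
  source : IsMetricOn G W
  target : IsMetricOn G' U'
  contDiffOn : ContDiffOn ℝ ∞ φ W
  mapsTo : Set.MapsTo φ W U'
  pullback : ∀ x ∈ W, G x = (jacobian φ x).transpose * G' (φ x) * jacobian φ x

namespace IsPullbackOn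

theorem isUnit_det_jacobian (h : IsPullbackOn φ G G' W U') (hx : x ∈ W) :
    IsUnit (jacobian φ x).det := by
  have h1 := h.source.det_ne_zero x hx
  rw [h.pullback x hx, Matrix.det_mul] at h1
  exact isUnit_iff_ne_zero.2 (right_ne_zero_of_mul h1)

theorem pd_jacobian_comm (h : IsPullbackOn φ G G' W U') (hx : x ∈ W) (i j a : Fin n) :
    pd i (fun y => jacobian φ y a j) x = pd j (fun y => jacobian φ y a i) x :=
  pd_comm h.source.isOpen (contDiffOn_apply h.contDiffOn a) hx i j

/-- The transformation law of the Christoffel symbols. -/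
theorem jacobian_mul_connection (h : IsPullbackOn φ G G' W U') (hx : x ∈ W) (i : Fin n) :
    jacobian φ x * connection G i x
      = pullbackConnection G' φ i x * jacobian φ x + pdM i (jacobian φ) x := by
  have hJu := h.isUnit_det_jacobian hx
  have hφ : DifferentiableAt ℝ φ x :=
    (h.contDiffOn.contDiffAt (h.source.isOpen.mem_nhds hx)).differentiableAt (by simp)
  have hJ := smooth_jacobian h.source.isOpen h.contDiffOn
  have hW := h.source.isOpen
  have hG' := h.target.smooth.comp h.contDiffOn h.mapsTo
  -- The expected connection is symmetric because second partials of `φ` commute, and preserves `G`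
  -- because `G` is a pullback; uniqueness of the Levi-Civita connection does the rest.
  have key := eq_connection_of_symm_of_compat (h.source.isUnit_det hx) (h.source.transpose_eq x)
    (fun i => (jacobian φ x)⁻¹ *
      (pullbackConnection G' φ i x * jacobian φ x + pdM i (jacobian φ) x)) ?_ ?_ i
  · rw [key, ← Matrix.mul_assoc, Matrix.mul_nonsing_inv _ hJu, Matrix.one_mul]
  · intro i j m
    have e : ∀ c, (pullbackConnection G' φ i x * jacobian φ x + pdM i (jacobian φ) x) c j
        = (pullbackConnection G' φ j x * jacobian φ x + pdM j (jacobian φ) x) c i := by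
      intro c
      have e1 : (pdM i (jacobian φ) x) c j = (pdM j (jacobian φ) x) c i :=
        h.pd_jacobian_comm hx i j c
      rw [Matrix.add_apply, Matrix.add_apply, e1]
      congr 1
      simp only [pullbackConnection, Matrix.sum_apply, Matrix.smul_apply, smul_eq_mul,
        Matrix.mul_apply, Finset.sum_mul]
      rw [Finset.sum_comm]
      refine Finset.sum_congr rfl fun a _ => Finset.sum_congr rfl fun b _ => ?_
      have : connection G' b (φ x) c a = connection G' a (φ x) c b :=
        h.target.christoffel_comm c b a (φ x)
      rw [this]; ring
    rw [Matrix.mul_apply, Matrix.mul_apply]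
    exact Finset.sum_congr rfl fun c _ => by rw [e c]
  · intro s
    have e1 : pdM s (fun y => G' (φ y)) x = (pullbackConnection G' φ s x).transpose * G' (φ x)
        + G' (φ x) * pullbackConnection G' φ s x := by
      rw [pdM_comp h.target.isOpen h.target.smooth hφ (h.mapsTo hx)]
      simp only [h.target.pdM_metric (h.mapsTo hx), pullbackConnection, smul_add,
        Finset.sum_add_distrib, Matrix.transpose_sum, Matrix.sum_mul, Matrix.mul_sum,
        Matrix.transpose_smul, Matrix.smul_mul, Matrix.mul_smul]
    rw [pdM_congr hW h.pullback hx, pdM_mul hW (hJ.transpose.mul hG') hJ hx,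
      pdM_mul hW hJ.transpose hG' hx, pdM_transpose, e1, h.pullback x hx]
    set J := jacobian φ x
    set B := pullbackConnection G' φ s x
    set dJ := pdM s (jacobian φ) x
    have e2 : J * (J⁻¹ * (B * J + dJ)) = B * J + dJ := by
      rw [← Matrix.mul_assoc, Matrix.mul_nonsing_inv _ hJu, Matrix.one_mul]
    have e3 : (J⁻¹ * (B * J + dJ)).transpose * J.transpose
        = J.transpose * B.transpose + dJ.transpose := by
      rw [← Matrix.transpose_mul, e2, Matrix.transpose_add, Matrix.transpose_mul]
    rw [Matrix.mul_assoc _ J (J⁻¹ * _), e2, ← Matrix.mul_assoc _ (J.transpose * _) J,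
      ← Matrix.mul_assoc _ J.transpose, e3]
    noncomm_ring

/-- Derivatives of the Jacobian enter symmetrically in `i` and `j`, so they drop out of the
antisymmetrised expression. -/
theorem curvature_pullback_form (h : IsPullbackOn φ G G' W U') (hx : x ∈ W) (i j : Fin n) :
    pdM j (pullbackConnection G' φ i) x - pdM i (pullbackConnection G' φ j) x
      + (pullbackConnection G' φ j x * pullbackConnection G' φ i x
        - pullbackConnection G' φ i x * pullbackConnection G' φ j x)
      = ∑ a, ∑ b, (jacobian φ x a i * jacobian φ x b j) • curvature G' a b (φ x) := by
  have hφ : DifferentiableAt ℝ φ x :=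
    (h.contDiffOn.contDiffAt (h.source.isOpen.mem_nhds hx)).differentiableAt (by simp)
  have hJ := smooth_jacobian h.source.isOpen h.contDiffOn
  have h1 : ∀ i j, pdM j (pullbackConnection G' φ i) x
      = ∑ a, pd j (fun y => jacobian φ y a i) x • connection G' a (φ x)
        + ∑ a, ∑ b, (jacobian φ x a i * jacobian φ x b j) • pdM b (connection G' a) (φ x) := by
    intro i j
    have e : pdM j (pullbackConnection G' φ i) x = _ :=
      pdM_sum_smul h.source.isOpen (fun a => hJ a i)
        (fun a => (h.target.smooth_connection a).comp h.contDiffOn h.mapsTo) hx j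
    rw [e]
    simp only [pdM_comp h.target.isOpen (h.target.smooth_connection _) hφ (h.mapsTo hx),
      Finset.smul_sum, smul_smul]
  have h2 : ∀ i j, pullbackConnection G' φ i x * pullbackConnection G' φ j x
      = ∑ a, ∑ b, (jacobian φ x a i * jacobian φ x b j) •
        (connection G' a (φ x) * connection G' b (φ x)) := by
    intro i j
    simp only [pullbackConnection, Matrix.sum_mul, Matrix.mul_sum, Matrix.smul_mul,
      Matrix.mul_smul, Finset.smul_sum, smul_smul]
    rw [Finset.sum_comm]
    simp only [mul_comm]
  rw [h1, h1, h2, h2, Finset.sum_comm (f := fun a b => (jacobian φ x a j * jacobian φ x b i) •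
    pdM b (connection G' a) (φ x)), Finset.sum_comm (f := fun a b =>
    (jacobian φ x a j * jacobian φ x b i) • (connection G' a (φ x) * connection G' b (φ x)))]
  simp only [h.pd_jacobian_comm hx j i, curvature_eq, smul_add, smul_sub, Finset.sum_add_distrib,
    Finset.sum_sub_distrib, mul_comm (jacobian φ x _ j)]
  abel

/-- The transformation law of the curvature. -/
theorem jacobian_mul_curvature (h : IsPullbackOn φ G G' W U') (hx : x ∈ W) (i j : Fin n) :
    jacobian φ x * curvature G i j x
      = (∑ a, ∑ b, (jacobian φ x a i * jacobian φ x b j) • curvature G' a b (φ x))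
        * jacobian φ x := by
  have hW := h.source.isOpen
  have hJ := smooth_jacobian hW h.contDiffOn
  have hA := h.source.smooth_connection
  have hB : ∀ i, SmoothOn (pullbackConnection G' φ i) W := fun i k l => by
    have : ContDiffOn ℝ ∞ (fun y => ∑ a, jacobian φ y a i * connection G' a (φ y) k l) W :=
      ContDiffOn.sum fun a _ => (hJ a i).mul
        ((h.target.smooth_connection a).comp h.contDiffOn h.mapsTo k l)
    refine this.congr fun y _ => ?_
    simp [pullbackConnection, Matrix.sum_apply]
  have key : ∀ i j, pdM j (jacobian φ) x * connection G i x
      + jacobian φ x * pdM j (connection G i) x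
      = pdM j (pullbackConnection G' φ i) x * jacobian φ x
        + pullbackConnection G' φ i x * pdM j (jacobian φ) x + pdM j (pdM i (jacobian φ)) x := by
    intro i j
    rw [← pdM_mul hW hJ (hA i) hx, pdM_congr hW (fun y hy => h.jacobian_mul_connection hy i) hx,
      pdM_add hW ((hB i).mul hJ) (hJ.pdM hW i) hx, pdM_mul hW (hB i) hJ hx]
  have hd : ∀ i, pdM i (jacobian φ) x = jacobian φ x * connection G i x
      - pullbackConnection G' φ i x * jacobian φ x := fun i => by
    rw [h.jacobian_mul_connection hx]; abel
  -- Antisymmetrising the differentiated law for the connection removes the second derivatives of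
  -- the Jacobian.
  have hk := congrArg₂ (· - ·) (key i j) (key j i)
  rw [pdM_comm hW hJ hx j i] at hk
  simp only [hd i, hd j] at hk
  rw [← h.curvature_pullback_form hx, curvature_eq, ← sub_eq_zero]
  rw [← sub_eq_zero] at hk
  rw [← hk]
  noncomm_ring

/-- The Ricci tensor is a tensor. -/
theorem ricciMatrix_eq (h : IsPullbackOn φ G G' W U') (hx : x ∈ W) :
    ricciMatrix G x = (jacobian φ x).transpose * ricciMatrix G' (φ x) * jacobian φ x := by
  have hJu := h.isUnit_det_jacobian hx
  set J := jacobian φ x with hJ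
  have h1 : ∀ i j, curvature G i j x
      = J⁻¹ * ((∑ a, ∑ b, (J a i * J b j) • curvature G' a b (φ x)) * J) := fun i j => by
    rw [← h.jacobian_mul_curvature hx, ← Matrix.mul_assoc, Matrix.nonsing_inv_mul _ hJu,
      Matrix.one_mul]
  have h2 : ∀ a c, ∑ i, J a i * J⁻¹ i c = (1 : Matrix (Fin n) (Fin n) ℝ) a c := fun a c => by
    rw [← Matrix.mul_nonsing_inv _ hJu, Matrix.mul_apply]
  ext k l
  have h3 : ∀ i, curvature G i k x i l
      = ∑ a, ∑ b, ∑ c, J a i * J⁻¹ i c * (J b k * (curvature G' a b (φ x) * J) c l) := by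
    intro i
    rw [h1]
    simp only [Matrix.sum_mul, Matrix.mul_sum, Matrix.sum_apply, Matrix.smul_mul, Matrix.mul_smul,
      Matrix.smul_apply, smul_eq_mul]
    refine Finset.sum_congr rfl fun a _ => Finset.sum_congr rfl fun b _ => ?_
    rw [Matrix.mul_apply (M := J⁻¹), Finset.mul_sum]
    exact Finset.sum_congr rfl fun c _ => by ring
  have h4 : ∑ i, curvature G i k x i l
      = ∑ a, ∑ b, J b k * (curvature G' a b (φ x) * J) a l := by
    simp only [h3]
    rw [Finset.sum_comm]
    refine Finset.sum_congr rfl fun a _ => ?_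
    rw [Finset.sum_comm]
    refine Finset.sum_congr rfl fun b _ => ?_
    rw [Finset.sum_comm]
    simp only [← Finset.sum_mul, h2, Matrix.one_apply, ite_mul, one_mul, zero_mul,
      Finset.sum_ite_eq, Finset.mem_univ, if_true]
  have h5 : ((J.transpose * ricciMatrix G' (φ x)) * J) k l
      = ∑ b, J b k * (ricciMatrix G' (φ x) * J) b l := by
    rw [Matrix.mul_assoc, Matrix.mul_apply]; rfl
  have h6 : ∀ b, (ricciMatrix G' (φ x) * J) b l
      = - ∑ a, (curvature G' a b (φ x) * J) a l := by
    intro b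
    simp only [Matrix.mul_apply, ricciMatrix, Matrix.of_apply, ricci_eq, neg_mul, Finset.sum_mul,
      Finset.sum_neg_distrib]
    rw [Finset.sum_comm]
  have h7 : ricciMatrix G x k l = - ∑ i, curvature G i k x i l := rfl
  rw [h5, h7, h4, Finset.sum_comm]
  simp only [h6, mul_neg, Finset.sum_neg_distrib, Finset.mul_sum]

/-- Mixed components change by conjugation, so traces of powers are invariants. -/
theorem mixedRicci_eq (h : IsPullbackOn φ G G' W U') (hx : x ∈ W) :
    mixedRicci G x = (jacobian φ x)⁻¹ * mixedRicci G' (φ x) * jacobian φ x := by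
  have hJu := h.isUnit_det_jacobian hx
  have hJt : IsUnit (jacobian φ x).transpose.det := by rwa [Matrix.det_transpose]
  rw [mixedRicci, h.ricciMatrix_eq hx, h.pullback x hx, Matrix.mul_inv_rev, Matrix.mul_inv_rev,
    mixedRicci]
  simp only [Matrix.mul_assoc]
  rw [← Matrix.mul_assoc (jacobian φ x).transpose⁻¹, Matrix.nonsing_inv_mul _ hJt, Matrix.one_mul]

theorem scalar_eq (h : IsPullbackOn φ G G' W U') (hx : x ∈ W) :
    scalar G x = scalar G' (φ x) := by
  rw [h.source.scalar_eq_trace, h.target.scalar_eq_trace, h.mixedRicci_eq hx, Matrix.mul_assoc,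
    Matrix.trace_mul_comm, Matrix.mul_assoc, Matrix.mul_nonsing_inv _ (h.isUnit_det_jacobian hx),
    Matrix.mul_one]

theorem trace_mixedRicci_mul_self_eq (h : IsPullbackOn φ G G' W U') (hx : x ∈ W) :
    (mixedRicci G x * mixedRicci G x).trace
      = (mixedRicci G' (φ x) * mixedRicci G' (φ x)).trace := by
  have hJu := h.isUnit_det_jacobian hx
  have e : mixedRicci G x * mixedRicci G x
      = (jacobian φ x)⁻¹ * (mixedRicci G' (φ x) * mixedRicci G' (φ x) * jacobian φ x) := by
    rw [h.mixedRicci_eq hx]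
    simp only [Matrix.mul_assoc]
    rw [← Matrix.mul_assoc (jacobian φ x) (jacobian φ x)⁻¹, Matrix.mul_nonsing_inv _ hJu,
      Matrix.one_mul]
  rw [e, Matrix.trace_mul_comm, Matrix.mul_assoc, Matrix.mul_nonsing_inv _ hJu, Matrix.mul_one]

end IsPullbackOn

end CoordinateChange

/-! ### Vector fields and functions on the manifold, read in a chart. -/

section Charts

variable {n : ℕ} {M : Type*} [TopologicalSpace M] [ChartedSpace (Coord n) M]
  {e : OpenPartialHomeomorph M (Coord n)} {x : Coord n}

theorem mdifferentiable_of_mem_maximalAtlas (he : e ∈ IsManifold.maximalAtlas (𝓡 n) ∞ M) :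
    e.MDifferentiable (𝓡 n) (𝓡 n) :=
  ⟨(contMDiffOn_of_mem_maximalAtlas he).mdifferentiableOn (by simp),
    (contMDiffOn_symm_of_mem_maximalAtlas he).mdifferentiableOn (by simp)⟩

/-- The differential of the inverse of a chart. -/
def chartEquiv (he : e ∈ IsManifold.maximalAtlas (𝓡 n) ∞ M) (hx : x ∈ e.target) :
    Coord n ≃L[ℝ] TangentSpace (𝓡 n) (e.symm x) :=
  (mdifferentiable_of_mem_maximalAtlas he).symm.mfderiv (x := x) hx

theorem chartEquiv_single (he : e ∈ IsManifold.maximalAtlas (𝓡 n) ∞ M) (hx : x ∈ e.target)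
    (i : Fin n) : chartEquiv he hx (EuclideanSpace.single i 1) = coordVec e i x := rfl

theorem eq_sum_single (v : Coord n) : v = ∑ i, v i • EuclideanSpace.single i (1 : ℝ) := by
  ext b
  simp [Finset.sum_apply, Pi.single_apply]

theorem chartEquiv_eq_sum (he : e ∈ IsManifold.maximalAtlas (𝓡 n) ∞ M) (hx : x ∈ e.target)
    (v : Coord n) : chartEquiv he hx v = ∑ i, v i • coordVec e i x := by
  conv_lhs => rw [eq_sum_single v]
  rw [map_sum]
  simp only [map_smul, chartEquiv_single]

/-- The coordinate expression of a vector field. -/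
def chartField (X : ∀ p : M, TangentSpace (𝓡 n) p) (e : OpenPartialHomeomorph M (Coord n))
    (x : Coord n) : Coord n :=
  VectorField.mpullback (𝓡 n) (𝓡 n) e.symm X x

theorem chartEquiv_chartField (he : e ∈ IsManifold.maximalAtlas (𝓡 n) ∞ M) (hx : x ∈ e.target)
    (X : ∀ p : M, TangentSpace (𝓡 n) p) :
    chartEquiv he hx (chartField X e x) = X (e.symm x) := by
  have h1 : chartField X e x = (chartEquiv he hx).symm (X (e.symm x)) := by
    have : mfderiv (𝓡 n) (𝓡 n) e.symm x
      = ((chartEquiv he hx : Coord n ≃L[ℝ] TangentSpace (𝓡 n) (e.symm x)) :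
        Coord n →L[ℝ] TangentSpace (𝓡 n) (e.symm x)) := rfl
    unfold chartField VectorField.mpullback
    rw [this]
    exact congrArg (fun f => f (X (e.symm x))) (ContinuousLinearMap.inverse_equiv (chartEquiv he hx))
  rw [h1, ContinuousLinearEquiv.apply_symm_apply]

theorem contDiffOn_chartField [IsManifold (𝓡 n) ∞ M]
    (he : e ∈ IsManifold.maximalAtlas (𝓡 n) ∞ M)
    {X : ∀ p : M, TangentSpace (𝓡 n) p}
    (hX : ContMDiff (𝓡 n) (𝓡 n).tangent ∞ (fun p => (⟨p, X p⟩ : TangentBundle (𝓡 n) M))) :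
    ContDiffOn ℝ ∞ (chartField X e) e.target := by
  have : IsManifold (𝓡 n) 1 M := IsManifold.of_le (n := ∞) (by simp)
  intro x hx
  have h1 : ContMDiffAt (𝓡 n) (𝓡 n) ∞ e.symm x :=
    (contMDiffOn_symm_of_mem_maximalAtlas he).contMDiffAt (e.open_target.mem_nhds hx)
  have h2 := ContMDiffAt.mpullback_vectorField_preimage (m := ∞) (hX (e.symm x)) h1
    ⟨chartEquiv he hx, rfl⟩ (by simp)
  exact (contMDiffAt_vectorSpace_iff_contDiffAt.1 h2).contDiffWithinAt

theorem contDiffOn_comp_symm (he : e ∈ IsManifold.maximalAtlas (𝓡 n) ∞ M) {f : M → ℝ}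
    (hf : ContMDiff (𝓡 n) 𝓘(ℝ, ℝ) ∞ f) : ContDiffOn ℝ ∞ (fun y => f (e.symm y)) e.target :=
  contMDiffOn_iff_contDiffOn.1 (hf.comp_contMDiffOn (contMDiffOn_symm_of_mem_maximalAtlas he))

theorem contMDiff_of_contDiffOn_comp_symm [IsManifold (𝓡 n) ∞ M] {f : M → ℝ}
    (hf : ∀ e ∈ IsManifold.maximalAtlas (𝓡 n) ∞ M,
      ContDiffOn ℝ ∞ (fun y => f (e.symm y)) e.target) :
    ContMDiff (𝓡 n) 𝓘(ℝ, ℝ) ∞ f := by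
  intro p
  have he : chartAt (Coord n) p ∈ IsManifold.maximalAtlas (𝓡 n) ∞ M :=
    IsManifold.chart_mem_maximalAtlas p
  have h1 : ContMDiffOn (𝓡 n) 𝓘(ℝ, ℝ) ∞
      ((fun y => f ((chartAt (Coord n) p).symm y)) ∘ chartAt (Coord n) p)
      (chartAt (Coord n) p).source :=
    (contMDiffOn_iff_contDiffOn.2 (hf _ he)).comp (contMDiffOn_of_mem_maximalAtlas he)
      (fun q hq => (chartAt (Coord n) p).map_source hq)
  refine (h1.congr fun q hq => ?_).contMDiffAt
    ((chartAt (Coord n) p).open_source.mem_nhds (mem_chart_source _ p))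
  simp [(chartAt (Coord n) p).left_inv hq]

/-- The derivative of a function along a vector field, in coordinates. -/
theorem mfderiv_eq_sum_pd (he : e ∈ IsManifold.maximalAtlas (𝓡 n) ∞ M) (hx : x ∈ e.target)
    {f : M → ℝ} (hf : MDifferentiableAt (𝓡 n) 𝓘(ℝ, ℝ) f (e.symm x)) (v : Coord n) :
    mfderiv (𝓡 n) 𝓘(ℝ, ℝ) f (e.symm x) (chartEquiv he hx v)
      = ∑ i, v i * pd i (fun y => f (e.symm y)) x := by
  have h1 : mfderiv (𝓡 n) 𝓘(ℝ, ℝ) (f ∘ e.symm) x = _ :=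
    mfderiv_comp x hf ((mdifferentiable_of_mem_maximalAtlas he).mdifferentiableAt_symm hx)
  rw [mfderiv_eq_fderiv] at h1
  have h2 : mfderiv (𝓡 n) 𝓘(ℝ, ℝ) f (e.symm x) (chartEquiv he hx v)
      = fderiv ℝ (f ∘ e.symm) x v := by
    rw [h1]; rfl
  rw [h2]
  conv_lhs => rw [eq_sum_single v]
  rw [map_sum]
  simp only [map_smul, smul_eq_mul]
  rfl

end Charts

/-! ### Lorentzian linear algebra, and the passage from the manifold to a chart. -/

namespace LorentzMetric

variable {n : ℕ} {M : Type*} [TopologicalSpace M] [ChartedSpace (Coord n) M]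
  (g : LorentzMetric n M)
  {e : OpenPartialHomeomorph M (Coord n)} {x : Coord n}

theorem form_chartEquiv (he : e ∈ IsManifold.maximalAtlas (𝓡 n) ∞ M) (hx : x ∈ e.target)
    (u v : Coord n) :
    g.form (e.symm x) (chartEquiv he hx u) (chartEquiv he hx v)
      = ∑ i, ∑ j, u i * v j * g.matrix e x i j := by
  rw [chartEquiv_eq_sum, chartEquiv_eq_sum]
  simp only [map_sum, LinearMap.sum_apply, map_smul, LinearMap.smul_apply, smul_eq_mul,
    Finset.mul_sum, ← mul_assoc]
  rw [Finset.sum_comm]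
  exact Finset.sum_congr rfl fun i _ => Finset.sum_congr rfl fun j _ => by
    rw [mul_comm (v j)]; rfl

theorem form_chartEquiv_coordVec (he : e ∈ IsManifold.maximalAtlas (𝓡 n) ∞ M)
    (hx : x ∈ e.target) (u : Coord n) (k : Fin n) :
    g.form (e.symm x) (chartEquiv he hx u) (coordVec e k x) = ∑ i, u i * g.matrix e x i k := by
  rw [chartEquiv_eq_sum]
  simp only [map_sum, LinearMap.sum_apply, map_smul, LinearMap.smul_apply, smul_eq_mul]
  rfl

theorem eq_zero_of_form_eq_zero {p : M} {v : TangentSpace (𝓡 n) p}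
    (hv : ∀ u, g.form p u v = 0) : v = 0 := by
  obtain ⟨u, -, h2⟩ := g.lorentzian p
  by_contra h
  exact (h2 v (hv u) h).ne' (hv v)

/-- The orthogonal complement of a timelike vector is spacelike. -/
theorem form_pos_of_orthogonal_timelike {p : M} {X v : TangentSpace (𝓡 n) p}
    (hX : g.form p X X < 0) (hv : g.form p X v = 0) (hv0 : v ≠ 0) : 0 < g.form p v v := by
  obtain ⟨u, hu, hpos⟩ := g.lorentzian p
  set N := g.form p u u with hN
  have hN0 : N ≠ 0 := hu.ne
  have hnonneg : ∀ z, g.form p u z = 0 → 0 ≤ g.form p z z := fun z hz => by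
    by_cases h0 : z = 0
    · simp [h0]
    · exact (hpos z hz h0).le
  have hdec : ∀ z, ∃ (a : ℝ) (z' : TangentSpace (𝓡 n) p), g.form p u z' = 0 ∧ z = a • u + z' :=
    fun z => ⟨g.form p u z / N, z - (g.form p u z / N) • u, by
      rw [map_sub, map_smul, smul_eq_mul, ← hN]; field_simp; ring, by abel⟩
  obtain ⟨a, v', hv', rfl⟩ := hdec v
  obtain ⟨b, X', hX', rfl⟩ := hdec X
  have hform : ∀ (s t : ℝ) (y z : TangentSpace (𝓡 n) p), g.form p u y = 0 → g.form p u z = 0 →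
      g.form p (s • u + y) (t • u + z) = s * t * N + g.form p y z := fun s t y z hy hz => by
    simp only [map_add, map_smul, LinearMap.add_apply, LinearMap.smul_apply, smul_eq_mul, hz,
      g.symm p y u, hy, ← hN]
    ring
  rw [hform b b X' X' hX' hX'] at hX
  rw [hform b a X' v' hX' hv'] at hv
  rw [hform a a v' v' hv' hv']
  set q := g.form p X' X' with hq
  set m := g.form p X' v' with hm
  set k := g.form p v' v' with hk
  have hq0 : 0 ≤ q := hnonneg _ hX'
  have hk0 : 0 ≤ k := hnonneg _ hv'
  -- Cauchy-Schwarz on the positive definite complement of `u`.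
  have hcs : m * m ≤ k * q := by
    by_cases h0 : X' = 0
    · have : m = 0 := by rw [hm, h0]; simp
      rw [this]
      have := mul_nonneg hk0 hq0
      linarith
    · have hqp : 0 < q := hpos _ hX' h0
      have h1 := hnonneg (q • v' - m • X') (by simp [hv', hX'])
      have h2 : g.form p (q • v' - m • X') (q • v' - m • X') = q * (k * q - m * m) := by
        simp only [map_sub, map_smul, LinearMap.sub_apply, LinearMap.smul_apply, smul_eq_mul,
          g.symm p v' X', ← hq, ← hm, ← hk]
        ring
      rw [h2] at h1
      linarith [nonneg_of_mul_nonneg_right h1 hqp]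
  -- If `v` were not spacelike, then `k ≤ -a²N`, while `q < -b²N` and `m = -abN`; for `a ≠ 0` this
  -- contradicts Cauchy-Schwarz, and for `a = 0` it forces `v = 0`.
  by_contra! hcon
  have hbN : 0 < -(b * b * N) := by linarith
  have hmN : m = -(b * a * N) := by linarith
  by_cases ha : a = 0
  · have hk' : v' = 0 := by
      by_contra h0
      have := hpos _ hv' h0
      rw [ha] at hcon
      linarith
    exact hv0 (by rw [ha, hk']; simp)
  · have haN : 0 < -(a * a * N) := by nlinarith [mul_self_pos.2 ha]
    have h1 : m * m = -(a * a * N) * -(b * b * N) := by rw [hmN]; ring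
    have h2 : k * q ≤ -(a * a * N) * q := mul_le_mul_of_nonneg_right (by linarith) hq0
    have h3 : -(a * a * N) * q < -(a * a * N) * -(b * b * N) :=
      mul_lt_mul_of_pos_left (by linarith) haN
    linarith

theorem isMetricOn (he : e ∈ IsManifold.maximalAtlas (𝓡 n) ∞ M) :
    IsMetricOn (g.matrix e) e.target where
  isOpen := e.open_target
  smooth := g.smooth e he
  transpose_eq x := by
    ext i j
    exact g.symm _ _ _
  det_ne_zero x hx hdet := by
    -- A kernel vector of the component matrix is orthogonal to every tangent vector.
    obtain ⟨v, hv0, hv⟩ := Matrix.exists_mulVec_eq_zero_iff.2 hdet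
    set V : Coord n := WithLp.toLp 2 v with hV
    have h1 : chartEquiv he hx V = 0 := by
      refine g.eq_zero_of_form_eq_zero fun u => ?_
      obtain ⟨u', rfl⟩ := (chartEquiv he hx).surjective u
      rw [form_chartEquiv]
      refine Finset.sum_eq_zero fun i _ => ?_
      have := congrFun hv i
      simp only [Matrix.mulVec, dotProduct, Pi.zero_apply] at this
      have e1 : ∀ j, u' i * V j * g.matrix e x i j = u' i * (g.matrix e x i j * v j) :=
        fun j => by rw [hV]; ring
      simp only [e1]
      rw [← Finset.mul_sum, this, mul_zero]
    have h2 : V = 0 := (chartEquiv he hx).injective (by rw [h1, map_zero])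
    apply hv0
    funext i
    exact congrFun (congrArg WithLp.ofLp h2) i

section Field

variable {X : ∀ p : M, TangentSpace (𝓡 n) p} {ρ : M → ℝ}

theorem lower_eq (he : e ∈ IsManifold.maximalAtlas (𝓡 n) ∞ M) (hx : x ∈ e.target) (k : Fin n) :
    g.lower X e k x = ∑ i, chartField X e x i * g.matrix e x i k := by
  rw [lower, ← form_chartEquiv_coordVec g he hx, chartEquiv_chartField]

theorem raise_lower (he : e ∈ IsManifold.maximalAtlas (𝓡 n) ∞ M) (hx : x ∈ e.target)
    (a : Fin n) : raise (g.matrix e) (g.lower X e) x a = chartField X e x a := by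
  have h := g.isMetricOn he
  have h1 : (fun a => raise (g.matrix e) (g.lower X e) x a)
      = (g.matrix e x)⁻¹.mulVec ((g.matrix e x).mulVec fun i => chartField X e x i) := by
    funext a
    simp only [raise, Matrix.mulVec, dotProduct]
    refine Finset.sum_congr rfl fun b _ => ?_
    rw [g.lower_eq he hx]
    congr 1
    exact Finset.sum_congr rfl fun i _ => by rw [h.apply_comm x b i, mul_comm]
  rw [Matrix.mulVec_mulVec, Matrix.nonsing_inv_mul _ (h.isUnit_det hx), Matrix.one_mulVec] at h1
  exact congrFun h1 a

theorem normSq_lower (he : e ∈ IsManifold.maximalAtlas (𝓡 n) ∞ M) (hx : x ∈ e.target) :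
    normSq (g.matrix e) (g.lower X e) x = g.sq X (e.symm x) := by
  rw [← pairing_raise_covector, sq, ← chartEquiv_chartField he hx X, form_chartEquiv]
  simp only [pairing, g.raise_lower he hx, g.lower_eq he hx, Finset.mul_sum]
  refine Finset.sum_congr rfl fun i _ => Finset.sum_congr rfl fun j _ => ?_
  rw [(g.isMetricOn he).apply_comm x i j]; ring

theorem isConcircularOn [IsManifold (𝓡 n) ∞ M] (hX : g.IsChenVector X ρ)
    (he : e ∈ IsManifold.maximalAtlas (𝓡 n) ∞ M) :
    IsConcircularOn (g.matrix e) e.target (g.lower X e) (fun y => ρ (e.symm y)) where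
  toIsMetricOn := g.isMetricOn he
  smooth_covector k := by
    have h1 := contDiffOn_chartField he hX.smooth
    refine (ContDiffOn.sum (s := Finset.univ) fun i _ =>
      (contDiffOn_apply h1 i).mul ((g.isMetricOn he).smooth i k)).congr fun y hy => ?_
    exact g.lower_eq he hy k
  smooth_potential := contDiffOn_comp_symm he hX.smooth_scalar
  normSq_ne_zero x hx := by
    rw [g.normSq_lower he hx]
    exact (hX.timelike _).ne
  concircular := hX.concircular e he

/-- Reflecting the sign of the metric along the timelike `X` makes it Riemannian, since the
complement of `X` is spacelike. -/
theorem posDef_flip [IsManifold (𝓡 n) ∞ M] (hX : g.IsChenVector X ρ)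
    (he : e ∈ IsManifold.maximalAtlas (𝓡 n) ∞ M)
    (hx : x ∈ e.target) :
    (Matrix.of fun a b => g.matrix e x a b - 2 / normSq (g.matrix e) (g.lower X e) x
      * (g.lower X e a x * g.lower X e b x)).PosDef := by
  refine Matrix.PosDef.of_dotProduct_mulVec_pos ?_ fun v hv0 => ?_
  · ext a b
    simp only [Matrix.conjTranspose_apply, Matrix.of_apply, star_trivial]
    rw [(g.isMetricOn he).apply_comm x a b]; ring
  · set V : Coord n := WithLp.toLp 2 v with hV
    set p := e.symm x
    set Y := chartEquiv he hx V with hY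
    have hY0 : Y ≠ 0 := fun h0 => hv0 <| by
      have : V = 0 := (chartEquiv he hx).injective (by rw [← hY, h0, map_zero])
      funext i
      exact congrFun (congrArg WithLp.ofLp this) i
    have hs : g.form p (X p) (X p) < 0 := hX.timelike p
    have h1 : g.form p (X p) Y = ∑ i, v i * g.lower X e i x := by
      rw [hY, chartEquiv_eq_sum]
      simp only [map_sum, map_smul, smul_eq_mul]
      rfl
    have h2 : g.form p Y Y = ∑ i, ∑ j, v i * v j * g.matrix e x i j := by
      rw [hY, form_chartEquiv]
    have h3 : star v ⬝ᵥ (Matrix.of fun a b => g.matrix e x a b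
        - 2 / normSq (g.matrix e) (g.lower X e) x * (g.lower X e a x * g.lower X e b x)).mulVec v
        = g.form p Y Y - 2 / g.form p (X p) (X p) * (g.form p (X p) Y * g.form p (X p) Y) := by
      rw [h1, h2, g.normSq_lower he hx]
      simp only [dotProduct, Matrix.mulVec, star_trivial, Matrix.of_apply, Finset.mul_sum,
        Finset.sum_mul, ← Finset.sum_sub_distrib]
      refine Finset.sum_congr rfl fun i _ => Finset.sum_congr rfl fun j _ => ?_
      unfold sq
      ring
    rw [h3]
    set s := g.form p (X p) (X p) with hsdef
    have hs0 : s ≠ 0 := hs.ne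
    -- `c X` is the component of `Y` along `X`; the flipped form is the square of the orthogonal
    -- remainder minus `s c²`, with `s < 0`.
    set c := g.form p (X p) Y / s with hc
    have h4 : g.form p (X p) (Y - c • X p) = 0 := by
      rw [map_sub, map_smul, smul_eq_mul, ← hsdef, hc]; field_simp; ring
    have h5 : g.form p (Y - c • X p) (Y - c • X p) = g.form p Y Y - s * c * c := by
      have e1 : g.form p (X p) Y = s * c := by rw [hc]; field_simp
      simp only [map_sub, map_smul, LinearMap.sub_apply, LinearMap.smul_apply, smul_eq_mul,
        g.symm p Y (X p), e1, ← hsdef]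
      ring
    have h6 : g.form p Y Y - 2 / s * (g.form p (X p) Y * g.form p (X p) Y)
        = g.form p (Y - c • X p) (Y - c • X p) - s * c * c := by
      rw [h5]
      have e1 : g.form p (X p) Y = s * c := by rw [hc]; field_simp
      rw [e1]
      field_simp
      ring
    rw [h6]
    by_cases hz : Y - c • X p = 0
    · have hc0 : c ≠ 0 := fun h0 => hY0 (by rw [h0, zero_smul, sub_zero] at hz; exact hz)
      rw [hz]
      have := mul_self_pos.2 hc0
      simp only [map_zero]
      nlinarith
    · have := g.form_pos_of_orthogonal_timelike hs h4 hz
      nlinarith [mul_self_nonneg c]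

end Field

end LorentzMetric

/-! ### Independence of the chart, invariants on the manifold, and the theorem. -/

theorem IsMetricOn.mono {n : ℕ} {G : Coord n → Matrix (Fin n) (Fin n) ℝ} {U V : Set (Coord n)}
    (h : IsMetricOn G U) (hV : IsOpen V) (hVU : V ⊆ U) : IsMetricOn G V where
  isOpen := hV
  smooth a b := (h.smooth a b).mono hVU
  transpose_eq := h.transpose_eq
  det_ne_zero x hx := h.det_ne_zero x (hVU hx)

namespace LorentzMetric

variable {n : ℕ} {M : Type*} [TopologicalSpace M] [ChartedSpace (Coord n) M]
  (g : LorentzMetric n M) {e e' : OpenPartialHomeomorph M (Coord n)} {x : Coord n}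

theorem form_congr {p q : M} (h : p = q) (u v : Coord n) :
    g.form p (u : TangentSpace (𝓡 n) p) (v : TangentSpace (𝓡 n) p)
      = g.form q (u : TangentSpace (𝓡 n) q) (v : TangentSpace (𝓡 n) q) := by
  subst h; rfl

theorem contDiffOn_chart_change (he : e ∈ IsManifold.maximalAtlas (𝓡 n) ∞ M)
    (he' : e' ∈ IsManifold.maximalAtlas (𝓡 n) ∞ M) :
    ContDiffOn ℝ ∞ (fun y => e' (e.symm y)) (e.target ∩ e.symm ⁻¹' e'.source) :=
  contMDiffOn_iff_contDiffOn.1 ((contMDiffOn_of_mem_maximalAtlas he').comp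
    ((contMDiffOn_symm_of_mem_maximalAtlas he).mono Set.inter_subset_left) fun _ hy => hy.2)

/-- Differentiating `e'.symm ∘ φ = e.symm` shows that the coordinate vectors are related by the
Jacobian. -/
theorem isPullbackOn (he : e ∈ IsManifold.maximalAtlas (𝓡 n) ∞ M)
    (he' : e' ∈ IsManifold.maximalAtlas (𝓡 n) ∞ M) :
    IsPullbackOn (fun y => e' (e.symm y)) (g.matrix e) (g.matrix e')
      (e.target ∩ e.symm ⁻¹' e'.source) e'.target where
  source := (g.isMetricOn he).mono (e.isOpen_inter_preimage_symm e'.open_source)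
    Set.inter_subset_left
  target := g.isMetricOn he'
  contDiffOn := contDiffOn_chart_change he he'
  mapsTo _ hy := e'.map_source hy.2
  pullback x hx := by
    have hW := e.isOpen_inter_preimage_symm e'.open_source
    set φ : Coord n → Coord n := fun y => e' (e.symm y) with hφdef
    have hφ : DifferentiableAt ℝ φ x :=
      ((contDiffOn_chart_change he he').contDiffAt (hW.mem_nhds hx)).differentiableAt (by simp)
    have hxt : φ x ∈ e'.target := e'.map_source hx.2
    have hp : e'.symm (φ x) = e.symm x := e'.left_inv hx.2
    have h1 : mfderiv (𝓡 n) (𝓡 n) (e'.symm ∘ φ) x = _ :=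
      mfderiv_comp x ((mdifferentiable_of_mem_maximalAtlas he').mdifferentiableAt_symm hxt)
        hφ.mdifferentiableAt
    have h2 : mfderiv (𝓡 n) (𝓡 n) (e'.symm ∘ φ) x = mfderiv (𝓡 n) (𝓡 n) e.symm x := by
      refine Filter.EventuallyEq.mfderiv_eq
        (Filter.eventually_of_mem (hW.mem_nhds hx) fun y hy => ?_)
      exact e'.left_inv hy.2
    have h3 : ∀ i, (coordVec e i x : Coord n)
        = chartEquiv he' hxt (fderiv ℝ φ x (EuclideanSpace.single i 1)) := by
      intro i
      have := congrArg (fun L : Coord n →L[ℝ] Coord n => L (EuclideanSpace.single i 1))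
        (h2.symm.trans h1)
      rw [mfderiv_eq_fderiv] at this
      exact this
    have h4 : ∀ i a, fderiv ℝ φ x (EuclideanSpace.single i 1) a = jacobian φ x a i := by
      intro i a
      rw [fderiv_single hφ]
      simp [Finset.sum_apply, Pi.single_apply]
    ext i j
    have h5 : g.matrix e x i j = g.form (e'.symm (φ x))
        (chartEquiv he' hxt (fderiv ℝ φ x (EuclideanSpace.single i 1)))
        (chartEquiv he' hxt (fderiv ℝ φ x (EuclideanSpace.single j 1))) := by
      have := g.form_congr hp (coordVec e i x) (coordVec e j x)
      rw [h3 i, h3 j] at this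
      refine Eq.trans ?_ this.symm
      rw [← h3 i, ← h3 j]
      rfl
    rw [h5, form_chartEquiv]
    simp only [h4, Matrix.mul_apply, Matrix.transpose_apply, Finset.sum_mul]
    rw [Finset.sum_comm]
    exact Finset.sum_congr rfl fun a _ => Finset.sum_congr rfl fun b _ => by ring

/-- The curvature scalar as a function on the manifold. -/
def scalarCurvature (p : M) : ℝ :=
  scalar (g.matrix (chartAt (Coord n) p)) (chartAt (Coord n) p p)

/-- The squared length of the Ricci tensor as a function on the manifold. -/
def ricciNormSq (p : M) : ℝ :=
  (mixedRicci (g.matrix (chartAt (Coord n) p)) (chartAt (Coord n) p p)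
    * mixedRicci (g.matrix (chartAt (Coord n) p)) (chartAt (Coord n) p p)).trace

/-- The derivative `X f` of the function `f` along the vector field `X`. -/
def dirDeriv (X : ∀ p : M, TangentSpace (𝓡 n) p) (f : M → ℝ) (p : M) : ℝ :=
  mfderiv (𝓡 n) 𝓘(ℝ, ℝ) f p (X p)

/-- The eigenvalue of the Ricci tensor on a Chen vector as a function on the manifold. -/
def chenEigenvalue (X : ∀ p : M, TangentSpace (𝓡 n) p) (ρ : M → ℝ) (p : M) : ℝ :=
  -((n : ℝ) - 1) * (dirDeriv X ρ p / g.sq X p)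

/-- The eigenvalue of the Ricci tensor of a perfect fluid on the orthogonal complement of a Chen
vector, as a function on the manifold. -/
def chenTransverseEigenvalue (X : ∀ p : M, TangentSpace (𝓡 n) p) (ρ : M → ℝ) (p : M) : ℝ :=
  1 / ((n : ℝ) - 1) * (g.scalarCurvature p - g.chenEigenvalue X ρ p)

/-- The anisotropy as a function on the manifold. -/
def chenAnisotropy (X : ∀ p : M, TangentSpace (𝓡 n) p) (ρ : M → ℝ) (p : M) : ℝ :=
  g.ricciNormSq p - g.chenEigenvalue X ρ p * g.chenEigenvalue X ρ p
    - 1 / ((n : ℝ) - 1) * ((g.scalarCurvature p - g.chenEigenvalue X ρ p)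
      * (g.scalarCurvature p - g.chenEigenvalue X ρ p))

theorem pairing_raise_lower_pd (he : e ∈ IsManifold.maximalAtlas (𝓡 n) ∞ M) (hx : x ∈ e.target)
    {X : ∀ p : M, TangentSpace (𝓡 n) p}
    {f : M → ℝ} (hf : ContMDiff (𝓡 n) 𝓘(ℝ, ℝ) ∞ f) :
    pairing (raise (g.matrix e) (g.lower X e) x) (fun a => pd a (fun y => f (e.symm y)) x)
      = dirDeriv X f (e.symm x) := by
  rw [dirDeriv]
  have h1 := mfderiv_eq_sum_pd he hx (hf.mdifferentiable (by simp) (e.symm x)) (chartField X e x)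
  rw [chartEquiv_chartField] at h1
  rw [h1]
  simp only [pairing, g.raise_lower he hx]

/-- Carries the vanishing of the anisotropy from a point with `ρ ≠ 0` to the whole integral curve.
-/
theorem _root_.IsMIntegralCurveOn.eq_of_dirDeriv_eq_zero {X : ∀ p : M, TangentSpace (𝓡 n) p}
    {γ : ℝ → M} {a b : ℝ}
    (hγ : IsMIntegralCurveOn γ X (Set.Ioo a b)) {f : M → ℝ}
    (hf : ContMDiff (𝓡 n) 𝓘(ℝ, ℝ) ∞ f) (hfX : ∀ p, dirDeriv X f p = 0) {s t : ℝ}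
    (hs : s ∈ Set.Ioo a b) (ht : t ∈ Set.Ioo a b) : f (γ s) = f (γ t) := by
  have key : ∀ τ ∈ Set.Ioo a b, HasDerivAt (f ∘ γ) 0 τ := by
    intro τ hτ
    have h1 := (hγ τ hτ).hasMFDerivAt (Ioo_mem_nhds hτ.1 hτ.2)
    obtain ⟨L, hL, hL1⟩ : ∃ L : ℝ →L[ℝ] ℝ, HasFDerivAt (f ∘ γ) L τ ∧ L 1 = 0 :=
      ⟨_, ((hf.mdifferentiable (by simp) (γ τ)).hasMFDerivAt.comp τ h1).hasFDerivAt,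
        (congrArg (mfderiv (𝓡 n) 𝓘(ℝ, ℝ) f (γ τ)) (one_smul ℝ (X (γ τ)))).trans (hfX (γ τ))⟩
    exact hL1 ▸ hL.hasDerivAt
  exact isOpen_Ioo.is_const_of_deriv_eq_zero isPreconnected_Ioo
    (fun τ hτ => (key τ hτ).differentiableAt.differentiableWithinAt)
    (fun τ hτ => (key τ hτ).deriv) hs ht

variable [IsManifold (𝓡 n) ∞ M] {X : ∀ p : M, TangentSpace (𝓡 n) p} {ρ : M → ℝ}

/-- The definition uses the preferred chart, which jumps from point to point. Invariance replaces it
by one fixed chart, from which smoothness follows. -/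
theorem scalarCurvature_eq (he : e ∈ IsManifold.maximalAtlas (𝓡 n) ∞ M) (hx : x ∈ e.target) :
    g.scalarCurvature (e.symm x) = scalar (g.matrix e) x :=
  ((g.isPullbackOn he (IsManifold.chart_mem_maximalAtlas (e.symm x))).scalar_eq
    ⟨hx, mem_chart_source _ _⟩).symm

theorem ricciNormSq_eq (he : e ∈ IsManifold.maximalAtlas (𝓡 n) ∞ M) (hx : x ∈ e.target) :
    g.ricciNormSq (e.symm x) = (mixedRicci (g.matrix e) x * mixedRicci (g.matrix e) x).trace :=
  ((g.isPullbackOn he (IsManifold.chart_mem_maximalAtlas (e.symm x))).trace_mixedRicci_mul_self_eq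
    ⟨hx, mem_chart_source _ _⟩).symm

theorem chenEigenvalue_eq (hX : g.IsChenVector X ρ) (he : e ∈ IsManifold.maximalAtlas (𝓡 n) ∞ M)
    (hx : x ∈ e.target) : g.chenEigenvalue X ρ (e.symm x)
      = eigenvalue (g.matrix e) (g.lower X e) (fun y => ρ (e.symm y)) x := by
  rw [chenEigenvalue, ← g.pairing_raise_lower_pd he hx hX.smooth_scalar, ← g.normSq_lower he hx]
  rfl

theorem chenTransverseEigenvalue_eq (hX : g.IsChenVector X ρ)
    (he : e ∈ IsManifold.maximalAtlas (𝓡 n) ∞ M) (hx : x ∈ e.target) :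
    g.chenTransverseEigenvalue X ρ (e.symm x)
      = transverseEigenvalue (g.matrix e) (g.lower X e) (fun y => ρ (e.symm y)) x := by
  rw [chenTransverseEigenvalue, g.chenEigenvalue_eq hX he hx, g.scalarCurvature_eq he hx]
  rfl

theorem chenAnisotropy_eq (hX : g.IsChenVector X ρ)
    (he : e ∈ IsManifold.maximalAtlas (𝓡 n) ∞ M) (hx : x ∈ e.target) :
    g.chenAnisotropy X ρ (e.symm x)
      = anisotropy (g.matrix e) (g.lower X e) (fun y => ρ (e.symm y)) x := by
  rw [chenAnisotropy, g.chenEigenvalue_eq hX he hx, g.scalarCurvature_eq he hx,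
    g.ricciNormSq_eq he hx]
  rfl

theorem contMDiff_chenEigenvalue (hX : g.IsChenVector X ρ) :
    ContMDiff (𝓡 n) 𝓘(ℝ, ℝ) ∞ (g.chenEigenvalue X ρ) :=
  contMDiff_of_contDiffOn_comp_symm fun _ he =>
    (g.isConcircularOn hX he).smooth_eigenvalue.congr fun _ hy => g.chenEigenvalue_eq hX he hy

theorem contMDiff_chenTransverseEigenvalue (hX : g.IsChenVector X ρ) :
    ContMDiff (𝓡 n) 𝓘(ℝ, ℝ) ∞ (g.chenTransverseEigenvalue X ρ) :=
  contMDiff_of_contDiffOn_comp_symm fun _ he =>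
    ((contDiffOn_const (c := 1 / ((n : ℝ) - 1))).mul ((g.isMetricOn he).smooth_scalar.sub
      (g.isConcircularOn hX he).smooth_eigenvalue)).congr
        fun _ hy => g.chenTransverseEigenvalue_eq hX he hy

theorem contMDiff_chenAnisotropy (hX : g.IsChenVector X ρ) :
    ContMDiff (𝓡 n) 𝓘(ℝ, ℝ) ∞ (g.chenAnisotropy X ρ) :=
  contMDiff_of_contDiffOn_comp_symm fun _ he =>
    (g.isConcircularOn hX he).smooth_anisotropy.congr fun _ hy => g.chenAnisotropy_eq hX he hy

/-- The coefficients in `IsFluidAt` are invariants of the metric, `X` and `ρ`, so a pointwise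
property already provides smooth global `α` and `β`. -/
theorem isPerfectFluid_of_isFluidAt (hX : g.IsChenVector X ρ)
    (h : ∀ e ∈ IsManifold.maximalAtlas (𝓡 n) ∞ M, ∀ x ∈ e.target,
      IsFluidAt (g.matrix e) (g.lower X e) (fun y => ρ (e.symm y)) x) : g.IsPerfectFluid X := by
  refine ⟨g.chenTransverseEigenvalue X ρ,
    fun p => g.chenEigenvalue X ρ p - g.chenTransverseEigenvalue X ρ p,
    g.contMDiff_chenTransverseEigenvalue hX,
    (g.contMDiff_chenEigenvalue hX).sub (g.contMDiff_chenTransverseEigenvalue hX),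
    fun e he x hx j k => ?_⟩
  beta_reduce
  rw [h e he x hx j k, g.chenTransverseEigenvalue_eq hX he hx, g.chenEigenvalue_eq hX he hx,
    g.normSq_lower he hx]
  ring

theorem harmonicWeyl_of_isPerfectFluid (hn : 3 ≤ n) (hX : g.IsChenVector X ρ)
    (h : g.IsPerfectFluid X) : g.HarmonicWeyl := by
  obtain ⟨α, β, hα, hβ, hR⟩ := h
  intro e he x hx j k l
  have hc := g.isConcircularOn hX he
  -- The coefficient `b` of `X_j X_k` is `β / X²`, smooth because `X` is nowhere null.
  refine hc.divWeyl_eq_zero_of_fluid hn hx (contDiffOn_comp_symm he hα)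
    ((contDiffOn_comp_symm he hβ).fun_div hc.smooth_normSq hc.normSq_ne_zero) (fun y hy k l => ?_) j k l
  rw [hR e he y hy k l, g.normSq_lower he hy]
  ring

theorem exists_chart_eq (p : M) : ∃ e ∈ IsManifold.maximalAtlas (𝓡 n) ∞ M,
    ∃ x ∈ e.target, e.symm x = p :=
  ⟨chartAt (Coord n) p, IsManifold.chart_mem_maximalAtlas p, chartAt (Coord n) p p,
    mem_chart_target _ p, (chartAt (Coord n) p).left_inv (mem_chart_source _ p)⟩

theorem mul_chenAnisotropy_eq_zero (hn : 4 ≤ n) (hX : g.IsChenVector X ρ) (h : g.HarmonicWeyl)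
    (p : M) : ρ p * g.chenAnisotropy X ρ p = 0 := by
  obtain ⟨e, he, x, hx, rfl⟩ := exists_chart_eq (n := n) p
  rw [g.chenAnisotropy_eq hX he hx]
  exact (g.isConcircularOn hX he).mul_anisotropy_eq_zero hn hx (h e he x hx)

theorem dirDeriv_chenAnisotropy (hn : 4 ≤ n) (hX : g.IsChenVector X ρ) (h : g.HarmonicWeyl)
    (p : M) : dirDeriv X (g.chenAnisotropy X ρ) p = 0 := by
  obtain ⟨e, he, x, hx, rfl⟩ := exists_chart_eq (n := n) p
  rw [← g.pairing_raise_lower_pd he hx (g.contMDiff_chenAnisotropy hX)]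
  refine Eq.trans ?_ ((g.isConcircularOn hX he).pairing_pd_anisotropy hn hx (h e he x hx))
  congr 1
  funext s
  exact pd_congr e.open_target (fun y hy => g.chenAnisotropy_eq hX he hy) hx s

theorem isPerfectFluid_of_harmonicWeyl (hn : 4 ≤ n) (hX : g.IsChenVector X ρ)
    (hns : NonStatic X ρ) (h : g.HarmonicWeyl) : g.IsPerfectFluid X := by
  refine g.isPerfectFluid_of_isFluidAt hX fun e he x hx => ?_
  refine (g.isConcircularOn hX he).isFluidAt_of_anisotropy_eq_zero (by omega) hx
    (g.posDef_flip hX he hx) ?_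
  rw [← g.chenAnisotropy_eq hX he hx]
  obtain ⟨γ, a, b, hγ, ⟨s, hs, hsp⟩, t, ht, hρ⟩ := hns (e.symm x)
  rw [← hsp, hγ.eq_of_dirDeriv_eq_zero (g.contMDiff_chenAnisotropy hX)
    (g.dirDeriv_chenAnisotropy hn hX h) hs ht]
  exact (mul_eq_zero.1 (g.mul_chenAnisotropy_eq_zero hn hX h (γ t))).resolve_left hρ

end LorentzMetric

theorem LorentzMetric.isPerfectFluid_of_dim_three {M : Type*} [TopologicalSpace M]
    [ChartedSpace (Coord 3) M] [IsManifold (𝓡 3) ∞ M] (g : LorentzMetric 3 M)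
    {X : ∀ p : M, TangentSpace (𝓡 3) p} {ρ : M → ℝ} (hX : g.IsChenVector X ρ) :
    g.IsPerfectFluid X :=
  g.isPerfectFluid_of_isFluidAt hX fun _ he _ hx =>
    (g.isConcircularOn hX he).isFluidAt_of_dim_three hx

end GRW

end

/-- The hypothesis `4 ≤ n → NonStatic` encodes the alternative "`n = 3` or non-static": it is
vacuous for `n = 3`, where both conditions always hold. -/
theorem mainTheorem2 {n : ℕ} (hn : 3 ≤ n) {M : Type*} [TopologicalSpace M]
    [ChartedSpace (GRW.Coord n) M] [IsManifold (𝓡 n) ∞ M] (g : GRW.LorentzMetric n M)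
    (X : ∀ p : M, TangentSpace (𝓡 n) p) (ρ : M → ℝ) (hX : g.IsChenVector X ρ) :
    (g.IsPerfectFluid X → g.HarmonicWeyl) ∧
      ((4 ≤ n → GRW.NonStatic X ρ) → (g.HarmonicWeyl ↔ g.IsPerfectFluid X)) := by
  refine ⟨g.harmonicWeyl_of_isPerfectFluid hn hX, fun hns =>
    ⟨fun h => ?_, g.harmonicWeyl_of_isPerfectFluid hn hX⟩⟩
  rcases hn.eq_or_lt with rfl | hn4
  · exact g.isPerfectFluid_of_dim_three hX
  · exact g.isPerfectFluid_of_harmonicWeyl hn4 hX (hns hn4) h
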